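/- Let $L=\left\{\begin{pmatrix} b& c\\ -a&-b\end{pmatrix}: a,b,c\in\mathbb Z\right\}$ be the even lattice of signature $(1,2)$ with $q(X)=\det X$ and $(X,Y)=q(X+Y)-q(X)-q(Y)$. For a lattice $M$ let $M'$ be its dual lattice, and let $\mathfrak e_X$ ($X\in M'$) be the standard basis vectors of $\mathbb C[M'/M]$. Write $e(x)=e^{2\pi i x}$, and let $\tau=u+iv$ and $z=x+iy$ be in the upper half-plane $\mathbb H$. Let $X_z$ and $X_{z^\perp}$ be the orthogonal projections of $X$ to the line spanned by $X(z)=\frac1{\sqrt2 y}\begin{pmatrix}-x&|z|^2\\-1&x\end{pmatrix}$ and to its orthogonal complement. Put $$\Theta_L(\tau,z)=v\sum_{X\in L'}e\big(q(X_z)\tau+q(X_{z^\perp})\overline\tau\big)\mathfrak e_X,\qquad R_0=2i\frac{\partial}{\partial z}.$$ Let $a,b,c\in\mathbb Z$ with $a>0$ be such that $D=b^2-4ac$ is positive and not a square. Let $A=\begin{pmatrix} b/2&c\\-a&-b/2\end{pmatrix}\in L'$, $I=L\cap(\mathbb QA)^\perp$ and $N=L\cap\mathbb QA$. Let $\Gamma=\mathrm{PSL}_2(\mathbb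 Z)$ act by $g.X=gXg^{-1}$, let $\Gamma_A$ be the stabilizer of $A$ in $\Gamma$, and let $S_A=\{z\in\mathbb H: a|z|^2+bx+c=0\}$, oriented counter-clockwise. For $f$ transforming with weight $2$ for $\Gamma$ put $\mathcal C_A(f)=\int_{\Gamma_A\backslash S_A}f(z)\,dz$. Let $w=\frac{-b-\sqrt D}{2a}$, $Y_0=\begin{pmatrix}-w&w^2\\-1&w\end{pmatrix}$, and define $$\vartheta_I(\tau)=\sum_{\substack{Y\in\Gamma_A\backslash I'\\ q(Y)>0}}\frac{\operatorname{sgn}(Y,Y_0)}{|\Gamma_Y|}\,e(q(Y)\tau)\,\mathfrak e_Y,\qquad \Theta_{3/2,N}(\tau)=\sum_{W\in N'}(W,A)\,e(-q(W)\tau)\,\mathfrak e_W,$$ where $\Gamma_Y$ is the stabilizer of $Y$ in $\Gamma_A$. Let $\mathfrak e_Y\otimes\mathfrak e_W=\mathfrak e_{Y+W}$ for $Y\in I'$, $W\in N'$. For $g\in\mathbb C[(I\oplus N)'/(I\oplus N)]$ let $g^L\in\mathbb C[L'/L]$ be given by $(g^L)_\gamma=\sum_{\beta\in L/(I\oplus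 N)}g_{\beta+\gamma}$. Then, for every $\tau\in\mathbb H$, the three series above converge absolutely, $\Theta_L(\tau,z)$ is real-differentiable in $z$, $I\oplus N$ has finite index in $L$, the cycle integral below converges absolutely, and $$\mathcal C_A\big(R_0\Theta_L(\tau,\cdot)\big)=-\frac{4\pi}{\sqrt D}\Big(\vartheta_I(\tau)\otimes\overline{\Theta_{3/2,N}(\tau)}\,v^{3/2}\Big)^L .$$ -/

import Mathlib

open scoped MatrixGroups UpperHalfPlane

noncomputable section

namespace SiegelTheta

/-- The ambient space of real `2 × 2` matrices. The quadratic space of signature `(1,2)` is its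
subspace of matrices of trace zero, the real span of the lattice `latticeL`. -/
abbrev V : Type := Matrix (Fin 2) (Fin 2) ℝ

/-- The quadratic form `q(X) = det X`. -/
def q (X : V) : ℝ := X.det

/-- The bilinear form `(X, Y) = q(X + Y) - q(X) - q(Y)`, so that `(X, X) = 2 q(X)`. -/
def bil (X Y : V) : ℝ := QuadraticMap.polar q X Y

/-- The matrix of the binary quadratic form `[a, b, c]`. -/
def formMatrix (a b c : ℝ) : V := !![b / 2, c; -a, -b / 2]

lemma bil_eq (X Y : V) :
    bil X Y = X 0 0 * Y 1 1 + Y 0 0 * X 1 1 - X 0 1 * Y 1 0 - Y 0 1 * X 1 0 := by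
  simp only [bil, QuadraticMap.polar, q, Matrix.det_fin_two, Matrix.add_apply]
  ring

lemma bil_add_left (X Y Z : V) : bil (X + Y) Z = bil X Z + bil Y Z := by
  simp only [bil_eq, Matrix.add_apply]; ring

lemma bil_neg_left (X Z : V) : bil (-X) Z = -bil X Z := by
  simp only [bil_eq, Matrix.neg_apply]; ring

lemma bil_zero_left (Z : V) : bil 0 Z = 0 := by
  simp [bil_eq]

/-- The even lattice `L` of all `(b, c; -a, -b)` with `a, b, c ∈ ℤ`. -/
def latticeL : AddSubgroup V where
  carrier := {X | ∃ a b c : ℤ, X = !![(b : ℝ), (c : ℝ); -(a : ℝ), -(b : ℝ)]}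
  zero_mem' := ⟨0, 0, 0, by ext i j; fin_cases i <;> fin_cases j <;> simp⟩
  add_mem' := by
    rintro _ _ ⟨a, b, c, rfl⟩ ⟨a', b', c', rfl⟩
    refine ⟨a + a', b + b', c + c', ?_⟩
    ext i j; fin_cases i <;> fin_cases j <;> simp <;> ring
  neg_mem' := by
    rintro _ ⟨a, b, c, rfl⟩
    refine ⟨-a, -b, -c, ?_⟩
    ext i j; fin_cases i <;> fin_cases j <;> simp

/-- The sublattice `I = L ∩ (ℚ A)^⊥`. -/
def latticeI (A : V) : AddSubgroup V where
  carrier := {X | X ∈ latticeL ∧ bil X A = 0}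
  zero_mem' := ⟨zero_mem _, bil_zero_left A⟩
  add_mem' := fun hX hY => ⟨add_mem hX.1 hY.1, by rw [bil_add_left, hX.2, hY.2, add_zero]⟩
  neg_mem' := fun hX => ⟨neg_mem hX.1, by rw [bil_neg_left, hX.2, neg_zero]⟩

/-- The sublattice `N = L ∩ ℚ A`. -/
def latticeN (A : V) : AddSubgroup V where
  carrier := {X | X ∈ latticeL ∧ ∃ r : ℚ, X = (r : ℝ) • A}
  zero_mem' := ⟨zero_mem _, 0, by simp⟩
  add_mem' := by
    rintro X Y ⟨hX, r, hr⟩ ⟨hY, s, hs⟩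
    exact ⟨add_mem hX hY, r + s, by rw [hr, hs]; push_cast; rw [add_smul]⟩
  neg_mem' := by
    rintro X ⟨hX, r, hr⟩
    exact ⟨neg_mem hX, -r, by rw [hr]; push_cast; rw [neg_smul]⟩

/-- The dual lattice `M' = {X ∈ M ⊗ ℝ : (X, Y) ∈ ℤ for all Y ∈ M}`. -/
def dual (M : AddSubgroup V) : AddSubgroup V where
  carrier := {X | X ∈ Submodule.span ℝ (M : Set V) ∧ ∀ Y ∈ M, ∃ n : ℤ, bil X Y = n}
  zero_mem' := ⟨zero_mem _, fun Y _ => ⟨0, by rw [bil_zero_left]; simp⟩⟩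
  add_mem' := by
    rintro X X' ⟨hX, h⟩ ⟨hX', h'⟩
    refine ⟨add_mem hX hX', fun Y hY => ?_⟩
    obtain ⟨n, hn⟩ := h Y hY
    obtain ⟨m, hm⟩ := h' Y hY
    exact ⟨n + m, by rw [bil_add_left, hn, hm]; push_cast; rfl⟩
  neg_mem' := by
    rintro X ⟨hX, h⟩
    refine ⟨neg_mem hX, fun Y hY => ?_⟩
    obtain ⟨n, hn⟩ := h Y hY
    exact ⟨-n, by rw [bil_neg_left, hn]; push_cast; rfl⟩

/-- The discriminant group `M' / M`. -/
abbrev Disc (M : AddSubgroup V) : Type := dual M ⧸ M.addSubgroupOf (dual M)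

/-- The underlying space of the group ring `ℂ[M'/M]`: the function `g` stands for
`∑_γ g(γ) 𝔢_γ`. -/
abbrev GroupRing (M : AddSubgroup V) : Type := Disc M → ℂ

/-- The class `X + M` of `X ∈ M'`. -/
def toDisc (M : AddSubgroup V) (X : dual M) : Disc M := QuotientAddGroup.mk X

open Classical in
/-- The coefficient `g_X = g_{X + M}` for `X ∈ M'` (and `0` for a vector `X` outside `M'`). -/
def coeff {M : AddSubgroup V} (g : GroupRing M) (X : V) : ℂ :=
  if h : X ∈ dual M then g (toDisc M ⟨X, h⟩) else 0

/-- The map `g ↦ g^L` from `ℂ[M'/M]` to `ℂ[L'/L]` for a sublattice `M ⊆ L` of finite index: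
`(g^L)_γ = ∑_{β ∈ L/M} g_{β + γ}`. -/
def up {M : AddSubgroup V} (L : AddSubgroup V) (g : GroupRing M) : GroupRing L := fun γ =>
  ∑ᶠ β : L ⧸ M.addSubgroupOf L,
    coeff g ((Quotient.out β : L) + (Quotient.out γ : dual L) : V)

/-- The orthogonal projection of `X` to the line spanned by `A`. -/
def projLine (A X : V) : V := (bil X A / bil A A) • A

/-- The orthogonal projection of `X` to the orthogonal complement of `A`. -/
def projPerp (A X : V) : V := X - projLine A X

/-- The tensor product `ℂ[I'/I] × ℂ[N'/N] → ℂ[(I ⊕ N)'/(I ⊕ N)]`, determined by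
`𝔢_Y ⊗ 𝔢_W = 𝔢_{Y + W}`: the coefficient of `f ⊗ h` at `X = Y + W` with `Y ∈ I'` and `W ∈ N'`
is `f_Y h_W`. -/
def tensor (A : V) (f : GroupRing (latticeI A)) (h : GroupRing (latticeN A)) :
    GroupRing (latticeI A ⊔ latticeN A) := fun δ =>
  coeff f (projPerp A (Quotient.out δ : dual (latticeI A ⊔ latticeN A))) *
    coeff h (projLine A (Quotient.out δ : dual (latticeI A ⊔ latticeN A)))

/-- `e(x) = exp(2πix)`. -/
def e (x : ℂ) : ℂ := Complex.exp (2 * Real.pi * Complex.I * x)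

/-- The vector `X(z)`, which spans the positive line attached to `z`. -/
def posVec (z : ℂ) : V :=
  (1 / (√2 * z.im)) • !![-z.re, ‖z‖ ^ 2; -1, z.re]

/-- The summand of index `X` of the Siegel theta function (without the factor `v`),
`e(q(X_z) τ + q(X_{z^⊥}) \bar τ)`, where `X_z` and `X_{z^⊥}` are the orthogonal projections of `X`
to the line spanned by `X(z)` and to its orthogonal complement. -/
def siegelTerm (τ : ℍ) (z : ℂ) (X : V) : ℂ :=
  e ((q (projLine (posVec z) X) : ℂ) * τ +
    (q (projPerp (posVec z) X) : ℂ) * (starRingEnd ℂ) (τ : ℂ))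

/-- The Siegel theta function `Θ_L(τ, z) = v ∑_{X ∈ L'} e(q(X_z) τ + q(X_{z^⊥}) \bar τ) 𝔢_X`,
for `z` in the upper half-plane (as a subset of `ℂ`). -/
def siegelTheta (τ : ℍ) (z : ℂ) : GroupRing latticeL := fun γ =>
  (τ.im : ℂ) * ∑' X : {X : dual latticeL // toDisc latticeL X = γ}, siegelTerm τ z X.1

/-- The Wirtinger derivative `∂f/∂z = (∂f/∂x - i ∂f/∂y) / 2`. -/
def dWirtinger (f : ℂ → ℂ) (z : ℂ) : ℂ :=
  (fderiv ℝ f z 1 - Complex.I * fderiv ℝ f z Complex.I) / 2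

/-- The raising operator `R_κ = 2i ∂/∂z + κ / y`. -/
def raising (κ : ℝ) (f : ℂ → ℂ) (z : ℂ) : ℂ :=
  2 * Complex.I * dWirtinger f z + (κ : ℂ) / (z.im : ℂ) * f z

/-- The action `g.X = g X g⁻¹` of `SL₂(ℤ)`. -/
def conj (g : SL(2, ℤ)) (X : V) : V :=
  (g : Matrix (Fin 2) (Fin 2) ℤ).map (Int.cast : ℤ → ℝ) * X *
    ((g⁻¹ : SL(2, ℤ)) : Matrix (Fin 2) (Fin 2) ℤ).map (Int.cast : ℤ → ℝ)

lemma conj_one (X : V) : conj 1 X = X := by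
  simp [conj, Matrix.map_one]

lemma conj_mul (g h : SL(2, ℤ)) (X : V) : conj (g * h) X = conj g (conj h X) := by
  simp only [conj, mul_inv_rev, Matrix.SpecialLinearGroup.coe_mul]
  rw [show (Int.cast : ℤ → ℝ) = (Int.castRingHom ℝ : ℤ → ℝ) from rfl, Matrix.map_mul,
    Matrix.map_mul]
  simp only [Matrix.mul_assoc]

lemma conj_inv_eq {g : SL(2, ℤ)} {X Y : V} (h : conj g X = Y) : conj g⁻¹ Y = X := by
  rw [← h, ← conj_mul, inv_mul_cancel, conj_one]

/-- The stabilizer of `X` in `SL₂(ℤ)`. Its image in `PSL₂(ℤ)` is the group `Γ_X`. -/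
def stab (X : V) : Subgroup SL(2, ℤ) where
  carrier := {g | conj g X = X}
  one_mem' := conj_one X
  mul_mem' := by
    intro g h hg hh
    change conj (g * h) X = X
    rw [conj_mul, hh, hg]
  inv_mem' := by
    intro g hg
    exact conj_inv_eq hg

/-- The order of the stabilizer of `Y` in `Γ_A ⊆ PSL₂(ℤ)`. -/
def stabOrder (A Y : V) : ℕ :=
  Nat.card ((stab A ⊓ stab Y).map
    (QuotientGroup.mk' (Subgroup.center SL(2, ℤ))) :
      Subgroup (Matrix.ProjectiveSpecialLinearGroup (Fin 2) ℤ))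

/-- The vectors `Y ∈ I'` with `q(Y) > 0` in the class `γ ∈ I'/I`. -/
abbrev HeckeIndex (A : V) (γ : Disc (latticeI A)) : Type :=
  {Y : dual (latticeI A) // toDisc (latticeI A) Y = γ ∧ 0 < q Y}

/-- Equivalence of vectors under `Γ_A`. -/
def heckeSetoid (A : V) (γ : Disc (latticeI A)) : Setoid (HeckeIndex A γ) where
  r Y Y' := ∃ g ∈ stab A, conj g (Y.1 : V) = (Y'.1 : V)
  iseqv :=
    { refl := fun Y => ⟨1, one_mem _, conj_one _⟩
      symm := by
        rintro Y Y' ⟨g, hg, h⟩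
        exact ⟨g⁻¹, inv_mem hg, conj_inv_eq h⟩
      trans := by
        rintro Y Y' Y'' ⟨g, hg, h⟩ ⟨g', hg', h'⟩
        exact ⟨g' * g, mul_mem hg' hg, by rw [conj_mul, h, h']⟩ }

/-- The smaller real endpoint `w = (-b - √D) / (2a)` of the geodesic of `[a, b, c]`, `a > 0`. -/
def endpoint (a b c : ℝ) : ℝ := (-b - √(b ^ 2 - 4 * a * c)) / (2 * a)

/-- The vector `Y₀ = (-w, w²; -1, w)`. -/
def vecY0 (a b c : ℝ) : V :=
  !![-endpoint a b c, endpoint a b c ^ 2; -1, endpoint a b c]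

/-- The summand `sgn(Y, Y₀) / |Γ_Y| · e(q(Y) τ)` of Hecke's theta series; it only depends on the
`Γ_A`-orbit of `Y`. -/
def heckeTerm (a b c : ℝ) (τ : ℍ) (Y : V) : ℂ :=
  ((bil Y (vecY0 a b c)).sign : ℂ) / (stabOrder (formMatrix a b c) Y : ℂ) * e ((q Y : ℂ) * τ)

/-- Hecke's indefinite theta series
`ϑ_I(τ) = ∑_{Y ∈ Γ_I \ I', q(Y) > 0} sgn(Y, Y₀) / |Γ_Y| · e(q(Y) τ) 𝔢_Y`, with `Γ_I = Γ_A`. -/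
def heckeTheta (a b c : ℝ) (τ : ℍ) : GroupRing (latticeI (formMatrix a b c)) := fun γ =>
  ∑' Y : Quotient (heckeSetoid (formMatrix a b c) γ),
    heckeTerm a b c τ (Quotient.out Y).1

/-- The summand `(W, A) e(-q(W) τ)` of the unary theta series. -/
def unaryTerm (A : V) (τ : ℍ) (W : V) : ℂ := (bil W A : ℂ) * e (-(q W : ℂ) * τ)

/-- The unary theta series `Θ_{3/2,N}(τ) = ∑_{W ∈ N'} (W, A) e(-q(W) τ) 𝔢_W`. -/
def unaryTheta (A : V) (τ : ℍ) : GroupRing (latticeN A) := fun γ =>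
  ∑' W : {W : dual (latticeN A) // toDisc (latticeN A) W = γ}, unaryTerm A τ W.1

/-- The geodesic `S_A = {z ∈ ℍ : a|z|² + b Re(z) + c = 0}`. -/
def geodesic (a b c : ℝ) : Set ℍ := {z | a * ‖(z : ℂ)‖ ^ 2 + b * z.re + c = 0}

/-- The parametrization by hyperbolic arc length of the semicircle `S_A`, `a > 0`, with centre
`-b/(2a)` and radius `√D/(2a)`, oriented counter-clockwise, that is, from the larger to the smaller
real endpoint. -/
def geodesicPath (a b c : ℝ) (s : ℝ) : ℂ :=
  ((-b / (2 * a) - √(b ^ 2 - 4 * a * c) / (2 * a) * Real.tanh s : ℝ) : ℂ) +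
    ((√(b ^ 2 - 4 * a * c) / (2 * a) / Real.cosh s : ℝ) : ℂ) * Complex.I

/-- `F` is a (measurable, strict) fundamental domain for the action of `Γ_A` on `S_A`: it contains
exactly one point of each orbit. -/
def IsFundDomain (a b c : ℝ) (F : Set ℍ) : Prop :=
  F ⊆ geodesic a b c ∧ MeasurableSet F ∧
    ∀ z ∈ geodesic a b c, ∃! z' : ℍ, z' ∈ F ∧ ∃ g ∈ stab (formMatrix a b c), g • z = z'

/-- The parameters of the points of `F ⊆ S_A`. -/
def params (a b c : ℝ) (F : Set ℍ) : Set ℝ := {s | ∃ z ∈ F, (z : ℂ) = geodesicPath a b c s}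

/-- The integrand of the cycle integral of a function of weight `2k` along `S_A`, in the parameter
of the geodesic: `f(z) A(z, 1)^{k-1} dz` with `A(z, 1) = a z² + b z + c`. -/
def cycleIntegrand (a b c : ℝ) (k : ℤ) (f : ℂ → ℂ) (s : ℝ) : ℂ :=
  f (geodesicPath a b c s) *
    ((a : ℂ) * geodesicPath a b c s ^ 2 + (b : ℂ) * geodesicPath a b c s + (c : ℂ)) ^ (k - 1) *
      deriv (geodesicPath a b c) s

/-- `C_A(f) = ∫_{Γ_A \ S_A} f(z) A(z, 1)^{k-1} dz` exists and equals `I₀`: the quotient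
`Γ_A \ S_A` has a fundamental domain, and on each of them the line integral converges absolutely
and has the value `I₀`. -/
def HasCycleIntegral (a b c : ℝ) (k : ℤ) (f : ℂ → ℂ) (I₀ : ℂ) : Prop :=
  (∃ F : Set ℍ, IsFundDomain a b c F) ∧
    ∀ F : Set ℍ, IsFundDomain a b c F →
      MeasureTheory.IntegrableOn (cycleIntegrand a b c k f) (params a b c F) ∧
        ∫ s in params a b c F, cycleIntegrand a b c k f s = I₀

end SiegelTheta

end

open SiegelTheta

/-! Split `X ∈ L'` as `Y + W` along the decomposition of `L ⊗ ℚ` into `(ℚA)^⊥` and `ℚA`. On the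
geodesic `S_A` the vector `X(z)` is orthogonal to `A`, so with a parameter `s` on `S_A` and
`p(s) = (Y, X(z(s)))` the summand of `R₀Θ_L(τ, z) dz` becomes `e(q(Y) \bar τ) e(q(W) \bar τ)` times
a combination of `(W, A) p exp(-2πvp²)` and `p p' exp(-2πvp²)`. The group `Γ_A` is infinite cyclic,
acts on `s` by translations and acts freely on `Y ≠ 0`, so the integral of the sum over `Y` over one
period unfolds to a sum over `Γ_A \ I'` of integrals over `ℝ`. The second part is exact and
integrates to `0`. Since `p` is a combination of `exp s` and `exp (-s)` whose coefficients multiply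
to a positive multiple of `q(Y)`, the first part is odd about a point if `q(Y) < 0`, and becomes a
Gaussian integral with the sign of `(Y, Y₀)` by the substitution `u = p'` if `q(Y) > 0`. -/

namespace SiegelTheta

open MeasureTheory Filter Topology

/-! ### The quadratic space -/

lemma q_eq (X : V) : q X = X 0 0 * X 1 1 - X 0 1 * X 1 0 := Matrix.det_fin_two X

lemma q_smul (r : ℝ) (X : V) : q (r • X) = r ^ 2 * q X := by
  simp only [q_eq, Matrix.smul_apply, smul_eq_mul]; ring

lemma q_add (X Y : V) : q (X + Y) = q X + q Y + bil X Y := by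
  simp only [bil, QuadraticMap.polar]; ring

lemma bil_comm (X Y : V) : bil X Y = bil Y X := QuadraticMap.polar_comm q X Y

lemma bil_self (X : V) : bil X X = 2 * q X := by
  simp only [bil_eq, q_eq]; ring

lemma bil_add_right (X Y Z : V) : bil X (Y + Z) = bil X Y + bil X Z := by
  simp only [bil_comm X, bil_add_left]

lemma bil_smul_left (r : ℝ) (X Y : V) : bil (r • X) Y = r * bil X Y := by
  simp only [bil_eq, Matrix.smul_apply, smul_eq_mul]; ring

lemma bil_smul_right (r : ℝ) (X Y : V) : bil X (r • Y) = r * bil X Y := by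
  simp only [bil_comm X, bil_smul_left]

lemma bil_sub_left (X Y Z : V) : bil (X - Y) Z = bil X Z - bil Y Z := by
  rw [sub_eq_add_neg, bil_add_left, bil_neg_left, sub_eq_add_neg]

section Projections

variable {A X : V}

lemma projLine_add (A X Y : V) : projLine A (X + Y) = projLine A X + projLine A Y := by
  simp only [projLine, bil_add_left, add_div, add_smul]

lemma projPerp_add (A X Y : V) : projPerp A (X + Y) = projPerp A X + projPerp A Y := by
  simp only [projPerp, projLine_add]; abel

lemma projLine_sub (A X Y : V) : projLine A (X - Y) = projLine A X - projLine A Y := by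
  simp only [projLine, bil_sub_left, sub_div, sub_smul]

lemma projPerp_sub (A X Y : V) : projPerp A (X - Y) = projPerp A X - projPerp A Y := by
  simp only [projPerp, projLine_sub]; abel

lemma projPerp_add_projLine (A X : V) : projPerp A X + projLine A X = X := sub_add_cancel _ _

lemma bil_projLine (hA : bil A A ≠ 0) (X : V) : bil (projLine A X) A = bil X A := by
  rw [projLine, bil_smul_left, div_mul_cancel₀ _ hA]

lemma bil_projPerp (hA : bil A A ≠ 0) (X : V) : bil (projPerp A X) A = 0 := by
  rw [projPerp, bil_sub_left, bil_projLine hA, sub_self]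

lemma projLine_of_perp (hX : bil X A = 0) : projLine A X = 0 := by
  rw [projLine, hX, zero_div, zero_smul]

lemma projPerp_of_perp (hX : bil X A = 0) : projPerp A X = X := by
  rw [projPerp, projLine_of_perp hX, sub_zero]

lemma projLine_smul_self (hA : bil A A ≠ 0) (r : ℝ) : projLine A (r • A) = r • A := by
  rw [projLine, bil_smul_left, mul_div_cancel_right₀ _ hA]

lemma projPerp_smul_self (hA : bil A A ≠ 0) (r : ℝ) : projPerp A (r • A) = 0 := by
  rw [projPerp, projLine_smul_self hA, sub_self]

end Projections

lemma bil_formMatrix (a b c : ℝ) (X : V) :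
    bil X (formMatrix a b c) = -(X 0 0 * b / 2) + X 1 1 * b / 2 + a * X 0 1 - c * X 1 0 := by
  simp [bil_eq, formMatrix]; ring

lemma bil_formMatrix_self (a b c : ℝ) :
    bil (formMatrix a b c) (formMatrix a b c) = -(b ^ 2 - 4 * a * c) / 2 := by
  simp [bil_eq, formMatrix]; ring

lemma bil_formMatrix_self_ne_zero {a b c : ℝ} (hD : 0 < b ^ 2 - 4 * a * c) :
    bil (formMatrix a b c) (formMatrix a b c) ≠ 0 := by
  rw [bil_formMatrix_self]
  linarith

/-! ### The lattice `L` and its dual -/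

lemma mk_mem_latticeL (α β γ : ℤ) : (!![(β : ℝ), (γ : ℝ); -(α : ℝ), -(β : ℝ)] : V) ∈ latticeL :=
  ⟨α, β, γ, rfl⟩

lemma mem_span_latticeL_iff {X : V} :
    X ∈ Submodule.span ℝ (latticeL : Set V) ↔ X 1 1 = -X 0 0 := by
  refine ⟨fun hX => ?_, fun hX => ?_⟩
  · induction hX using Submodule.span_induction with
    | mem X h => obtain ⟨a, b, c, rfl⟩ := h; simp
    | zero => simp
    | add X Y _ _ hX hY => simp only [Matrix.add_apply, hX, hY]; ring
    | smul r X _ hX => simp only [Matrix.smul_apply, hX, smul_eq_mul]; ring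
  · have h : X = X 0 0 • (!![((1 : ℤ) : ℝ), ((0 : ℤ) : ℝ); -((0 : ℤ) : ℝ), -((1 : ℤ) : ℝ)] : V) +
        X 0 1 • (!![((0 : ℤ) : ℝ), ((1 : ℤ) : ℝ); -((0 : ℤ) : ℝ), -((0 : ℤ) : ℝ)] : V) +
        (-X 1 0) • (!![((0 : ℤ) : ℝ), ((0 : ℤ) : ℝ); -((1 : ℤ) : ℝ), -((0 : ℤ) : ℝ)] : V) := by
      ext i j; fin_cases i <;> fin_cases j <;> simp [hX]
    have smul_mem (r : ℝ) (α β γ : ℤ) :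
        r • (!![(β : ℝ), (γ : ℝ); -(α : ℝ), -(β : ℝ)] : V) ∈
          Submodule.span ℝ (latticeL : Set V) :=
      Submodule.smul_mem _ r (Submodule.subset_span (mk_mem_latticeL α β γ))
    rw [h]
    exact add_mem (add_mem (smul_mem _ _ _ _) (smul_mem _ _ _ _)) (smul_mem _ _ _ _)

lemma mem_dual_latticeL_iff {X : V} : X ∈ dual latticeL ↔
    ∃ α β γ : ℤ, X = !![(β : ℝ) / 2, (γ : ℝ); -(α : ℝ), -(β : ℝ) / 2] := by
  constructor
  · rintro ⟨hs, h⟩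
    have ht := mem_span_latticeL_iff.1 hs
    obtain ⟨n, hn⟩ := h _ (mk_mem_latticeL 0 1 0)
    obtain ⟨m, hm⟩ := h _ (mk_mem_latticeL 0 0 1)
    obtain ⟨k, hk⟩ := h _ (mk_mem_latticeL 1 0 0)
    simp [bil_eq, ht] at hn hm hk
    refine ⟨m, -n, k, ?_⟩
    ext i j; fin_cases i <;> fin_cases j <;> simp [ht] <;> linarith
  · rintro ⟨α, β, γ, rfl⟩
    refine ⟨mem_span_latticeL_iff.2 (by simp; ring), ?_⟩
    rintro _ ⟨a, b, c, rfl⟩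
    refine ⟨-(β * b) + α * c + γ * a, ?_⟩
    simp [bil_eq]; ring

lemma traceless_of_mem_dual {M : AddSubgroup V} (hM : M ≤ latticeL) {X : V}
    (hX : X ∈ dual M) : X 1 1 = -X 0 0 :=
  mem_span_latticeL_iff.1 (Submodule.span_mono hM hX.1)

lemma latticeL_le_dual : latticeL ≤ dual latticeL := by
  rintro _ ⟨a, b, c, rfl⟩
  refine mem_dual_latticeL_iff.2 ⟨a, 2 * b, c, ?_⟩
  ext i j; fin_cases i <;> fin_cases j <;> simp [neg_div]

lemma two_smul_mem_latticeL {X : V} (hX : X ∈ dual latticeL) : (2 : ℝ) • X ∈ latticeL := by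
  obtain ⟨α, β, γ, rfl⟩ := mem_dual_latticeL_iff.1 hX
  refine ⟨2 * α, β, 2 * γ, ?_⟩
  ext i j; fin_cases i <;> fin_cases j <;> simp <;> ring

lemma formMatrix_mem_dual (a b c : ℤ) : formMatrix a b c ∈ dual latticeL :=
  mem_dual_latticeL_iff.2 ⟨a, b, c, rfl⟩

lemma intCast_smul_mem {M : AddSubgroup V} {X : V} (hX : X ∈ M) (n : ℤ) : (n : ℝ) • X ∈ M := by
  rw [Int.cast_smul_eq_zsmul]; exact zsmul_mem hX n

lemma mem_span_of_smul_mem {M : AddSubgroup V} {r : ℝ} (hr : r ≠ 0) {X : V} (hX : r • X ∈ M) :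
    X ∈ Submodule.span ℝ (M : Set V) :=
  (Submodule.smul_mem_iff _ hr).1 (Submodule.subset_span hX)

instance : AddGroup.FG latticeL :=
  let f : ℤ × ℤ × ℤ →+ latticeL := AddMonoidHom.mk' (fun n => ⟨_, mk_mem_latticeL n.1 n.2.1 n.2.2⟩)
    fun m n => by ext i j; fin_cases i <;> fin_cases j <;> simp [add_comm]
  AddGroup.fg_of_surjective (f := f) fun ⟨_, α, β, γ, h⟩ => ⟨(α, β, γ), Subtype.ext h.symm⟩

lemma finite_quotient_of_zsmul_mem {G : Type*} [AddCommGroup G] {L M : AddSubgroup G}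
    [AddGroup.FG L] {n : ℤ} (hn : n ≠ 0) (h : ∀ X ∈ L, n • X ∈ M) :
    Finite (L ⧸ M.addSubgroupOf L) := by
  refine AddCommGroup.finite_of_fg_isAddTorsion _ fun y => ?_
  obtain ⟨X, rfl⟩ := QuotientAddGroup.mk_surjective y
  refine isOfFinAddOrder_iff_zsmul_eq_zero.2 ⟨n, hn, ?_⟩
  rw [← QuotientAddGroup.mk_zsmul, QuotientAddGroup.eq_zero_iff]
  exact h X X.2

/-! ### The action by conjugation -/

lemma conj_eq (g : SL(2, ℤ)) (X : V) : conj g X =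
    !![(g 0 0 : ℝ), (g 0 1 : ℝ); (g 1 0 : ℝ), (g 1 1 : ℝ)] * X *
      !![(g 1 1 : ℝ), -(g 0 1 : ℝ); -(g 1 0 : ℝ), (g 0 0 : ℝ)] := by
  rw [conj, Matrix.SpecialLinearGroup.SL2_inv_expl]
  congr 1
  · congr 1
    ext i j; fin_cases i <;> fin_cases j <;> simp
  · ext i j; fin_cases i <;> fin_cases j <;> simp [Matrix.map]

lemma det_intCast (g : SL(2, ℤ)) : (g 0 0 : ℝ) * g 1 1 - g 0 1 * g 1 0 = 1 := by
  exact_mod_cast (Matrix.det_fin_two (g : Matrix (Fin 2) (Fin 2) ℤ)).symm.trans g.det_coe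

lemma conj_apply (g : SL(2, ℤ)) (X : V) : conj g X =
    !![(g 0 0 * X 0 0 + g 0 1 * X 1 0) * g 1 1 - (g 0 0 * X 0 1 + g 0 1 * X 1 1) * g 1 0,
      -((g 0 0 * X 0 0 + g 0 1 * X 1 0) * g 0 1) + (g 0 0 * X 0 1 + g 0 1 * X 1 1) * g 0 0;
      (g 1 0 * X 0 0 + g 1 1 * X 1 0) * g 1 1 - (g 1 0 * X 0 1 + g 1 1 * X 1 1) * g 1 0,
      -((g 1 0 * X 0 0 + g 1 1 * X 1 0) * g 0 1) + (g 1 0 * X 0 1 + g 1 1 * X 1 1) * g 0 0] := by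
  rw [conj_eq]
  nth_rewrite 1 [Matrix.eta_fin_two X]
  simp only [Matrix.mul_fin_two]
  ext i j; fin_cases i <;> fin_cases j <;> simp <;> ring

lemma conj_neg_one (X : V) : conj (-1) X = X := by
  rw [conj_apply]
  ext i j; fin_cases i <;> fin_cases j <;> simp

lemma conj_add (g : SL(2, ℤ)) (X Y : V) : conj g (X + Y) = conj g X + conj g Y := by
  simp only [conj, Matrix.mul_add, Matrix.add_mul]

lemma conj_smul (g : SL(2, ℤ)) (r : ℝ) (X : V) : conj g (r • X) = r • conj g X := by
  simp only [conj, Matrix.mul_smul, Matrix.smul_mul]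

lemma conj_sub (g : SL(2, ℤ)) (X Y : V) : conj g (X - Y) = conj g X - conj g Y := by
  simp only [conj, Matrix.mul_sub, Matrix.sub_mul]

lemma q_conj (g : SL(2, ℤ)) (X : V) : q (conj g X) = q X := by
  have h : (g 1 1 : ℝ) * g 0 0 - -(g 0 1 : ℝ) * -(g 1 0 : ℝ) = 1 := by
    linear_combination det_intCast g
  rw [conj_eq, q, q, Matrix.det_mul, Matrix.det_mul, Matrix.det_fin_two_of, Matrix.det_fin_two_of,
    det_intCast, h, one_mul, mul_one]

lemma bil_conj (g : SL(2, ℤ)) (X Y : V) : bil (conj g X) (conj g Y) = bil X Y := by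
  simp only [bil, QuadraticMap.polar, ← conj_add, q_conj]

lemma conj_sub_self_mem (g : SL(2, ℤ)) {X : V} (hX : X ∈ dual latticeL) :
    conj g X - X ∈ latticeL := by
  obtain ⟨α, β, γ, rfl⟩ := mem_dual_latticeL_iff.1 hX
  have hd := det_intCast g
  refine ⟨-((g 1 0 * β - g 1 1 * α) * g 1 1 - g 1 0 * γ * g 1 0) - α,
    (g 0 0 * β - g 0 1 * α) * g 1 1 - g 0 0 * γ * g 1 0 - β,
    -((g 0 0 * β - g 0 1 * α) * g 0 1) + g 0 0 * γ * g 0 0 - γ, ?_⟩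
  rw [conj_apply]
  ext i j; fin_cases i <;> fin_cases j <;> simp
  · linear_combination (-(β : ℝ) / 2) * hd
  · ring
  · ring
  · linear_combination (β / 2 : ℝ) * hd

/-! ### The sublattices `I` and `N` -/

section Sublattices

variable {A X Y W : V}

lemma latticeI_le (A : V) : latticeI A ≤ latticeL := fun _ h => h.1

lemma latticeN_le (A : V) : latticeN A ≤ latticeL := fun _ h => h.1

lemma perp_of_mem_dual_latticeI (hY : Y ∈ dual (latticeI A)) : bil Y A = 0 := by
  have h : ∀ Z ∈ Submodule.span ℝ (latticeI A : Set V), bil Z A = 0 := by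
    intro Z hZ
    induction hZ using Submodule.span_induction with
    | mem X h => exact h.2
    | zero => exact bil_zero_left A
    | add X Y _ _ h1 h2 => rw [bil_add_left, h1, h2, add_zero]
    | smul r X _ h => rw [bil_smul_left, h, mul_zero]
  exact h Y hY.1

lemma exists_smul_of_mem_dual_latticeN (hW : W ∈ dual (latticeN A)) : ∃ r : ℝ, W = r • A := by
  have h : Submodule.span ℝ (latticeN A : Set V) ≤ Submodule.span ℝ {A} :=
    Submodule.span_le.2 fun _ ⟨_, r, hr⟩ => Submodule.mem_span_singleton.2 ⟨r, hr.symm⟩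
  obtain ⟨r, hr⟩ := Submodule.mem_span_singleton.1 (h hW.1)
  exact ⟨r, hr.symm⟩

lemma bil_two_smul_int (hA : A ∈ dual latticeL) (hX : X ∈ dual latticeL) :
    ∃ n : ℤ, 2 * bil X A = n := by
  obtain ⟨n, hn⟩ := hA.2 _ (two_smul_mem_latticeL hX)
  exact ⟨n, by rw [← hn, bil_smul_right, bil_comm]⟩

lemma smul_mem_latticeL (hA : A ∈ dual latticeL) (hX : X ∈ dual latticeL) :
    (4 * bil A A) • X ∈ latticeL := by
  obtain ⟨n, hn⟩ := bil_two_smul_int hA hA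
  have h := intCast_smul_mem (two_smul_mem_latticeL hX) n
  rwa [← hn, smul_smul, show 2 * bil A A * 2 = 4 * bil A A by ring] at h

lemma smul_projLine_mem_latticeN (hA : A ∈ dual latticeL) (hA0 : bil A A ≠ 0)
    (hX : X ∈ dual latticeL) : (4 * bil A A) • projLine A X ∈ latticeN A := by
  obtain ⟨n, hn⟩ := bil_two_smul_int hA hX
  have h : (4 * bil A A) • projLine A X = (n : ℝ) • (2 : ℝ) • A := by
    rw [projLine, smul_smul, smul_smul, ← hn]
    congr 1
    field_simp
    ring
  rw [h]
  exact ⟨intCast_smul_mem (two_smul_mem_latticeL hA) n, n * 2, by rw [smul_smul]; push_cast; rfl⟩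

lemma smul_projPerp_mem_latticeI (hA : A ∈ dual latticeL) (hA0 : bil A A ≠ 0)
    (hX : X ∈ dual latticeL) : (4 * bil A A) • projPerp A X ∈ latticeI A := by
  refine ⟨?_, by rw [bil_smul_left, bil_projPerp hA0, mul_zero]⟩
  rw [projPerp, smul_sub]
  exact sub_mem (smul_mem_latticeL hA hX)
    (latticeN_le _ (smul_projLine_mem_latticeN hA hA0 hX))

lemma finite_quotient_sup (hA : A ∈ dual latticeL) (hA0 : bil A A ≠ 0) :
    Finite (latticeL ⧸ (latticeI A ⊔ latticeN A).addSubgroupOf latticeL) := by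
  obtain ⟨n, hn⟩ := bil_two_smul_int hA hA
  have hn0 : (2 * n : ℤ) ≠ 0 := fun h => hA0 (by
    have h' : (2 * n : ℝ) = 0 := by exact_mod_cast h
    linarith)
  refine finite_quotient_of_zsmul_mem hn0 fun X hX => ?_
  have hX' := latticeL_le_dual hX
  have hcast : ((2 * n : ℤ) : ℝ) = 4 * bil A A := by push_cast; rw [← hn]; ring
  rw [← Int.cast_smul_eq_zsmul ℝ, hcast, ← projPerp_add_projLine A X, smul_add]
  exact AddSubgroup.add_mem_sup (smul_projPerp_mem_latticeI hA hA0 hX')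
    (smul_projLine_mem_latticeN hA hA0 hX')

lemma projPerp_mem_dual (hA : A ∈ dual latticeL) (hA0 : bil A A ≠ 0) (hX : X ∈ dual latticeL) :
    projPerp A X ∈ dual (latticeI A) := by
  refine ⟨mem_span_of_smul_mem (mul_ne_zero four_ne_zero hA0)
    (smul_projPerp_mem_latticeI hA hA0 hX), fun Z hZ => ?_⟩
  obtain ⟨n, hn⟩ := hX.2 Z hZ.1
  refine ⟨n, ?_⟩
  rw [projPerp, projLine, bil_sub_left, bil_smul_left, bil_comm A Z, hZ.2, hn, mul_zero, sub_zero]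

lemma projLine_mem_dual (hA : A ∈ dual latticeL) (hA0 : bil A A ≠ 0) (hX : X ∈ dual latticeL) :
    projLine A X ∈ dual (latticeN A) := by
  refine ⟨mem_span_of_smul_mem (mul_ne_zero four_ne_zero hA0)
    (smul_projLine_mem_latticeN hA hA0 hX), fun Z hZ => ?_⟩
  obtain ⟨n, hn⟩ := hX.2 Z hZ.1
  refine ⟨n, ?_⟩
  obtain ⟨r, rfl⟩ := hZ.2
  rw [bil_smul_right, bil_projLine hA0, ← bil_smul_right, hn]

lemma dual_latticeL_le_dual_sup (hA : A ∈ dual latticeL) (hA0 : bil A A ≠ 0) :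
    dual latticeL ≤ dual (latticeI A ⊔ latticeN A) := by
  intro X hX
  refine ⟨?_, fun Z hZ => hX.2 Z (sup_le (latticeI_le _) (latticeN_le _) hZ)⟩
  rw [← projPerp_add_projLine A X]
  exact add_mem (Submodule.span_mono (SetLike.coe_subset_coe.2 le_sup_left)
      (projPerp_mem_dual hA hA0 hX).1)
    (Submodule.span_mono (SetLike.coe_subset_coe.2 le_sup_right) (projLine_mem_dual hA hA0 hX).1)

lemma exists_bil_generator (hA : A ∈ dual latticeL) (hA0 : bil A A ≠ 0) :
    ∃ Z₀ ∈ latticeL, bil Z₀ A ≠ 0 ∧ ∀ Z ∈ latticeL, ∃ k : ℤ, bil Z A = k * bil Z₀ A := by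
  let φ : V →+ ℝ := AddMonoidHom.mk' (bil · A) (bil_add_left · · A)
  obtain ⟨d, hd⟩ := Int.subgroup_cyclic ((latticeL.map φ).comap (Int.castAddHom ℝ))
  obtain ⟨Z₀, hZ₀, hdZ₀ : bil Z₀ A = d⟩ : d ∈ (latticeL.map φ).comap (Int.castAddHom ℝ) := by
    rw [hd]; exact AddSubgroup.mem_closure_singleton_self d
  have hk : ∀ Z ∈ latticeL, ∃ k : ℤ, bil Z A = k * bil Z₀ A := by
    intro Z hZ
    obtain ⟨n, hn⟩ := hA.2 Z hZ
    rw [bil_comm] at hn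
    have hmem : n ∈ (latticeL.map φ).comap (Int.castAddHom ℝ) := ⟨Z, hZ, hn⟩
    rw [hd, AddSubgroup.mem_closure_singleton] at hmem
    obtain ⟨k, rfl⟩ := hmem
    exact ⟨k, by rw [hn, hdZ₀]; push_cast [smul_eq_mul]; rfl⟩
  refine ⟨Z₀, hZ₀, fun h0 => hA0 ?_, hk⟩
  obtain ⟨k, hk⟩ := hk _ (two_smul_mem_latticeL hA)
  rw [bil_smul_left, h0, mul_zero] at hk
  linarith

lemma exists_projPerp_eq_of_mem_dual_latticeI (hA : A ∈ dual latticeL) (hA0 : bil A A ≠ 0)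
    (hY : Y ∈ dual (latticeI A)) : ∃ X ∈ dual latticeL, projPerp A X = Y := by
  obtain ⟨Z₀, hZ₀, hne, hgen⟩ := exists_bil_generator hA hA0
  have hYt := traceless_of_mem_dual (latticeI_le _) hY
  have hAt := traceless_of_mem_dual le_rfl hA
  -- the multiple of `A` is chosen so that `X` is orthogonal to `Z₀`, and `L = I + ℤ Z₀`
  refine ⟨Y + (-(bil Y Z₀ / bil Z₀ A)) • A, ⟨mem_span_latticeL_iff.2 ?_, fun Z hZ => ?_⟩, ?_⟩
  · simp only [Matrix.add_apply, Matrix.smul_apply, hYt, hAt, smul_eq_mul]; ring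
  · obtain ⟨k, hk⟩ := hgen Z hZ
    obtain ⟨m, hm⟩ := hY.2 (Z - (k : ℝ) • Z₀) ⟨sub_mem hZ (intCast_smul_mem hZ₀ k), by
      rw [bil_sub_left, bil_smul_left, hk, sub_self]⟩
    rw [bil_comm, bil_sub_left, bil_smul_left, bil_comm Z, bil_comm Z₀] at hm
    refine ⟨m, ?_⟩
    rw [bil_add_left, bil_smul_left, bil_comm A Z, hk, ← hm]
    field_simp
    ring
  · rw [projPerp_add, projPerp_smul_self hA0, projPerp_of_perp (perp_of_mem_dual_latticeI hY),
      add_zero]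

lemma smul_mem_latticeL_of_mem_dual_latticeI (hA : A ∈ dual latticeL) (hA0 : bil A A ≠ 0)
    (hY : Y ∈ dual (latticeI A)) : (4 * bil A A) • Y ∈ latticeL := by
  obtain ⟨X, hX, rfl⟩ := exists_projPerp_eq_of_mem_dual_latticeI hA hA0 hY
  exact (smul_projPerp_mem_latticeI hA hA0 hX).1

lemma smul_mem_latticeL_of_mem_dual_latticeN (hA : A ∈ dual latticeL)
    (hW : W ∈ dual (latticeN A)) : (4 * bil A A) • W ∈ latticeL := by
  have h2A := two_smul_mem_latticeL hA
  obtain ⟨n, hn⟩ := hW.2 _ ⟨h2A, 2, by norm_num⟩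
  obtain ⟨r, rfl⟩ := exists_smul_of_mem_dual_latticeN hW
  rw [bil_smul_right, bil_smul_left] at hn
  have h : (4 * bil A A) • r • A = (n : ℝ) • (2 : ℝ) • A := by
    rw [smul_smul, smul_smul, ← hn]
    ring_nf
  exact h ▸ intCast_smul_mem h2A n

lemma conj_sub_self_mem_latticeI (hA : A ∈ dual latticeL) (hA0 : bil A A ≠ 0) {g : SL(2, ℤ)}
    (hg : g ∈ stab A) (hY : Y ∈ dual (latticeI A)) : conj g Y - Y ∈ latticeI A := by
  have hgA : conj g A = A := hg
  have hYA := perp_of_mem_dual_latticeI hY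
  have hgY : bil (conj g Y) A = 0 := by rw [← hYA, ← bil_conj g Y A, hgA]
  refine ⟨?_, by rw [bil_sub_left, hYA, hgY, sub_zero]⟩
  obtain ⟨X, hX, rfl⟩ := exists_projPerp_eq_of_mem_dual_latticeI hA hA0 hY
  rw [projPerp, projLine, conj_sub, conj_smul, hgA, sub_sub_sub_cancel_right]
  exact conj_sub_self_mem g hX

lemma conj_mem_dual_latticeI (hA : A ∈ dual latticeL) (hA0 : bil A A ≠ 0) {g : SL(2, ℤ)}
    (hg : g ∈ stab A) (hY : Y ∈ dual (latticeI A)) : conj g Y ∈ dual (latticeI A) := by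
  have h := conj_sub_self_mem_latticeI hA hA0 hg hY
  have hdual : conj g Y - Y ∈ dual (latticeI A) :=
    ⟨Submodule.subset_span h, fun Z hZ => (latticeL_le_dual h.1).2 Z hZ.1⟩
  simpa only [sub_add_cancel] using add_mem hdual hY

end Sublattices

/-! ### The geodesic in arc length coordinates -/

/-- The centre of the semicircle `S_A`. -/
noncomputable def center (a b : ℝ) : ℝ := -b / (2 * a)

/-- The radius of the semicircle `S_A`. -/
noncomputable def radius (a b c : ℝ) : ℝ := √(b ^ 2 - 4 * a * c) / (2 * a)

/-- The larger real endpoint of the geodesic of `[a, b, c]`, `a > 0`; the smaller one is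
`endpoint a b c`. -/
noncomputable def endpoint' (a b c : ℝ) : ℝ := (-b + √(b ^ 2 - 4 * a * c)) / (2 * a)

/-- The isotropic vector attached to the cusp `w ∈ ℝ`. -/
def isotropic (w : ℝ) : V := !![-w, w ^ 2; -1, w]

/-- The isotropic vector attached to the larger endpoint, the counterpart of `vecY0`. -/
noncomputable def vecY1 (a b c : ℝ) : V := isotropic (endpoint' a b c)

lemma hasDerivAt_tanh (s : ℝ) : HasDerivAt Real.tanh (1 / Real.cosh s ^ 2) s := by
  rw [show Real.tanh = fun x => Real.sinh x / Real.cosh x from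
    funext Real.tanh_eq_sinh_div_cosh]
  refine ((Real.hasDerivAt_sinh s).div (Real.hasDerivAt_cosh s)
    (Real.cosh_pos s).ne').congr_deriv ?_
  congr 1
  linarith [Real.cosh_sq s]

section Geodesic

variable {a b c : ℝ}

lemma vecY0_eq : vecY0 a b c = isotropic (endpoint a b c) := rfl

lemma radius_pos (ha : 0 < a) (hD : 0 < b ^ 2 - 4 * a * c) : 0 < radius a b c := by
  unfold radius; positivity

lemma endpoint_eq : endpoint a b c = center a b - radius a b c := by
  unfold endpoint center radius; ring

lemma endpoint'_eq : endpoint' a b c = center a b + radius a b c := by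
  unfold endpoint' center radius; ring

lemma coeff_b_eq (ha : 0 < a) : b = -(2 * a * center a b) := by
  unfold center; field_simp

lemma coeff_c_eq (ha : 0 < a) (hD : 0 < b ^ 2 - 4 * a * c) :
    c = a * (center a b ^ 2 - radius a b c ^ 2) := by
  unfold center radius
  rw [div_pow, div_pow, Real.sq_sqrt hD.le]
  field_simp
  ring

lemma endpoint_root (ha : 0 < a) (hD : 0 < b ^ 2 - 4 * a * c) :
    a * endpoint a b c ^ 2 + b * endpoint a b c + c = 0 := by
  rw [endpoint_eq]
  linear_combination coeff_c_eq ha hD + (center a b - radius a b c) * coeff_b_eq (b := b) ha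

lemma endpoint'_root (ha : 0 < a) (hD : 0 < b ^ 2 - 4 * a * c) :
    a * endpoint' a b c ^ 2 + b * endpoint' a b c + c = 0 := by
  rw [endpoint'_eq]
  linear_combination coeff_c_eq ha hD + (center a b + radius a b c) * coeff_b_eq (b := b) ha

lemma formMatrix_eq (ha : 0 < a) (hD : 0 < b ^ 2 - 4 * a * c) :
    formMatrix a b c =
      a • !![-center a b, center a b ^ 2 - radius a b c ^ 2; -1, center a b] := by
  have hb := coeff_b_eq (b := b) ha
  have hc := coeff_c_eq ha hD
  ext i j
  fin_cases i <;> fin_cases j <;> simp [formMatrix] <;> linarith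

lemma q_eq_combination (ha : 0 < a) (hD : 0 < b ^ 2 - 4 * a * c) {X : V} (hX : X 1 1 = -X 0 0) :
    q X = bil X (vecY0 a b c) * bil X (vecY1 a b c) / (4 * radius a b c ^ 2) -
      bil X (formMatrix a b c) ^ 2 / (4 * a ^ 2 * radius a b c ^ 2) := by
  have hr := radius_pos ha hD
  simp [formMatrix_eq ha hD, vecY0_eq, vecY1, isotropic, endpoint_eq, endpoint'_eq, bil_eq, q_eq,
    hX]
  field_simp
  ring

lemma geodesicPath_re (s : ℝ) :
    (geodesicPath a b c s).re = center a b - radius a b c * Real.tanh s := by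
  simp [geodesicPath, center, radius, -Complex.ofReal_div, -Complex.ofReal_mul,
    -Complex.ofReal_sub, -Complex.ofReal_tanh, -Complex.ofReal_cosh]

lemma geodesicPath_im (s : ℝ) : (geodesicPath a b c s).im = radius a b c / Real.cosh s := by
  simp [geodesicPath, radius, -Complex.ofReal_div, -Complex.ofReal_mul,
    -Complex.ofReal_sub, -Complex.ofReal_tanh, -Complex.ofReal_cosh]

lemma geodesicPath_im_pos (ha : 0 < a) (hD : 0 < b ^ 2 - 4 * a * c) (s : ℝ) :
    0 < (geodesicPath a b c s).im := by
  rw [geodesicPath_im]; exact div_pos (radius_pos ha hD) (Real.cosh_pos s)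

lemma posVec_geodesicPath (ha : 0 < a) (hD : 0 < b ^ 2 - 4 * a * c) (s : ℝ) :
    posVec (geodesicPath a b c s) = (1 / (2 * √2 * radius a b c)) •
      (Real.exp s • vecY0 a b c + Real.exp (-s) • vecY1 a b c) := by
  have hr := radius_pos ha hD
  have := Real.cosh_pos s
  rw [posVec, Complex.sq_norm, Complex.normSq_apply, geodesicPath_re, geodesicPath_im,
    Real.tanh_eq_sinh_div_cosh]
  ext i j
  fin_cases i <;> fin_cases j <;>
    simp [vecY0_eq, vecY1, isotropic, endpoint_eq, endpoint'_eq] <;> field_simp <;>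
    rw [← Real.cosh_add_sinh, ← Real.cosh_sub_sinh]
  · ring
  · linear_combination (-2 * radius a b c ^ 2) * Real.cosh_sq s
  · ring
  · ring

lemma bil_posVec_geodesicPath (ha : 0 < a) (hD : 0 < b ^ 2 - 4 * a * c) (X : V) (s : ℝ) :
    bil X (posVec (geodesicPath a b c s)) = 1 / (2 * √2 * radius a b c) *
      (bil X (vecY0 a b c) * Real.exp s + bil X (vecY1 a b c) * Real.exp (-s)) := by
  rw [posVec_geodesicPath ha hD, bil_smul_right, bil_add_right, bil_smul_right, bil_smul_right]
  ring

lemma hasDerivAt_geodesicPath (s : ℝ) : HasDerivAt (geodesicPath a b c)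
    (((-radius a b c / Real.cosh s ^ 2 : ℝ) : ℂ) +
      ((-radius a b c * Real.sinh s / Real.cosh s ^ 2 : ℝ) : ℂ) * Complex.I) s := by
  have hre : HasDerivAt (fun s => -b / (2 * a) - √(b ^ 2 - 4 * a * c) / (2 * a) * Real.tanh s)
      (-radius a b c / Real.cosh s ^ 2) s :=
    (((hasDerivAt_tanh s).const_mul (radius a b c)).const_sub (center a b)).congr_deriv (by ring)
  have him : HasDerivAt (fun s => √(b ^ 2 - 4 * a * c) / (2 * a) / Real.cosh s)
      (-radius a b c * Real.sinh s / Real.cosh s ^ 2) s :=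
    (((Real.hasDerivAt_cosh s).inv (Real.cosh_pos s).ne').const_mul
      (radius a b c)).congr_deriv (by ring)
  exact hre.ofReal_comp.add (him.ofReal_comp.mul_const Complex.I)

lemma continuous_geodesicPath : Continuous (geodesicPath a b c) :=
  continuous_iff_continuousAt.2 fun s => (hasDerivAt_geodesicPath s).continuousAt

lemma mem_geodesic_iff (ha : 0 < a) (hD : 0 < b ^ 2 - 4 * a * c) (z : ℍ) :
    z ∈ geodesic a b c ↔ (center a b - z.re) ^ 2 + z.im ^ 2 = radius a b c ^ 2 := by
  have key : a * ‖(z : ℂ)‖ ^ 2 + b * z.re + c =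
      a * ((center a b - z.re) ^ 2 + z.im ^ 2 - radius a b c ^ 2) := by
    rw [Complex.sq_norm, Complex.normSq_apply, UpperHalfPlane.coe_re, UpperHalfPlane.coe_im]
    linear_combination coeff_c_eq ha hD + z.re * coeff_b_eq (b := b) ha
  rw [geodesic, Set.mem_ofPred_eq, key, mul_eq_zero_iff_left ha.ne', sub_eq_zero]

/-- The point of `S_A` with arc length coordinate `s`: `geodesicPath` as a map to `ℍ`. -/
noncomputable def pathH (ha : 0 < a) (hD : 0 < b ^ 2 - 4 * a * c) (s : ℝ) : ℍ :=
  ⟨geodesicPath a b c s, geodesicPath_im_pos ha hD s⟩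

@[simp] lemma coe_pathH (ha : 0 < a) (hD : 0 < b ^ 2 - 4 * a * c) (s : ℝ) :
    (pathH ha hD s : ℂ) = geodesicPath a b c s := rfl

lemma re_pathH (ha : 0 < a) (hD : 0 < b ^ 2 - 4 * a * c) (s : ℝ) :
    (pathH ha hD s).re = center a b - radius a b c * Real.tanh s := geodesicPath_re s

lemma im_pathH (ha : 0 < a) (hD : 0 < b ^ 2 - 4 * a * c) (s : ℝ) :
    (pathH ha hD s).im = radius a b c / Real.cosh s := geodesicPath_im s

lemma continuous_pathH (ha : 0 < a) (hD : 0 < b ^ 2 - 4 * a * c) : Continuous (pathH ha hD) :=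
  UpperHalfPlane.isEmbedding_coe.continuous_iff.2 continuous_geodesicPath

lemma pathH_mem_geodesic (ha : 0 < a) (hD : 0 < b ^ 2 - 4 * a * c) (s : ℝ) :
    pathH ha hD s ∈ geodesic a b c := by
  have := Real.cosh_pos s
  rw [mem_geodesic_iff ha hD, re_pathH, im_pathH, Real.tanh_eq_sinh_div_cosh]
  field_simp
  linear_combination -radius a b c ^ 2 * Real.cosh_sq s

/-- The arc length coordinate of a point of the geodesic. -/
noncomputable def arcCoord (a b : ℝ) (z : ℍ) : ℝ := Real.arsinh ((center a b - z.re) / z.im)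

lemma continuous_arcCoord : Continuous (arcCoord a b) :=
  Real.continuous_arsinh.comp ((continuous_const.sub UpperHalfPlane.continuous_re).div
    UpperHalfPlane.continuous_im fun z => z.im_pos.ne')

lemma arcCoord_pathH (ha : 0 < a) (hD : 0 < b ^ 2 - 4 * a * c) (s : ℝ) :
    arcCoord a b (pathH ha hD s) = s := by
  have hr := radius_pos ha hD
  have := Real.cosh_pos s
  have hsinh : (center a b - (pathH ha hD s).re) / (pathH ha hD s).im = Real.sinh s := by
    rw [re_pathH, im_pathH, Real.tanh_eq_sinh_div_cosh]
    field_simp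
    ring
  rw [arcCoord, hsinh, Real.arsinh_sinh]

lemma pathH_arcCoord (ha : 0 < a) (hD : 0 < b ^ 2 - 4 * a * c) {z : ℍ}
    (hz : z ∈ geodesic a b c) : pathH ha hD (arcCoord a b z) = z := by
  have hr := radius_pos ha hD
  have := z.im_pos
  have hcosh : Real.cosh (arcCoord a b z) = radius a b c / z.im := by
    have hsq : 1 + ((center a b - z.re) / z.im) ^ 2 = (radius a b c / z.im) ^ 2 := by
      rw [div_pow, div_pow, ← (mem_geodesic_iff ha hD z).1 hz]
      field_simp
      ring
    rw [arcCoord, Real.cosh_arsinh, hsq, Real.sqrt_sq (by positivity)]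
  have hsinh : Real.sinh (arcCoord a b z) = (center a b - z.re) / z.im := Real.sinh_arsinh _
  apply UpperHalfPlane.ext_re_im
  · rw [re_pathH, Real.tanh_eq_sinh_div_cosh, hcosh, hsinh]
    field_simp
    ring
  · rw [im_pathH, hcosh]
    field_simp

lemma params_eq_preimage (ha : 0 < a) (hD : 0 < b ^ 2 - 4 * a * c) (F : Set ℍ) :
    params a b c F = pathH ha hD ⁻¹' F := by
  ext s
  constructor
  · rintro ⟨z, hz, h⟩
    have : pathH ha hD s = z := UpperHalfPlane.ext h.symm
    rwa [Set.mem_preimage, this]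
  · exact fun h => ⟨_, h, rfl⟩

end Geodesic

/-! ### The stabilizer of `A` -/

/-- The eigenvalue of `g` on the vector `(w, 1)`, for `g` fixing the cusp `w`. -/
def eigen (w : ℝ) (g : SL(2, ℤ)) : ℝ := g 1 0 * w + g 1 1

lemma conj_isotropic {g : SL(2, ℤ)} {w : ℝ} (h : g 0 0 * w + g 0 1 = eigen w g * w) :
    conj g (isotropic w) = eigen w g ^ 2 • isotropic w := by
  have h01 : (g 0 1 : ℝ) = eigen w g * w - g 0 0 * w := by linarith
  have h11 : (g 1 1 : ℝ) = eigen w g - g 1 0 * w := by rw [eigen]; ring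
  rw [isotropic, conj_apply, h01, h11]
  generalize eigen w g = l
  ext i j
  fin_cases i <;> fin_cases j <;> simp <;> ring

lemma eigen_mul {w : ℝ} (g : SL(2, ℤ)) {h : SL(2, ℤ)}
    (hw : h 0 0 * w + h 0 1 = eigen w h * w) : eigen w (g * h) = eigen w g * eigen w h := by
  simp only [eigen, Matrix.SpecialLinearGroup.coe_mul, Matrix.mul_apply, Fin.sum_univ_two] at hw ⊢
  push_cast
  linear_combination (g 1 0 : ℝ) * hw

lemma conj_posVec (g : SL(2, ℤ)) (z : ℍ) : conj g (posVec z) = posVec ↑(g • z) := by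
  have := z.im_pos
  set u : ℂ := g 0 0 * z + g 0 1
  set d : ℂ := g 1 0 * z + g 1 1
  have hgz : ((g • z : ℍ) : ℂ) = u / d := by
    exact UpperHalfPlane.coe_specialLinearGroup_apply g z
  have hd : 0 < Complex.normSq d := UpperHalfPlane.normSq_denom_pos g z.im_ne_zero
  have hre : (u / d).re = (u.re * d.re + u.im * d.im) / Complex.normSq d := by
    rw [Complex.div_re]; ring
  have him : (u / d).im = z.im / Complex.normSq d := by
    rw [← hgz]; exact ModularGroup.im_smul_eq_div_normSq g z
  rw [hgz, posVec, posVec, conj_smul, conj_apply, hre, him, norm_div, div_pow, Complex.sq_norm,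
    Complex.sq_norm, Complex.sq_norm]
  ext i j
  fin_cases i <;> fin_cases j <;> simp <;> field_simp <;>
    simp [Complex.normSq_apply, u, d] <;> ring

lemma posVec_injective : Function.Injective fun z : ℍ => posVec z := by
  intro z z' h
  have h2 : √2 ≠ 0 := by positivity
  have him : z.im = z'.im := by
    have := congrFun (congrFun h 1) 0
    simpa [posVec, h2] using this
  have hre : z.re = z'.re := by
    have := congrFun (congrFun h 1) 1
    simpa [posVec, him, h2, z'.im_ne_zero] using this
  exact UpperHalfPlane.ext_re_im hre him

section Stabilizer

variable {a b c : ℝ}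

lemma stab_relations {g : SL(2, ℤ)} (hg : g ∈ stab (formMatrix a b c)) :
    a * g 0 1 = -(c * g 1 0) ∧ a * g 0 0 = a * g 1 1 - b * g 1 0 := by
  have h : conj g (formMatrix a b c) = formMatrix a b c := hg
  have hdet := det_intCast g
  rw [formMatrix, conj_apply] at h
  have entry (i j : Fin 2) := congrFun (congrFun h i) j
  have h00 := entry 0 0
  have h01 := entry 0 1
  have h10 := entry 1 0
  have h11 := entry 1 1
  simp at h00 h01 h10 h11
  constructor
  · linear_combination (g 0 0 * (b / 2) - a * g 0 1) * hdet - g 0 0 * h00 - g 1 0 * h01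
  · linear_combination g 0 0 * h10 + g 1 0 * h11 - (g 1 0 * (b / 2) - a * g 1 1) * hdet

lemma fixes_root (ha : 0 < a) {w : ℝ} (hw : a * w ^ 2 + b * w + c = 0) {g : SL(2, ℤ)}
    (hg : g ∈ stab (formMatrix a b c)) : g 0 0 * w + g 0 1 = eigen w g * w := by
  obtain ⟨h01, h00⟩ := stab_relations hg
  rw [eigen]
  apply mul_left_cancel₀ ha.ne'
  linear_combination w * h00 + h01 - (g 1 0 : ℝ) * hw

lemma eigen_mul_eigen' (ha : 0 < a) (hD : 0 < b ^ 2 - 4 * a * c) {g : SL(2, ℤ)}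
    (hg : g ∈ stab (formMatrix a b c)) :
    eigen (endpoint a b c) g * eigen (endpoint' a b c) g = 1 := by
  obtain ⟨h01, h00⟩ := stab_relations hg
  simp only [eigen, endpoint_eq, endpoint'_eq]
  apply mul_left_cancel₀ ha.ne'
  linear_combination a * det_intCast g - (g 1 1 : ℝ) * h00 + (g 1 0 : ℝ) * h01 -
    (g 1 0 : ℝ) ^ 2 * coeff_c_eq ha hD + (g 1 0 : ℝ) * g 1 1 * coeff_b_eq (b := b) ha

lemma eigen_add_eigen' (ha : 0 < a) {g : SL(2, ℤ)} (hg : g ∈ stab (formMatrix a b c)) :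
    eigen (endpoint a b c) g + eigen (endpoint' a b c) g = g 0 0 + g 1 1 := by
  simp only [eigen, endpoint_eq, endpoint'_eq]
  apply mul_left_cancel₀ ha.ne'
  linear_combination (g 1 0 : ℝ) * coeff_b_eq (b := b) ha - (stab_relations hg).2

lemma eigen_ne_zero (ha : 0 < a) (hD : 0 < b ^ 2 - 4 * a * c) {g : SL(2, ℤ)}
    (hg : g ∈ stab (formMatrix a b c)) : eigen (endpoint a b c) g ≠ 0 :=
  left_ne_zero_of_mul_eq_one (eigen_mul_eigen' ha hD hg)

/-- The translation of the arc length coordinate effected by `g ∈ Γ_A`. -/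
noncomputable def shift (a b c : ℝ) (g : SL(2, ℤ)) : ℝ := Real.log (eigen (endpoint a b c) g ^ 2)

lemma shift_one : shift a b c 1 = 0 := by simp [shift, eigen]

lemma shift_mul (ha : 0 < a) (hD : 0 < b ^ 2 - 4 * a * c) {g h : SL(2, ℤ)}
    (hg : g ∈ stab (formMatrix a b c)) (hh : h ∈ stab (formMatrix a b c)) :
    shift a b c (g * h) = shift a b c g + shift a b c h := by
  rw [shift, eigen_mul g (fixes_root ha (endpoint_root ha hD) hh), mul_pow, Real.log_mul
    (pow_ne_zero 2 (eigen_ne_zero ha hD hg)) (pow_ne_zero 2 (eigen_ne_zero ha hD hh)), shift, shift]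

/-- `shift` as a homomorphism from `Γ_A` to the translations of the real line. -/
noncomputable def shiftHom (ha : 0 < a) (hD : 0 < b ^ 2 - 4 * a * c) :
    Additive (stab (formMatrix a b c)) →+ ℝ where
  toFun g := shift a b c g.toMul
  map_zero' := shift_one
  map_add' g h := shift_mul ha hD g.toMul.2 h.toMul.2

lemma shift_zpow (ha : 0 < a) (hD : 0 < b ^ 2 - 4 * a * c) {g : SL(2, ℤ)}
    (hg : g ∈ stab (formMatrix a b c)) (k : ℤ) : shift a b c (g ^ k) = k * shift a b c g := by
  simpa [shiftHom] using map_zsmul (shiftHom ha hD) k (Additive.ofMul ⟨g, hg⟩)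

lemma exp_shift (ha : 0 < a) (hD : 0 < b ^ 2 - 4 * a * c) {g : SL(2, ℤ)}
    (hg : g ∈ stab (formMatrix a b c)) :
    Real.exp (shift a b c g) = eigen (endpoint a b c) g ^ 2 :=
  Real.exp_log (sq_pos_of_ne_zero (eigen_ne_zero ha hD hg))

lemma exp_neg_shift (ha : 0 < a) (hD : 0 < b ^ 2 - 4 * a * c) {g : SL(2, ℤ)}
    (hg : g ∈ stab (formMatrix a b c)) :
    Real.exp (-shift a b c g) = eigen (endpoint' a b c) g ^ 2 := by
  rw [Real.exp_neg, exp_shift ha hD hg]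
  exact inv_eq_of_mul_eq_one_right (by rw [← mul_pow, eigen_mul_eigen' ha hD hg, one_pow])

lemma conj_vecY0 (ha : 0 < a) (hD : 0 < b ^ 2 - 4 * a * c) {g : SL(2, ℤ)}
    (hg : g ∈ stab (formMatrix a b c)) :
    conj g (vecY0 a b c) = Real.exp (shift a b c g) • vecY0 a b c := by
  rw [exp_shift ha hD hg]
  exact conj_isotropic (fixes_root ha (endpoint_root ha hD) hg)

lemma conj_vecY1 (ha : 0 < a) (hD : 0 < b ^ 2 - 4 * a * c) {g : SL(2, ℤ)}
    (hg : g ∈ stab (formMatrix a b c)) :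
    conj g (vecY1 a b c) = Real.exp (-shift a b c g) • vecY1 a b c := by
  rw [exp_neg_shift ha hD hg]
  exact conj_isotropic (fixes_root ha (endpoint'_root ha hD) hg)

lemma bil_conj_vecY0 (ha : 0 < a) (hD : 0 < b ^ 2 - 4 * a * c) {g : SL(2, ℤ)}
    (hg : g ∈ stab (formMatrix a b c)) (X : V) :
    bil (conj g X) (vecY0 a b c) = Real.exp (-shift a b c g) * bil X (vecY0 a b c) := by
  rw [← bil_conj g X, conj_vecY0 ha hD hg, bil_smul_right, ← mul_assoc, ← Real.exp_add,
    neg_add_cancel, Real.exp_zero, one_mul]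

lemma bil_conj_vecY1 (ha : 0 < a) (hD : 0 < b ^ 2 - 4 * a * c) {g : SL(2, ℤ)}
    (hg : g ∈ stab (formMatrix a b c)) (X : V) :
    bil (conj g X) (vecY1 a b c) = Real.exp (shift a b c g) * bil X (vecY1 a b c) := by
  rw [← bil_conj g X, conj_vecY1 ha hD hg, bil_smul_right, ← mul_assoc, ← Real.exp_add,
    add_neg_cancel, Real.exp_zero, one_mul]

-- `z` is determined by `X(z)`, and `X(z)` is equivariant, so it suffices to move `X(z)`.
lemma smul_pathH (ha : 0 < a) (hD : 0 < b ^ 2 - 4 * a * c) {g : SL(2, ℤ)}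
    (hg : g ∈ stab (formMatrix a b c)) (s : ℝ) :
    g • pathH ha hD s = pathH ha hD (s + shift a b c g) := by
  apply posVec_injective
  change posVec ↑(g • pathH ha hD s) = posVec (geodesicPath a b c (s + shift a b c g))
  rw [← conj_posVec, coe_pathH, posVec_geodesicPath ha hD, posVec_geodesicPath ha hD, conj_smul,
    conj_add, conj_smul, conj_smul, conj_vecY0 ha hD hg, conj_vecY1 ha hD hg, smul_smul, smul_smul,
    ← Real.exp_add, ← Real.exp_add, neg_add]

lemma eq_one_or_neg_one_of_shift_eq_zero (ha : 0 < a) (hD : 0 < b ^ 2 - 4 * a * c)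
    {g : SL(2, ℤ)} (hg : g ∈ stab (formMatrix a b c)) (h : shift a b c g = 0) :
    g = 1 ∨ g = -1 := by
  have hr := radius_pos ha hD
  obtain ⟨h01, h00⟩ := stab_relations hg
  have hsq : eigen (endpoint a b c) g ^ 2 = 1 := by rw [← exp_shift ha hD hg, h, Real.exp_zero]
  have heq : eigen (endpoint' a b c) g = eigen (endpoint a b c) g :=
    mul_left_cancel₀ (eigen_ne_zero ha hD hg) (by rw [eigen_mul_eigen' ha hD hg, ← hsq, sq])
  have h10 : (g 1 0 : ℝ) = 0 := by
    simp only [eigen, endpoint_eq, endpoint'_eq] at heq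
    have : (g 1 0 : ℝ) * (2 * radius a b c) = 0 := by linear_combination heq
    exact (mul_eq_zero.1 this).resolve_right (by positivity)
  simp only [h10, mul_zero, neg_zero, sub_zero, mul_eq_zero, ha.ne', false_or,
    mul_right_inj' ha.ne', eigen, zero_mul, zero_add] at h01 h00 hsq
  norm_cast at h10 h01 h00 hsq
  refine (sq_eq_one_iff.1 hsq).imp (fun h => ?_) (fun h => ?_) <;>
  · ext i j
    fin_cases i <;> fin_cases j <;> simp [h10, h01, h00, h]

lemma conj_eq_self_of_shift_eq_zero (ha : 0 < a) (hD : 0 < b ^ 2 - 4 * a * c)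
    {g : SL(2, ℤ)} (hg : g ∈ stab (formMatrix a b c)) (h : shift a b c g = 0) (X : V) :
    conj g X = X := by
  rcases eq_one_or_neg_one_of_shift_eq_zero ha hD hg h with rfl | rfl
  · exact conj_one X
  · exact conj_neg_one X

lemma shift_eq_zero_of_conj_eq (ha : 0 < a) (hD : 0 < b ^ 2 - 4 * a * c)
    {g : SL(2, ℤ)} (hg : g ∈ stab (formMatrix a b c)) {Y : V} (hY : bil Y (vecY0 a b c) ≠ 0)
    (h : conj g Y = Y) : shift a b c g = 0 := by
  have hexp := bil_conj_vecY0 ha hD hg Y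
  rw [h, right_eq_mul₀ hY, Real.exp_eq_one_iff, neg_eq_zero] at hexp
  exact hexp

lemma stabOrder_eq_one (ha : 0 < a) (hD : 0 < b ^ 2 - 4 * a * c) {Y : V}
    (hY : bil Y (vecY0 a b c) ≠ 0) : stabOrder (formMatrix a b c) Y = 1 := by
  rw [stabOrder, Subgroup.card_eq_one, Subgroup.map_eq_bot_iff, QuotientGroup.ker_mk']
  rintro g ⟨hg, hgY⟩
  rcases eq_one_or_neg_one_of_shift_eq_zero ha hD hg
    (shift_eq_zero_of_conj_eq ha hD hg hY hgY) with rfl | rfl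
  · exact one_mem _
  · exact Subgroup.mem_center_iff.2 fun h => by simp

end Stabilizer

/-! ### A generator of the stabilizer -/

section Generator

variable {a b c : ℝ}

/-- `g₀` generates `Γ_A` (up to sign) and moves the points of `S_A` counter-clockwise. -/
structure IsGenerator (a b c : ℝ) (g₀ : SL(2, ℤ)) : Prop where
  mem : g₀ ∈ stab (formMatrix a b c)
  shift_pos : 0 < shift a b c g₀
  exists_shift_eq : ∀ g ∈ stab (formMatrix a b c), ∃ k : ℤ, shift a b c g = k * shift a b c g₀

lemma two_mul_cosh_shift (ha : 0 < a) (hD : 0 < b ^ 2 - 4 * a * c) {g : SL(2, ℤ)}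
    (hg : g ∈ stab (formMatrix a b c)) :
    2 * Real.cosh (shift a b c g) = ((g 0 0 + g 1 1) ^ 2 - 2 : ℤ) := by
  rw [Real.cosh_eq, exp_shift ha hD hg, exp_neg_shift ha hD hg]
  push_cast
  rw [← eigen_add_eigen' ha hg]
  linear_combination (-2) * eigen_mul_eigen' ha hD hg

-- `2 cosh` of a shift is an integer, hence at least `3` if the shift is nonzero.
lemma log_two_le_shift (ha : 0 < a) (hD : 0 < b ^ 2 - 4 * a * c) {g : SL(2, ℤ)}
    (hg : g ∈ stab (formMatrix a b c)) (h : 0 < shift a b c g) :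
    Real.log 2 ≤ shift a b c g := by
  by_contra! hlt
  have hlo : ((2 : ℤ) : ℝ) < 2 * Real.cosh (shift a b c g) := by
    have := Real.one_lt_cosh.2 h.ne'
    push_cast
    linarith
  have hhi : 2 * Real.cosh (shift a b c g) < (3 : ℤ) := by
    have : Real.cosh (shift a b c g) < Real.cosh (Real.log 2) := by
      rwa [Real.cosh_lt_cosh, abs_of_pos h, abs_of_pos (Real.log_pos one_lt_two)]
    rw [Real.cosh_log two_pos] at this
    push_cast
    linarith
  rw [two_mul_cosh_shift ha hD hg, Int.cast_lt] at hlo hhi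
  omega

/-- The automorph of `[a, b, c]` attached to the solution `(x, y)` of Pell's equation
`x² - D y² = 1`. -/
def pellAutomorph (a b c x y : ℤ) (h : x ^ 2 - (b ^ 2 - 4 * a * c) * y ^ 2 = 1) : SL(2, ℤ) :=
  ⟨!![x + b * y, 2 * c * y; -(2 * a * y), x - b * y], by
    rw [Matrix.det_fin_two_of]; linear_combination h⟩

lemma pellAutomorph_mem_stab {a b c x y : ℤ} (h : x ^ 2 - (b ^ 2 - 4 * a * c) * y ^ 2 = 1) :
    pellAutomorph a b c x y h ∈ stab (formMatrix a b c) := by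
  have hdet : (x : ℝ) ^ 2 - (b ^ 2 - 4 * a * c) * y ^ 2 = 1 := by exact_mod_cast h
  change conj _ _ = _
  rw [conj_apply]
  ext i j
  fin_cases i <;> fin_cases j <;> simp [pellAutomorph, formMatrix]
  · linear_combination (b / 2 : ℝ) * hdet
  · linear_combination (c : ℝ) * hdet
  · linear_combination (-a : ℝ) * hdet
  · linear_combination (-b / 2 : ℝ) * hdet

lemma exists_shift_ne_zero {a b c : ℤ} (ha : 0 < (a : ℝ)) (hD : 0 < b ^ 2 - 4 * a * c)
    (hsq : ¬IsSquare (b ^ 2 - 4 * a * c)) :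
    ∃ g ∈ stab (formMatrix a b c), shift a b c g ≠ 0 := by
  obtain ⟨x, y, hxy, hy⟩ := Pell.exists_of_not_isSquare hD hsq
  have hmem := pellAutomorph_mem_stab hxy
  refine ⟨_, hmem, fun h => ?_⟩
  have ha0 : a ≠ 0 := by exact_mod_cast ha.ne'
  rcases eq_one_or_neg_one_of_shift_eq_zero ha (by exact_mod_cast hD) hmem h with h | h
  all_goals
    have h10 := congrFun (congrFun (congrArg Subtype.val h) 1) 0
    simp [pellAutomorph, ha0, hy] at h10

lemma exists_isGenerator {a b c : ℤ} (ha : 0 < (a : ℝ)) (hD : 0 < b ^ 2 - 4 * a * c)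
    (hsq : ¬IsSquare (b ^ 2 - 4 * a * c)) : ∃ g₀, IsGenerator a b c g₀ := by
  have hD' : (0 : ℝ) < b ^ 2 - 4 * a * c := by exact_mod_cast hD
  obtain ⟨t, ht⟩ := AddSubgroup.cyclic_of_isolated_zero (H := (shiftHom ha hD').range)
    (Real.log_pos one_lt_two) (by
      rw [Set.disjoint_left]
      rintro _ ⟨g, rfl⟩ ⟨hpos, hlt⟩
      exact hlt.not_ge (log_two_le_shift ha hD' g.toMul.2 hpos))
  have hgen : ∀ g ∈ stab (formMatrix a b c), ∃ k : ℤ, shift a b c g = k * t := fun g hg => by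
    have : shift a b c g ∈ (shiftHom ha hD').range := ⟨Additive.ofMul ⟨g, hg⟩, rfl⟩
    rw [ht, AddSubgroup.mem_closure_singleton] at this
    exact this.imp fun k hk => by rw [← hk, zsmul_eq_mul]
  obtain ⟨⟨g, hg⟩, hgt : shift a b c g = t⟩ : t ∈ (shiftHom ha hD').range := by
    rw [ht]; exact AddSubgroup.mem_closure_singleton_self t
  have ht0 : t ≠ 0 := by
    rintro rfl
    obtain ⟨h, hh, hne⟩ := exists_shift_ne_zero ha hD hsq
    exact hne (by simpa using hgen h hh)
  rcases lt_or_gt_of_ne ht0 with hneg | hpos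
  · have hinv : shift a b c g⁻¹ = -t := by simpa [hgt] using shift_zpow ha hD' hg (-1)
    refine ⟨g⁻¹, inv_mem hg, by linarith, fun g' hg' => ?_⟩
    obtain ⟨k, hk⟩ := hgen g' hg'
    exact ⟨-k, by rw [hk, hinv]; push_cast; ring⟩
  · exact ⟨g, hg, by rwa [hgt], by rwa [hgt]⟩

lemma IsGenerator.exists_conj_eq (ha : 0 < a) (hD : 0 < b ^ 2 - 4 * a * c) {g₀ : SL(2, ℤ)}
    (hg₀ : IsGenerator a b c g₀) {g : SL(2, ℤ)} (hg : g ∈ stab (formMatrix a b c)) :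
    ∃ k : ℤ, ∀ X, conj g X = conj (g₀ ^ k) X := by
  obtain ⟨k, hk⟩ := hg₀.exists_shift_eq g hg
  have hzero : shift a b c (g₀ ^ (-k) * g) = 0 := by
    rw [shift_mul ha hD (zpow_mem hg₀.mem _) hg, shift_zpow ha hD hg₀.mem, hk]
    push_cast
    ring
  refine ⟨k, fun X => ?_⟩
  have hself := conj_eq_self_of_shift_eq_zero ha hD (mul_mem (zpow_mem hg₀.mem (-k)) hg) hzero X
  rw [conj_mul, zpow_neg] at hself
  simpa using (conj_inv_eq hself).symm

end Generator

/-! ### Fundamental domains on the geodesic -/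

section FundamentalDomain


variable {a b c : ℝ} {g₀ : SL(2, ℤ)}

lemma exists_smul_pathH_eq_iff (ha : 0 < a) (hD : 0 < b ^ 2 - 4 * a * c)
    (hg₀ : IsGenerator a b c g₀) (s s' : ℝ) :
    (∃ g ∈ stab (formMatrix a b c), g • pathH ha hD s = pathH ha hD s') ↔
      ∃ k : ℤ, s + k • shift a b c g₀ = s' := by
  simp only [zsmul_eq_mul]
  constructor
  · rintro ⟨g, hg, h⟩
    obtain ⟨k, hk⟩ := hg₀.exists_shift_eq g hg
    rw [smul_pathH ha hD hg] at h
    exact ⟨k, by simpa only [arcCoord_pathH, hk] using congrArg (arcCoord a b) h⟩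
  · rintro ⟨k, rfl⟩
    have hk := zpow_mem hg₀.mem k
    exact ⟨g₀ ^ k, hk, by rw [smul_pathH ha hD hk, shift_zpow ha hD hg₀.mem]⟩

lemma measurableSet_geodesic : MeasurableSet (geodesic a b c) := by
  have := UpperHalfPlane.continuous_coe
  have := UpperHalfPlane.continuous_re
  exact (isClosed_eq (by fun_prop) continuous_const).measurableSet

lemma exists_isFundDomain (ha : 0 < a) (hD : 0 < b ^ 2 - 4 * a * c)
    (hg₀ : IsGenerator a b c g₀) : ∃ F : Set ℍ, IsFundDomain a b c F := by
  refine ⟨geodesic a b c ∩ arcCoord a b ⁻¹' Set.Ioc 0 (0 + shift a b c g₀),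
    Set.inter_subset_left,
    measurableSet_geodesic.inter (continuous_arcCoord.measurable measurableSet_Ioc), ?_⟩
  intro z hz
  rw [← pathH_arcCoord ha hD hz]
  obtain ⟨k, hk, huniq⟩ := existsUnique_add_zsmul_mem_Ioc hg₀.shift_pos (arcCoord a b z) 0
  refine ⟨pathH ha hD (arcCoord a b z + k • shift a b c g₀),
    ⟨⟨pathH_mem_geodesic ha hD _, by rwa [Set.mem_preimage, arcCoord_pathH]⟩,
      (exists_smul_pathH_eq_iff ha hD hg₀ _ _).2 ⟨k, rfl⟩⟩, ?_⟩
  rintro z' ⟨⟨hz', hmem⟩, h⟩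
  rw [← pathH_arcCoord ha hD hz'] at h ⊢
  obtain ⟨k', hk'⟩ := (exists_smul_pathH_eq_iff ha hD hg₀ _ _).1 h
  rw [Set.mem_preimage, ← hk'] at hmem
  rw [← hk', huniq k' hmem]

lemma isAddFundamentalDomain_params (ha : 0 < a) (hD : 0 < b ^ 2 - 4 * a * c)
    (hg₀ : IsGenerator a b c g₀) {F : Set ℍ} (hF : IsFundDomain a b c F) :
    IsAddFundamentalDomain (AddSubgroup.zmultiples (shift a b c g₀)) (params a b c F)
      volume := by
  obtain ⟨hsub, hmeas, huniq⟩ := hF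
  rw [params_eq_preimage ha hD]
  refine IsAddFundamentalDomain.mk'
    ((continuous_pathH ha hD).measurable hmeas).nullMeasurableSet fun s => ?_
  obtain ⟨z, ⟨hz, h⟩, hu⟩ := huniq _ (pathH_mem_geodesic ha hD s)
  rw [← pathH_arcCoord ha hD (hsub hz)] at h hz
  obtain ⟨k, hk⟩ := (exists_smul_pathH_eq_iff ha hD hg₀ _ _).1 h
  refine ⟨⟨k • shift a b c g₀, k, rfl⟩, ?_, ?_⟩
  · change pathH ha hD (k • shift a b c g₀ + s) ∈ F
    rwa [add_comm, hk]
  · rintro ⟨_, ⟨j, rfl⟩⟩ (hj : pathH ha hD (j • shift a b c g₀ + s) ∈ F)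
    have hjz := hu _ ⟨hj, (exists_smul_pathH_eq_iff ha hD hg₀ _ _).2 ⟨j, add_comm _ _⟩⟩
    have hjs := congrArg (arcCoord a b) hjz
    rw [arcCoord_pathH, ← hk, add_comm, add_right_inj] at hjs
    exact Subtype.ext hjs

end FundamentalDomain

/-! ### Gaussian sums over lattices -/

/-- The squared Euclidean norm on the space of matrices of trace zero, used to dominate the theta
series. -/
noncomputable def sqNorm (X : V) : ℝ := X 0 0 ^ 2 + X 0 1 ^ 2 + X 1 0 ^ 2

lemma summable_exp_neg_mul_int_sq {c : ℝ} (hc : 0 < c) :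
    Summable fun n : ℤ => Real.exp (-c * (n : ℝ) ^ 2) := by
  have him : 0 < (((c / Real.pi : ℝ) : ℂ) * Complex.I).im := by
    rw [Complex.im_ofReal_mul, Complex.I_im, mul_one]
    positivity
  refine ((summable_jacobiTheta₂_term_iff 0 _).2 him).norm.congr fun n => ?_
  rw [norm_jacobiTheta₂_term]
  congr 1
  simp
  field_simp

lemma summable_exp_neg_sqNorm {ι : Type*} {f : ι → V} (hf : Function.Injective f) {K : ℝ}
    (hK : K ≠ 0) (hL : ∀ i, K • f i ∈ latticeL) {c : ℝ} (hc : 0 < c) :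
    Summable fun i => Real.exp (-c * sqNorm (f i)) := by
  choose α β γ hcoord using hL
  have hone := summable_exp_neg_mul_int_sq (c := c / K ^ 2) (by positivity)
  have hthree := hone.mul_of_nonneg (hone.mul_of_nonneg hone (fun _ => (Real.exp_pos _).le)
    (fun _ => (Real.exp_pos _).le)) (fun _ => (Real.exp_pos _).le)
    (fun _ => (mul_pos (Real.exp_pos _) (Real.exp_pos _)).le)
  have hinj : Function.Injective fun i => (α i, β i, γ i) := by
    intro i j hij
    simp only [Prod.mk.injEq] at hij
    have : K • f i = K • f j := by rw [hcoord i, hcoord j, hij.1, hij.2.1, hij.2.2]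
    exact hf (smul_right_injective V hK this)
  refine (hthree.comp_injective hinj).congr fun i => ?_
  have h00 : K * f i 0 0 = β i := by simpa using congr($(hcoord i) 0 0)
  have h01 : K * f i 0 1 = γ i := by simpa using congr($(hcoord i) 0 1)
  have h10 : K * f i 1 0 = -α i := by simpa using congr($(hcoord i) 1 0)
  simp only [Function.comp_apply]
  rw [← Real.exp_add, ← Real.exp_add, sqNorm, ← h00, ← h01, ← neg_sq (α i : ℝ), ← h10]
  congr 1
  field_simp
  ring

/-! ### The Siegel theta function -/

lemma norm_e (x : ℂ) : ‖e x‖ = Real.exp (-(2 * Real.pi * x.im)) := by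
  rw [e, Complex.norm_exp]
  simp

lemma e_add (x y : ℂ) : e (x + y) = e x * e y := by
  rw [e, e, e, ← Complex.exp_add, mul_add]

lemma e_mul_I (x : ℝ) : e (x * Complex.I) = (Real.exp (-(2 * Real.pi * x)) : ℝ) := by
  rw [e, Complex.ofReal_exp]
  congr 1
  push_cast
  linear_combination (2 * Real.pi * x : ℂ) * Complex.I_sq

lemma bil_posVec_self {z : ℂ} (hz : 0 < z.im) : bil (posVec z) (posVec z) = 1 := by
  have hsqrt : √2 ^ 2 = 2 := Real.sq_sqrt two_pos.le
  rw [posVec, bil_smul_left, bil_smul_right, bil_eq, Complex.sq_norm, Complex.normSq_apply]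
  simp
  field_simp
  rw [hsqrt]
  ring

lemma q_projLine {A : V} (hA : bil A A = 1) (X : V) : q (projLine A X) = bil X A ^ 2 / 2 := by
  have hq := bil_self A
  rw [projLine, q_smul, hA, div_one]
  rw [hA] at hq
  linear_combination (-(bil X A ^ 2) / 2) * hq

lemma q_projPerp {A : V} (hA : bil A A = 1) (X : V) :
    q (projPerp A X) = q X - bil X A ^ 2 / 2 := by
  have hsum := q_add (projPerp A X) (projLine A X)
  have hperp : bil (projPerp A X) (projLine A X) = 0 := by
    rw [projLine, bil_smul_right, bil_projPerp (by rw [hA]; exact one_ne_zero), mul_zero]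
  rw [projPerp_add_projLine, q_projLine hA, hperp] at hsum
  linarith

lemma starRingEnd_coe (τ : ℍ) : (starRingEnd ℂ) (τ : ℂ) = τ - 2 * τ.im * Complex.I := by
  rw [eq_sub_iff_add_eq', ← eq_sub_iff_add_eq, Complex.sub_conj]
  push_cast
  rfl

lemma siegelTerm_eq (τ : ℍ) {z : ℂ} (hz : 0 < z.im) (X : V) :
    siegelTerm τ z X = e ((q X : ℂ) * (starRingEnd ℂ) (τ : ℂ)) *
      (Real.exp (-(2 * Real.pi * (τ.im * bil X (posVec z) ^ 2))) : ℝ) := by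
  have hp := bil_posVec_self hz
  rw [siegelTerm, q_projLine hp, q_projPerp hp, ← e_mul_I, ← e_add, starRingEnd_coe]
  congr 1
  push_cast
  ring

/-- The value at `X` of the positive definite form `q(X_z) - q(X_{z^⊥})`, the majorant of `q`
attached to `z`; the encoding uses that `q(X_z) = (X, X(z))² / 2`. -/
noncomputable def majorant (z : ℂ) (X : V) : ℝ := bil X (posVec z) ^ 2 - q X

lemma norm_siegelTerm (τ : ℍ) {z : ℂ} (hz : 0 < z.im) (X : V) :
    ‖siegelTerm τ z X‖ = Real.exp (-(2 * Real.pi * τ.im * majorant z X)) := by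
  rw [siegelTerm_eq τ hz, norm_mul, norm_e, Complex.norm_real, Real.norm_of_nonneg
    (Real.exp_pos _).le, ← Real.exp_add, majorant]
  congr 1
  simp
  ring

/-- The partial derivative of `(X, X(z))` with respect to `x`. -/
noncomputable def posDerivX (X : V) (z : ℂ) : ℝ :=
  √2 * (-X 1 0 * z.re + X 0 0) / z.im

/-- The partial derivative of `(X, X(z))` with respect to `y`. -/
noncomputable def posDerivY (X : V) (z : ℂ) : ℝ :=
  √2 * -X 1 0 - bil X (posVec z) / z.im

section Majorant

variable {X : V} {z : ℂ}

lemma bil_posVec (hX : X 1 1 = -X 0 0) (z : ℂ) : bil X (posVec z) =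
    (-X 1 0 * (z.re ^ 2 + z.im ^ 2) + 2 * X 0 0 * z.re + X 0 1) * (√2 * z.im)⁻¹ := by
  rw [posVec, bil_smul_right, bil_eq, Complex.sq_norm, Complex.normSq_apply]
  simp [hX]
  ring

lemma hasFDerivAt_bil_posVec (hX : X 1 1 = -X 0 0) (hz : 0 < z.im) :
    HasFDerivAt (fun z => bil X (posVec z))
      (posDerivX X z • Complex.reCLM + posDerivY X z • Complex.imCLM) z := by
  have hsqrt : √2 ^ 2 = 2 := Real.sq_sqrt two_pos.le
  have hre : HasFDerivAt Complex.re Complex.reCLM z := Complex.reCLM.hasFDerivAt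
  have him : HasFDerivAt Complex.im Complex.imCLM z := Complex.imCLM.hasFDerivAt
  have hnum := ((((hre.pow 2).add (him.pow 2)).const_mul (-X 1 0)).add
    (hre.const_mul (2 * X 0 0))).add_const (X 0 1)
  have hden := (hasDerivAt_inv (show √2 * z.im ≠ 0 by positivity)).comp_hasFDerivAt z
    (him.const_mul √2)
  rw [funext (bil_posVec hX)]
  refine (hnum.mul hden).congr_fderiv ?_
  ext v
  simp [posDerivX, posDerivY, bil_posVec hX]
  field_simp
  rw [hsqrt]
  ring

/-- The tangent vectors `y ∂X(z)/∂x` and `y ∂X(z)/∂y` form an orthogonal basis of `X(z)^⊥`. -/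
lemma two_mul_majorant (hX : X 1 1 = -X 0 0) (hz : 0 < z.im) : 2 * majorant z X =
    bil X (posVec z) ^ 2 + (z.im * posDerivX X z) ^ 2 + (z.im * posDerivY X z) ^ 2 := by
  have hsqrt : √2 ^ 2 = 2 := Real.sq_sqrt two_pos.le
  rw [majorant, posDerivX, posDerivY, bil_posVec hX, q_eq, hX]
  field_simp
  rw [show √2 ^ 4 = (√2 ^ 2) ^ 2 by ring, hsqrt]
  ring

lemma majorant_nonneg (hX : X 1 1 = -X 0 0) (hz : 0 < z.im) : 0 ≤ majorant z X := by
  have := two_mul_majorant hX hz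
  have : 0 ≤ 2 * majorant z X := by rw [this]; positivity
  linarith

lemma abs_bil_posVec_mul_abs_posDeriv_le (hX : X 1 1 = -X 0 0) (hz : 0 < z.im) :
    |bil X (posVec z)| * (|posDerivX X z| + |posDerivY X z|) ≤ 2 / z.im * majorant z X := by
  have hm := two_mul_majorant hX hz
  simp only [mul_pow, ← sq_abs (bil X (posVec z)), ← sq_abs (posDerivX X z),
    ← sq_abs (posDerivY X z)] at hm
  rw [div_mul_eq_mul_div, le_div_iff₀ hz, hm]
  nlinarith [sq_nonneg (|bil X (posVec z)| - z.im * |posDerivX X z|),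
    sq_nonneg (|bil X (posVec z)| - z.im * |posDerivY X z|)]

/-- A locally bounded constant comparing the Euclidean norm with the majorant attached to `z`. -/
noncomputable def distortion (z : ℂ) : ℝ :=
  (2 + 4 * z.re ^ 2 + 6 * z.re ^ 4) / z.im ^ 2 + 2 + 6 * z.im ^ 2 + 12 * z.re ^ 2

lemma distortion_pos : 0 < distortion z := by unfold distortion; positivity

lemma continuousAt_distortion (hz : 0 < z.im) : ContinuousAt distortion z := by
  have : z.im ^ 2 ≠ 0 := by positivity
  unfold distortion
  fun_prop (disch := assumption)

lemma sqNorm_le (hX : X 1 1 = -X 0 0) (hz : 0 < z.im) :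
    sqNorm X ≤ distortion z * majorant z X := by
  have hm := two_mul_majorant hX hz
  have hsqrt : √2 ^ 2 = 2 := Real.sq_sqrt two_pos.le
  have h10 : √2 * (z.im * X 1 0) = -(z.im * posDerivY X z) - bil X (posVec z) := by
    rw [posDerivY]; field_simp; ring
  have h00 : X 0 0 = z.im * posDerivX X z / √2 + X 1 0 * z.re := by
    rw [posDerivX]; field_simp; ring
  have h01 : X 0 1 = z.im * (bil X (posVec z) - z.im * posDerivY X z) / √2 - X 1 0 * z.re ^ 2 -
      2 * z.re * (z.im * posDerivX X z / √2) := by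
    rw [posDerivX, posDerivY, bil_posVec hX]; field_simp; rw [hsqrt]; ring
  set p := bil X (posVec z)
  set r := z.im * posDerivX X z
  set s := z.im * posDerivY X z
  have hle10 : X 1 0 ^ 2 ≤ 2 * majorant z X / z.im ^ 2 := by
    rw [le_div_iff₀ (by positivity)]
    nlinarith [congr($h10 ^ 2), sq_nonneg (s - p), sq_nonneg r]
  have hle00 : X 0 0 ^ 2 ≤ r ^ 2 + 2 * z.re ^ 2 * X 1 0 ^ 2 := by
    have : (r / √2) ^ 2 = r ^ 2 / 2 := by rw [div_pow, hsqrt]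
    nlinarith [congr($h00 ^ 2), sq_nonneg (r / √2 - X 1 0 * z.re)]
  have hle01 : X 0 1 ^ 2 ≤ 3 * (z.im ^ 2 * (p ^ 2 + s ^ 2) + z.re ^ 4 * X 1 0 ^ 2 +
      2 * z.re ^ 2 * r ^ 2) := by
    have hU : (z.im * (p - s) / √2) ^ 2 ≤ z.im ^ 2 * (p ^ 2 + s ^ 2) := by
      rw [div_pow, hsqrt, mul_pow]
      nlinarith [mul_nonneg (sq_nonneg z.im) (sq_nonneg (p + s))]
    have hT : (2 * z.re * (r / √2)) ^ 2 = 2 * z.re ^ 2 * r ^ 2 := by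
      rw [mul_pow, div_pow, hsqrt]; ring
    rw [h01]
    nlinarith [sq_nonneg (z.im * (p - s) / √2 + X 1 0 * z.re ^ 2),
      sq_nonneg (z.im * (p - s) / √2 + 2 * z.re * (r / √2)),
      sq_nonneg (X 1 0 * z.re ^ 2 - 2 * z.re * (r / √2))]
  calc sqNorm X ≤ (1 + 2 * z.re ^ 2 + 3 * z.re ^ 4) * X 1 0 ^ 2 + (1 + 6 * z.re ^ 2) * r ^ 2 +
        3 * z.im ^ 2 * (p ^ 2 + s ^ 2) := by rw [sqNorm]; linarith
    _ ≤ (1 + 2 * z.re ^ 2 + 3 * z.re ^ 4) * (2 * majorant z X / z.im ^ 2) +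
        (1 + 6 * z.re ^ 2) * (2 * majorant z X) + 3 * z.im ^ 2 * (2 * majorant z X) := by
      gcongr <;> rw [hm] <;> nlinarith [sq_nonneg p, sq_nonneg r, sq_nonneg s]
    _ = distortion z * majorant z X := by rw [distortion]; ring

lemma exp_neg_mul_majorant_le (hX : X 1 1 = -X 0 0) (hz : 0 < z.im) {C M : ℝ} (hC : 0 ≤ C)
    (hM : distortion z ≤ M) :
    Real.exp (-(C * majorant z X)) ≤ Real.exp (-(C / M) * sqNorm X) := by
  have hM' : 0 < M := distortion_pos.trans_le hM
  rw [Real.exp_le_exp, neg_mul, neg_le_neg_iff, div_mul_eq_mul_div, div_le_iff₀ hM', mul_assoc,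
    mul_comm _ M]
  gcongr
  exact (sqNorm_le hX hz).trans (mul_le_mul_of_nonneg_right hM (majorant_nonneg hX hz))

end Majorant

/-- The derivative of a summand of the Siegel theta function. -/
noncomputable def siegelTermDeriv (τ : ℍ) (X : V) (z : ℂ) : ℂ →L[ℝ] ℂ :=
  (siegelTerm τ z X * ((-(4 * Real.pi * τ.im) * bil X (posVec z) : ℝ) : ℂ)) •
    Complex.ofRealCLM.comp (posDerivX X z • Complex.reCLM + posDerivY X z • Complex.imCLM)

lemma hasFDerivAt_siegelTerm (τ : ℍ) {X : V} (hX : X 1 1 = -X 0 0) {z : ℂ} (hz : 0 < z.im) :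
    HasFDerivAt (fun z => siegelTerm τ z X) (siegelTermDeriv τ X z) z := by
  have hexp := ((((hasFDerivAt_bil_posVec hX hz).pow 2).const_mul τ.im).const_mul
    (2 * Real.pi)).neg.exp
  have hterm := (Complex.ofRealCLM.hasFDerivAt.comp z hexp).const_mul
    (e ((q X : ℂ) * (starRingEnd ℂ) (τ : ℂ)))
  have heq : (fun z => siegelTerm τ z X) =ᶠ[nhds z] fun z =>
      e ((q X : ℂ) * (starRingEnd ℂ) (τ : ℂ)) * (Complex.ofRealCLM ∘ fun z =>
        Real.exp (-(2 * Real.pi * (τ.im * bil X (posVec z) ^ 2)))) z := by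
    filter_upwards [(isOpen_lt continuous_const Complex.continuous_im).mem_nhds hz] with z' hz'
    exact siegelTerm_eq τ hz' X
  refine (hterm.congr_of_eventuallyEq heq).congr_fderiv ?_
  rw [siegelTermDeriv, siegelTerm_eq τ hz]
  ext v
  simp
  ring

lemma mul_exp_neg_two_mul_le (x : ℝ) : x * Real.exp (-(2 * x)) ≤ Real.exp (-x) := by
  rw [show -(2 * x) = -x + -x by ring, Real.exp_add, ← mul_assoc]
  refine mul_le_of_le_one_left (Real.exp_pos _).le ?_
  rw [Real.exp_neg, ← div_eq_mul_inv, div_le_one (Real.exp_pos _)]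
  linarith [Real.add_one_le_exp x]

lemma norm_siegelTermDeriv_le (τ : ℍ) {X : V} (hX : X 1 1 = -X 0 0) {z : ℂ} (hz : 0 < z.im) :
    ‖siegelTermDeriv τ X z‖ ≤ 8 / z.im * Real.exp (-(Real.pi * τ.im * majorant z X)) := by
  have := τ.im_pos
  have hgrad : ‖Complex.ofRealCLM.comp
      (posDerivX X z • Complex.reCLM + posDerivY X z • Complex.imCLM)‖ ≤
      |posDerivX X z| + |posDerivY X z| := by
    refine (ContinuousLinearMap.opNorm_comp_le _ _).trans ?_
    rw [Complex.ofRealCLM_norm, one_mul]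
    refine (norm_add_le _ _).trans_eq ?_
    rw [norm_smul, norm_smul, Complex.reCLM_norm, Complex.imCLM_norm, mul_one, mul_one,
      Real.norm_eq_abs, Real.norm_eq_abs]
  rw [siegelTermDeriv, norm_smul, norm_mul, norm_siegelTerm τ hz, Complex.norm_real,
    Real.norm_eq_abs, abs_mul, abs_neg, abs_of_pos (by positivity : 0 < 4 * Real.pi * τ.im)]
  set m := majorant z X
  calc _ ≤ Real.exp (-(2 * Real.pi * τ.im * m)) * (4 * Real.pi * τ.im * |bil X (posVec z)|) *
        (|posDerivX X z| + |posDerivY X z|) := by gcongr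
    _ = Real.exp (-(2 * Real.pi * τ.im * m)) * (4 * Real.pi * τ.im) *
        (|bil X (posVec z)| * (|posDerivX X z| + |posDerivY X z|)) := by ring
    _ ≤ Real.exp (-(2 * Real.pi * τ.im * m)) * (4 * Real.pi * τ.im) * (2 / z.im * m) := by
      gcongr _ * ?_
      exact abs_bil_posVec_mul_abs_posDeriv_le hX hz
    _ = 8 / z.im * (Real.pi * τ.im * m * Real.exp (-(2 * (Real.pi * τ.im * m)))) := by ring_nf
    _ ≤ 8 / z.im * Real.exp (-(Real.pi * τ.im * m)) := by
      gcongr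
      exact mul_exp_neg_two_mul_le _

section SiegelTheta

variable (τ : ℍ) (γ : Disc latticeL) {z : ℂ}

lemma summable_exp_neg_sqNorm_dual_latticeL {c : ℝ} (hc : 0 < c) :
    Summable fun X : {X : dual latticeL // toDisc latticeL X = γ} =>
      Real.exp (-c * sqNorm (X.1 : V)) :=
  summable_exp_neg_sqNorm (f := fun X : {X : dual latticeL // toDisc latticeL X = γ} => (X.1 : V))
    (Subtype.val_injective.comp Subtype.val_injective) two_ne_zero
    (fun X => two_smul_mem_latticeL X.1.2) hc

lemma summable_siegelTerm (hz : 0 < z.im) :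
    Summable fun X : {X : dual latticeL // toDisc latticeL X = γ} => siegelTerm τ z X.1 := by
  have := τ.im_pos
  have := distortion_pos (z := z)
  refine .of_norm_bounded (summable_exp_neg_sqNorm_dual_latticeL γ
    (c := 2 * Real.pi * τ.im / distortion z) (by positivity)) fun X => ?_
  rw [norm_siegelTerm τ hz]
  exact exp_neg_mul_majorant_le (traceless_of_mem_dual le_rfl X.1.2) hz (by positivity) le_rfl

lemma eventually_norm_siegelTermDeriv_le (hz : 0 < z.im) :
    ∀ᶠ z' in nhds z, 0 < z'.im ∧ ∀ X : dual latticeL, ‖siegelTermDeriv τ X z'‖ ≤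
      16 / z.im * Real.exp (-(Real.pi * τ.im / (distortion z + 1)) * sqNorm (X : V)) := by
  have := τ.im_pos
  have him : ∀ᶠ z' in nhds z, z.im / 2 < z'.im :=
    Complex.continuous_im.continuousAt.eventually_const_lt (by linarith)
  have hdist : ∀ᶠ z' in nhds z, distortion z' < distortion z + 1 :=
    (continuousAt_distortion hz).eventually_lt continuousAt_const (by linarith)
  filter_upwards [him, hdist] with z' him' hdist'
  have hz' : 0 < z'.im := by linarith
  refine ⟨hz', fun X => ?_⟩
  have hX := traceless_of_mem_dual le_rfl X.2
  have hfactor : 8 / z'.im ≤ 16 / z.im := by rw [div_le_div_iff₀ hz' hz]; linarith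
  refine (norm_siegelTermDeriv_le τ hX hz').trans ?_
  exact mul_le_mul hfactor (exp_neg_mul_majorant_le hX hz' (by positivity) hdist'.le)
    (Real.exp_pos _).le (by positivity)

lemma summable_siegelTermDeriv_bound {z : ℂ} : Summable fun X : {X : dual latticeL //
    toDisc latticeL X = γ} => 16 / z.im * Real.exp
      (-(Real.pi * τ.im / (distortion z + 1)) * sqNorm (X.1 : V)) := by
  have := τ.im_pos
  have := distortion_pos (z := z)
  exact (summable_exp_neg_sqNorm_dual_latticeL γ (by positivity)).mul_left _

lemma summable_siegelTermDeriv (hz : 0 < z.im) :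
    Summable fun X : {X : dual latticeL // toDisc latticeL X = γ} => siegelTermDeriv τ X.1 z :=
  .of_norm_bounded (summable_siegelTermDeriv_bound τ γ) fun X =>
    (eventually_norm_siegelTermDeriv_le τ hz).self_of_nhds.2 X.1

lemma hasFDerivAt_tsum_siegelTerm (hz : 0 < z.im) :
    HasFDerivAt (fun z => ∑' X : {X : dual latticeL // toDisc latticeL X = γ},
      siegelTerm τ z X.1)
      (∑' X : {X : dual latticeL // toDisc latticeL X = γ}, siegelTermDeriv τ X.1 z) z := by
  obtain ⟨ε, hε, hball⟩ := Metric.eventually_nhds_iff_ball.1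
    (eventually_norm_siegelTermDeriv_le τ hz)
  have hmem : z ∈ Metric.ball z ε := Metric.mem_ball_self hε
  exact hasFDerivAt_tsum_of_isPreconnected (summable_siegelTermDeriv_bound τ γ)
    Metric.isOpen_ball (convex_ball z ε).isPreconnected
    (fun X z' hz' => hasFDerivAt_siegelTerm τ (traceless_of_mem_dual le_rfl X.1.2)
      (hball z' hz').1)
    (fun X z' hz' => (hball z' hz').2 X.1) hmem (summable_siegelTerm τ γ hz) hmem

lemma differentiableAt_siegelTheta (hz : 0 < z.im) :
    DifferentiableAt ℝ (fun z : ℂ => siegelTheta τ z γ) z :=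
  ((hasFDerivAt_tsum_siegelTerm τ γ hz).const_mul (τ.im : ℂ)).differentiableAt

/-- The contribution of `X ∈ L'` to `R₀ Θ_L(τ, z)`. -/
noncomputable def raisingTerm (τ : ℍ) (z : ℂ) (X : V) : ℂ :=
  Complex.I * τ.im * (siegelTerm τ z X * ((-(4 * Real.pi * τ.im) * bil X (posVec z) : ℝ) : ℂ) *
    (posDerivX X z - Complex.I * posDerivY X z))

lemma hasSum_raising_siegelTheta (hz : 0 < z.im) :
    HasSum (fun X : {X : dual latticeL // toDisc latticeL X = γ} => raisingTerm τ z X.1)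
      (raising 0 (fun z : ℂ => siegelTheta τ z γ) z) := by
  set S := ∑' X : {X : dual latticeL // toDisc latticeL X = γ}, siegelTermDeriv τ X.1 z
  have hfderiv : fderiv ℝ (fun z : ℂ => siegelTheta τ z γ) z = (τ.im : ℂ) • S :=
    ((hasFDerivAt_tsum_siegelTerm τ γ hz).const_mul (τ.im : ℂ)).fderiv
  have hraising : raising 0 (fun z : ℂ => siegelTheta τ z γ) z =
      Complex.I * τ.im * (S 1 - Complex.I * S Complex.I) := by
    simp only [raising, dWirtinger, hfderiv, smul_apply, smul_eq_mul]
    push_cast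
    ring
  have happly (v : ℂ) := (ContinuousLinearMap.apply ℝ ℂ v).hasSum
    (summable_siegelTermDeriv τ γ hz).hasSum
  have hsumS := ((happly 1).sub ((happly Complex.I).mul_left Complex.I)).mul_left
    (Complex.I * τ.im)
  rw [hraising]
  refine hsumS.congr_fun fun X => ?_
  simp [siegelTermDeriv, raisingTerm]
  ring

end SiegelTheta

/-! ### Unfolding -/

section Unfolding

variable {E : Type*} [NormedAddCommGroup E] {T : ℝ}

lemma setIntegral_Ioc_comp_sub_intCast_mul [NormedSpace ℝ E] (hT : 0 < T) (f : ℝ → E) (j : ℤ) :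
    ∫ s in Set.Ioc 0 T, f (s - j * T) = ∫ s in Set.Ioc (-j • T) ((-j + 1) • T), f s := by
  rw [← intervalIntegral.integral_of_le hT.le, intervalIntegral.integral_comp_sub_right,
    intervalIntegral.integral_of_le (by linarith)]
  congr 3 <;> push_cast [zsmul_eq_mul] <;> ring

lemma integrable_of_summable_integral_norm_comp_sub (hT : 0 < T) {f : ℝ → E} (hf : Continuous f)
    (hsum : Summable fun j : ℤ => ∫ s in Set.Ioc 0 T, ‖f (s - j * T)‖) : Integrable f := by
  rw [← integrableOn_univ, ← iUnion_Ioc_zsmul hT]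
  refine integrableOn_iUnion_of_summable_integral_norm
    (fun j => hf.integrableOn_Icc.mono_set Set.Ioc_subset_Icc_self) ?_
  refine ((Equiv.neg ℤ).summable_iff.2 hsum).congr fun j => ?_
  rw [Function.comp_apply, setIntegral_Ioc_comp_sub_intCast_mul hT (fun s => ‖f s‖),
    Equiv.neg_apply, neg_neg]

lemma hasSum_integral_comp_sub [NormedSpace ℝ E] (hT : 0 < T) {f : ℝ → E} (hf : Integrable f) :
    HasSum (fun j : ℤ => ∫ s in Set.Ioc 0 T, f (s - j * T)) (∫ s, f s) := by
  have hpieces := hasSum_integral_iUnion (f := f) (μ := volume)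
    (fun j : ℤ => measurableSet_Ioc) (Set.pairwise_disjoint_Ioc_zsmul T) hf.integrableOn
  rw [iUnion_Ioc_zsmul hT, setIntegral_univ] at hpieces
  refine ((Equiv.neg ℤ).hasSum_iff.2 hpieces).congr_fun fun j => ?_
  rw [Function.comp_apply, setIntegral_Ioc_comp_sub_intCast_mul hT, Equiv.neg_apply]

variable {ι : Type*} {r : Setoid ι} {σ : Equiv.Perm ι}

lemma injective_zpow_apply (hfree : ∀ (y) (j : ℤ), (σ ^ j) y = y → j = 0) (y : ι) :
    Function.Injective fun j : ℤ => (σ ^ j) y := by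
  intro i j (hij : (σ ^ i) y = (σ ^ j) y)
  have hfix : (σ ^ (-j + i)) y = y := by
    rw [zpow_add, Equiv.Perm.mul_apply, hij, ← Equiv.Perm.mul_apply, ← zpow_add,
      neg_add_cancel, zpow_zero, Equiv.Perm.one_apply]
  have := hfree _ _ hfix
  lia

lemma bijective_zpow_out (hr : ∀ y y', r y y' ↔ σ.SameCycle y y')
    (hfree : ∀ (y) (j : ℤ), (σ ^ j) y = y → j = 0) :
    Function.Bijective fun x : Quotient r × ℤ => (σ ^ x.2) x.1.out := by
  constructor
  · rintro ⟨c, i⟩ ⟨d, j⟩ (hij : (σ ^ i) c.out = (σ ^ j) d.out)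
    have hcd : c = d := by
      rw [← Quotient.out_equiv_out]
      refine (hr _ _).2 ((Equiv.Perm.SameCycle.trans ⟨i, hij⟩) ⟨-j, ?_⟩)
      rw [← Equiv.Perm.mul_apply, ← zpow_add, neg_add_cancel, zpow_zero, Equiv.Perm.one_apply]
    subst hcd
    rw [injective_zpow_apply hfree _ hij]
  · intro y
    obtain ⟨j, hj⟩ := (hr _ _).1 (Quotient.mk_out (s := r) y)
    exact ⟨(⟦y⟧, j), hj⟩

lemma integrable_of_summable_unfold (hfree : ∀ (y) (j : ℤ), (σ ^ j) y = y → j = 0) (hT : 0 < T)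
    {k : ι → ℝ → E} (hk : ∀ y (j : ℤ) s, k ((σ ^ j) y) s = k y (s - j * T))
    (hcont : ∀ y, Continuous (k y)) (hsum : Summable fun y => ∫ s in Set.Ioc 0 T, ‖k y s‖)
    (y : ι) : Integrable (k y) := by
  refine integrable_of_summable_integral_norm_comp_sub hT (hcont y) ?_
  simpa only [Function.comp_def, hk] using hsum.comp_injective (injective_zpow_apply hfree y)

lemma hasSum_integral_unfold (hr : ∀ y y', r y y' ↔ σ.SameCycle y y')
    (hfree : ∀ (y) (j : ℤ), (σ ^ j) y = y → j = 0) [NormedSpace ℝ E] [CompleteSpace E] (hT : 0 < T)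
    {k : ι → ℝ → E} (hk : ∀ y (j : ℤ) s, k ((σ ^ j) y) s = k y (s - j * T))
    (hcont : ∀ y, Continuous (k y)) (hsum : Summable fun y => ∫ s in Set.Ioc 0 T, ‖k y s‖) :
    HasSum (fun c : Quotient r => ∫ s, k c.out s) (∑' y, ∫ s in Set.Ioc 0 T, k y s) := by
  have hsum' : Summable fun y => ∫ s in Set.Ioc 0 T, k y s :=
    .of_norm_bounded hsum fun y => norm_integral_le_integral_norm _
  refine ((Equiv.ofBijective _ (bijective_zpow_out hr hfree)).hasSum_iff.2
    hsum'.hasSum).prod_fiberwise fun c => ?_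
  simpa only [Function.comp_def, Equiv.ofBijective_apply, hk] using
    hasSum_integral_comp_sub hT (integrable_of_summable_unfold hfree hT hk hcont hsum c.out)

end Unfolding

/-! ### Gaussian integrals over the whole geodesic -/

section GaussianIntegral

/-- The function `m e^s + n e^{-s}`, the shape of `(X, X(z))` in the arc length `s` of `S_A`. -/
noncomputable def expSum (m n s : ℝ) : ℝ := m * Real.exp s + n * Real.exp (-s)

lemma hasDerivAt_expSum (m n s : ℝ) : HasDerivAt (expSum m n) (expSum m (-n) s) s :=
  (((Real.hasDerivAt_exp s).const_mul m).add
    ((hasDerivAt_neg s).exp.const_mul n)).congr_deriv (by simp [expSum])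

lemma continuous_expSum (m n : ℝ) : Continuous (expSum m n) := by
  unfold expSum; fun_prop

lemma expSum_neg (m n s : ℝ) : expSum m n (-s) = expSum n m s := by
  rw [expSum, expSum, neg_neg, add_comm]

lemma neg_expSum (m n s : ℝ) : -expSum m n s = expSum (-m) (-n) s := by
  rw [expSum, expSum]; ring

lemma expSum_sq (m n s : ℝ) : expSum m n s ^ 2 = expSum m (-n) s ^ 2 + 4 * (m * n) := by
  have hexp : Real.exp s * Real.exp (-s) = 1 := by
    rw [← Real.exp_add, add_neg_cancel, Real.exp_zero]
  unfold expSum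
  linear_combination (4 * m * n) * hexp

lemma tendsto_expSum_atTop {m : ℝ} (hm : 0 < m) (n : ℝ) :
    Tendsto (expSum m n) atTop atTop :=
  (Real.tendsto_exp_atTop.const_mul_atTop hm).atTop_add
    (Real.tendsto_exp_neg_atTop_nhds_zero.const_mul n)

lemma tendsto_expSum_atBot {m : ℝ} (hm : m < 0) (n : ℝ) :
    Tendsto (expSum m n) atTop atBot := by
  refine (tendsto_neg_atTop_atBot.comp (tendsto_expSum_atTop (neg_pos.2 hm) (-n))).congr fun s => ?_
  rw [Function.comp_apply, neg_expSum, neg_neg, neg_neg]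

lemma tendsto_expSum_sq {m : ℝ} (hm : m ≠ 0) (n : ℝ) :
    Tendsto (fun s => expSum m n s ^ 2) atTop atTop := by
  rcases hm.lt_or_gt with hneg | hpos
  · refine ((tendsto_pow_atTop two_ne_zero).comp
      (tendsto_neg_atBot_atTop.comp (tendsto_expSum_atBot hneg n))).congr fun s => ?_
    rw [Function.comp_apply, Function.comp_apply, neg_sq]
  · exact (tendsto_pow_atTop two_ne_zero).comp (tendsto_expSum_atTop hpos n)

/-- The odd antiderivative of the Gaussian `exp(-β t²)`. -/
noncomputable def gaussPrim (β x : ℝ) : ℝ := ∫ t in (0 : ℝ)..x, Real.exp (-β * t ^ 2)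

lemma hasDerivAt_gaussPrim (β x : ℝ) :
    HasDerivAt (gaussPrim β) (Real.exp (-β * x ^ 2)) x := by
  have hc : Continuous fun t : ℝ => Real.exp (-β * t ^ 2) := by fun_prop
  exact hc.integral_hasStrictDerivAt 0 x |>.hasDerivAt

lemma gaussPrim_neg (β x : ℝ) : gaussPrim β (-x) = -gaussPrim β x := by
  have := intervalIntegral.integral_comp_neg (a := x) (b := 0)
    (fun t : ℝ => Real.exp (-β * t ^ 2))
  simp only [neg_zero, neg_sq] at this
  rw [gaussPrim, gaussPrim, ← this, intervalIntegral.integral_symm]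

lemma tendsto_gaussPrim_atTop {β : ℝ} (hβ : 0 < β) :
    Tendsto (gaussPrim β) atTop (𝓝 (√(Real.pi / β) / 2)) := by
  rw [← integral_gaussian_Ioi]
  exact intervalIntegral_tendsto_integral_Ioi 0 (integrable_exp_neg_mul_sq hβ).integrableOn
    tendsto_id

lemma tendsto_gaussPrim_atBot {β : ℝ} (hβ : 0 < β) :
    Tendsto (gaussPrim β) atBot (𝓝 (-(√(Real.pi / β) / 2))) := by
  refine ((tendsto_gaussPrim_atTop hβ).comp tendsto_neg_atBot_atTop).neg.congr fun x => ?_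
  rw [Function.comp_apply, gaussPrim_neg, neg_neg]

lemma tendsto_gaussPrim_expSum {β : ℝ} (hβ : 0 < β) {m : ℝ} (hm : m ≠ 0) (n : ℝ) :
    Tendsto (fun s => gaussPrim β (expSum m n s)) atTop (𝓝 (m.sign * (√(Real.pi / β) / 2))) := by
  rcases hm.lt_or_gt with hneg | hpos
  · rw [Real.sign_of_neg hneg, neg_one_mul]
    exact (tendsto_gaussPrim_atBot hβ).comp (tendsto_expSum_atBot hneg n)
  · rw [Real.sign_of_pos hpos, one_mul]
    exact (tendsto_gaussPrim_atTop hβ).comp (tendsto_expSum_atTop hpos n)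

lemma tendsto_exp_neg_expSum_sq {β : ℝ} (hβ : 0 < β) {m : ℝ} (hm : m ≠ 0) (n : ℝ) :
    Tendsto (fun s => Real.exp (-β * expSum m n s ^ 2)) atTop (𝓝 0) :=
  Real.tendsto_exp_atBot.comp
    ((tendsto_expSum_sq hm n).const_mul_atTop_of_neg (neg_neg_of_pos hβ))

-- `p² = p'² + 4mn` turns `p exp(-β p²) ds` into a multiple of the Gaussian `exp(-β p'²) dp'`.
lemma hasDerivAt_gaussPrim_expSum (β m n s : ℝ) :
    HasDerivAt (fun s => Real.exp (-β * (4 * (m * n))) * gaussPrim β (expSum m (-n) s))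
      (expSum m n s * Real.exp (-β * expSum m n s ^ 2)) s := by
  refine (((hasDerivAt_gaussPrim β _).comp s (hasDerivAt_expSum m (-n) s)).const_mul
    _).congr_deriv ?_
  rw [neg_neg, ← mul_assoc, ← Real.exp_add, mul_comm, expSum_sq m n]
  ring_nf

lemma hasDerivAt_exp_neg_expSum_sq {β : ℝ} (hβ : β ≠ 0) (m n s : ℝ) :
    HasDerivAt (fun s => -(1 / (2 * β)) * Real.exp (-β * expSum m n s ^ 2))
      (expSum m n s * expSum m (-n) s * Real.exp (-β * expSum m n s ^ 2)) s := by
  refine ((((hasDerivAt_expSum m n s).pow 2).const_mul (-β)).exp.const_mul _).congr_deriv ?_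
  simp only [Pi.pow_apply, Nat.cast_ofNat, Nat.add_one_sub_one, pow_one]
  field_simp

/-- The antiderivative of `(x p + y p p') exp(-β p²)`, where `p = m e^s + n e^{-s}`. -/
noncomputable def expSumPrim (β m n : ℝ) (x y : ℂ) (s : ℝ) : ℂ :=
  x * (Real.exp (-β * (4 * (m * n))) * gaussPrim β (expSum m (-n) s) : ℝ) +
    y * (-(1 / (2 * β)) * Real.exp (-β * expSum m n s ^ 2) : ℝ)

lemma hasDerivAt_expSumPrim {β : ℝ} (hβ : β ≠ 0) (m n : ℝ) (x y : ℂ) (s : ℝ) :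
    HasDerivAt (expSumPrim β m n x y) ((x * (expSum m n s : ℝ) +
      y * (expSum m n s : ℝ) * (expSum m (-n) s : ℝ)) *
        (Real.exp (-β * expSum m n s ^ 2) : ℝ)) s := by
  refine (((hasDerivAt_gaussPrim_expSum β m n s).ofReal_comp.const_mul x).add
    ((hasDerivAt_exp_neg_expSum_sq hβ m n s).ofReal_comp.const_mul y)).congr_deriv ?_
  push_cast
  ring

lemma expSumPrim_neg (β m n : ℝ) (x y : ℂ) (s : ℝ) :
    expSumPrim β m n x y (-s) = expSumPrim β n m (-x) y s := by
  rw [expSumPrim, expSumPrim, expSum_neg, expSum_neg, ← neg_neg (expSum (-n) m s), neg_expSum,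
    neg_neg, gaussPrim_neg, mul_comm n m]
  push_cast
  ring

lemma tendsto_expSumPrim_atTop {β : ℝ} (hβ : 0 < β) {m : ℝ} (hm : m ≠ 0) (n : ℝ) (x y : ℂ) :
    Tendsto (expSumPrim β m n x y) atTop
      (𝓝 (x * (Real.exp (-β * (4 * (m * n))) * (m.sign * (√(Real.pi / β) / 2)) : ℝ))) := by
  have hx := ((tendsto_gaussPrim_expSum hβ hm (-n)).const_mul
    (Real.exp (-β * (4 * (m * n))))).ofReal.const_mul x
  have hy := ((tendsto_exp_neg_expSum_sq hβ hm n).const_mul (-(1 / (2 * β)))).ofReal.const_mul y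
  unfold expSumPrim
  simpa only [mul_zero, Complex.ofReal_zero, add_zero] using hx.add hy

lemma tendsto_expSumPrim_atBot {β : ℝ} (hβ : 0 < β) (m : ℝ) {n : ℝ} (hn : n ≠ 0) (x y : ℂ) :
    Tendsto (expSumPrim β m n x y) atBot
      (𝓝 (-x * (Real.exp (-β * (4 * (n * m))) * (n.sign * (√(Real.pi / β) / 2)) : ℝ))) := by
  refine ((tendsto_expSumPrim_atTop hβ hn m (-x) y).comp tendsto_neg_atBot_atTop).congr
    fun s => ?_
  rw [Function.comp_apply, ← expSumPrim_neg, neg_neg]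

lemma integral_expSum_mul_exp_neg_sq {β : ℝ} (hβ : 0 < β) {m n : ℝ} (hm : m ≠ 0) (hn : n ≠ 0)
    {x y : ℂ}
    (hint : Integrable fun s => (x * (expSum m n s : ℝ) +
      y * (expSum m n s : ℝ) * (expSum m (-n) s : ℝ)) * (Real.exp (-β * expSum m n s ^ 2) : ℝ)) :
    ∫ s, (x * (expSum m n s : ℝ) + y * (expSum m n s : ℝ) * (expSum m (-n) s : ℝ)) *
        (Real.exp (-β * expSum m n s ^ 2) : ℝ) =
      x * (Real.exp (-β * (4 * (m * n))) * √(Real.pi / β) * ((m.sign + n.sign) / 2) : ℝ) := by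
  rw [integral_of_hasDerivAt_of_tendsto (hasDerivAt_expSumPrim hβ.ne' m n x y) hint
    (tendsto_expSumPrim_atBot hβ m hn x y) (tendsto_expSumPrim_atTop hβ hm n x y), mul_comm n m]
  push_cast
  ring

end GaussianIntegral

/-! ### The kernel of Hecke's theta series -/

/-- The inner product of `Y ∈ I'` with `X(z)` at the point of parameter `s` of the geodesic. -/
noncomputable def arcProd (a b c : ℝ) (Y : V) : ℝ → ℝ :=
  expSum (bil Y (vecY0 a b c) / (2 * √2 * radius a b c))
    (bil Y (vecY1 a b c) / (2 * √2 * radius a b c))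

/-- The derivative of `arcProd`. -/
noncomputable def arcProdDeriv (a b c : ℝ) (Y : V) : ℝ → ℝ :=
  expSum (bil Y (vecY0 a b c) / (2 * √2 * radius a b c))
    (-(bil Y (vecY1 a b c) / (2 * √2 * radius a b c)))

/-- The contribution of `Y ∈ I'` to the integrand of the cycle integral is of this form; `x` and
`y` are the coefficients of the even and of the odd part in the derivative of the Siegel theta
function along the geodesic. -/
noncomputable def kernel (a b c : ℝ) (τ : ℍ) (x y : ℂ) (Y : V) (s : ℝ) : ℂ :=
  e ((q Y : ℂ) * (starRingEnd ℂ) (τ : ℂ)) *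
    ((x * (arcProd a b c Y s : ℝ) + y * (arcProd a b c Y s : ℝ) * (arcProdDeriv a b c Y s : ℝ)) *
      (Real.exp (-(2 * Real.pi * τ.im) * arcProd a b c Y s ^ 2) : ℝ))

section Kernel

variable {a b c : ℝ} (τ : ℍ) (x y : ℂ) {Y : V}

lemma arcProd_eq (ha : 0 < a) (hD : 0 < b ^ 2 - 4 * a * c) (Y : V) (s : ℝ) :
    arcProd a b c Y s = bil Y (posVec (geodesicPath a b c s)) := by
  rw [bil_posVec_geodesicPath ha hD, arcProd, expSum]
  ring

lemma expSum_exp_mul (m n s t : ℝ) :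
    expSum (Real.exp (-t) * m) (Real.exp t * n) s = expSum m n (s - t) := by
  rw [expSum, expSum, neg_sub, sub_eq_add_neg, sub_eq_add_neg, Real.exp_add, Real.exp_add]
  ring

lemma arcProd_conj (ha : 0 < a) (hD : 0 < b ^ 2 - 4 * a * c) {g : SL(2, ℤ)}
    (hg : g ∈ stab (formMatrix a b c)) (Y : V) (s : ℝ) :
    arcProd a b c (conj g Y) s = arcProd a b c Y (s - shift a b c g) := by
  rw [arcProd, bil_conj_vecY0 ha hD hg, bil_conj_vecY1 ha hD hg, mul_div_assoc, mul_div_assoc,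
    expSum_exp_mul, arcProd]

lemma arcProdDeriv_conj (ha : 0 < a) (hD : 0 < b ^ 2 - 4 * a * c) {g : SL(2, ℤ)}
    (hg : g ∈ stab (formMatrix a b c)) (Y : V) (s : ℝ) :
    arcProdDeriv a b c (conj g Y) s = arcProdDeriv a b c Y (s - shift a b c g) := by
  rw [arcProdDeriv, bil_conj_vecY0 ha hD hg, bil_conj_vecY1 ha hD hg, mul_div_assoc,
    mul_div_assoc, ← mul_neg, expSum_exp_mul, arcProdDeriv]

lemma kernel_conj (ha : 0 < a) (hD : 0 < b ^ 2 - 4 * a * c) {g : SL(2, ℤ)}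
    (hg : g ∈ stab (formMatrix a b c)) (Y : V) (s : ℝ) :
    kernel a b c τ x y (conj g Y) s = kernel a b c τ x y Y (s - shift a b c g) := by
  rw [kernel, arcProd_conj ha hD hg, arcProdDeriv_conj ha hD hg, q_conj, kernel]

lemma continuous_kernel (Y : V) : Continuous (kernel a b c τ x y Y) := by
  have hp : Continuous (arcProd a b c Y) := continuous_expSum _ _
  have hp' : Continuous (arcProdDeriv a b c Y) := continuous_expSum _ _
  unfold kernel
  fun_prop

lemma q_eq_mul_of_perp (ha : 0 < a) (hD : 0 < b ^ 2 - 4 * a * c) (hY : Y 1 1 = -Y 0 0)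
    (hA : bil Y (formMatrix a b c) = 0) :
    q Y = 2 * (bil Y (vecY0 a b c) / (2 * √2 * radius a b c) *
      (bil Y (vecY1 a b c) / (2 * √2 * radius a b c))) := by
  have hsqrt : √2 ^ 2 = 2 := Real.sq_sqrt two_pos.le
  have hr := radius_pos ha hD
  rw [q_eq_combination ha hD hY, hA]
  field_simp
  rw [hsqrt]
  ring

lemma arcProd_sq (ha : 0 < a) (hD : 0 < b ^ 2 - 4 * a * c) (hY : Y 1 1 = -Y 0 0)
    (hA : bil Y (formMatrix a b c) = 0) (s : ℝ) :
    arcProd a b c Y s ^ 2 = arcProdDeriv a b c Y s ^ 2 + 2 * q Y := by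
  rw [arcProd, arcProdDeriv, expSum_sq, q_eq_mul_of_perp ha hD hY hA]
  ring

lemma norm_kernel (ha : 0 < a) (hD : 0 < b ^ 2 - 4 * a * c) (Y : V) (s : ℝ) :
    ‖kernel a b c τ x y Y s‖ =
      ‖x * (arcProd a b c Y s : ℝ) + y * (arcProd a b c Y s : ℝ) * (arcProdDeriv a b c Y s : ℝ)‖ *
        Real.exp (-(2 * (Real.pi * τ.im) * majorant (geodesicPath a b c s) Y)) := by
  rw [kernel, norm_mul, norm_mul, norm_e, Complex.norm_real,
    Real.norm_of_nonneg (Real.exp_pos _).le, mul_comm, mul_assoc, ← Real.exp_add, majorant,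
    ← arcProd_eq ha hD, Complex.im_ofReal_mul, Complex.conj_im, UpperHalfPlane.coe_im]
  ring_nf

lemma norm_add_mul_mul_le {p p' M : ℝ} (h : p ^ 2 + p' ^ 2 = 2 * M) (x y : ℂ) :
    ‖x * (p : ℂ) + y * p * p'‖ ≤ (‖x‖ + ‖y‖) * (1 + M) := by
  have hp : |p| ≤ 1 + M := abs_le.2 ⟨by nlinarith [sq_nonneg p'], by nlinarith [sq_nonneg p']⟩
  have hpp' : |p| * |p'| ≤ 1 + M := by
    rw [← sq_abs p, ← sq_abs p'] at h
    nlinarith [two_mul_le_add_sq |p| |p'|]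
  calc _ ≤ ‖x‖ * |p| + ‖y‖ * (|p| * |p'|) := by
        refine (norm_add_le _ _).trans_eq ?_
        rw [norm_mul, norm_mul, norm_mul, Complex.norm_real, Complex.norm_real, mul_assoc,
          Real.norm_eq_abs, Real.norm_eq_abs]
    _ ≤ _ := by rw [add_mul]; gcongr

lemma one_add_mul_exp_neg_two_mul_le {C t : ℝ} (hC : 0 < C) (ht : 0 ≤ t) :
    (1 + t) * Real.exp (-(2 * C * t)) ≤ (1 + 1 / C) * Real.exp (-(C * t)) := by
  have hlin : t * Real.exp (-(2 * C * t)) ≤ 1 / C * Real.exp (-(C * t)) := by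
    rw [one_div, ← div_eq_inv_mul, le_div_iff₀' hC, ← mul_assoc, mul_assoc 2]
    exact mul_exp_neg_two_mul_le (C * t)
  have hone : Real.exp (-(2 * C * t)) ≤ Real.exp (-(C * t)) := by
    gcongr
    linarith
  linarith

lemma norm_kernel_le (ha : 0 < a) (hD : 0 < b ^ 2 - 4 * a * c) (hY : Y 1 1 = -Y 0 0)
    (hA : bil Y (formMatrix a b c) = 0) (s : ℝ) :
    ‖kernel a b c τ x y Y s‖ ≤ (‖x‖ + ‖y‖) * ((1 + 1 / (Real.pi * τ.im)) *
      Real.exp (-(Real.pi * τ.im * majorant (geodesicPath a b c s) Y))) := by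
  have := τ.im_pos
  have hz := geodesicPath_im_pos ha hD s
  have hsq : arcProd a b c Y s ^ 2 + arcProdDeriv a b c Y s ^ 2 =
      2 * majorant (geodesicPath a b c s) Y := by
    rw [majorant, ← arcProd_eq ha hD]
    linarith [arcProd_sq ha hD hY hA s]
  calc _ ≤ (‖x‖ + ‖y‖) * (1 + majorant (geodesicPath a b c s) Y) *
        Real.exp (-(2 * (Real.pi * τ.im) * majorant (geodesicPath a b c s) Y)) := by
        rw [norm_kernel τ x y ha hD]
        gcongr
        exact norm_add_mul_mul_le hsq x y
    _ ≤ _ := by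
        rw [mul_assoc]
        exact mul_le_mul_of_nonneg_left
          (one_add_mul_exp_neg_two_mul_le (by positivity) (majorant_nonneg hY hz)) (by positivity)

lemma exists_distortion_geodesicPath_le (ha : 0 < a) (hD : 0 < b ^ 2 - 4 * a * c) (T : ℝ) :
    ∃ M : ℝ, ∀ s ∈ Set.Icc 0 T, distortion (geodesicPath a b c s) ≤ M := by
  have hc : ContinuousOn (fun s => distortion (geodesicPath a b c s)) (Set.Icc 0 T) :=
    fun s _ => ((continuousAt_distortion (geodesicPath_im_pos ha hD s)).comp
      continuous_geodesicPath.continuousAt).continuousWithinAt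
  obtain ⟨M, hM⟩ := (isCompact_Icc.image_of_continuousOn hc).bddAbove
  exact ⟨M, fun s hs => hM (Set.mem_image_of_mem _ hs)⟩

lemma e_mul_conj_mul_exp (r : ℝ) :
    e ((r : ℂ) * (starRingEnd ℂ) (τ : ℂ)) * (Real.exp (-(2 * Real.pi * τ.im) * (2 * r)) : ℝ) =
      e ((r : ℂ) * τ) := by
  rw [show -(2 * Real.pi * τ.im) * (2 * r) = -(2 * Real.pi * (2 * τ.im * r)) by ring, ← e_mul_I,
    ← e_add, starRingEnd_coe]
  push_cast
  ring_nf

lemma sign_mul_of_pos {t : ℝ} (ht : 0 < t) (r : ℝ) : (t * r).sign = r.sign := by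
  rcases lt_trichotomy r 0 with hr | rfl | hr
  · rw [Real.sign_of_neg hr, Real.sign_of_neg (mul_neg_of_pos_of_neg ht hr)]
  · rw [mul_zero]
  · rw [Real.sign_of_pos hr, Real.sign_of_pos (mul_pos ht hr)]

lemma integral_kernel (ha : 0 < a) (hD : 0 < b ^ 2 - 4 * a * c) (hY : Y 1 1 = -Y 0 0)
    (hA : bil Y (formMatrix a b c) = 0) (hq : q Y ≠ 0)
    (hint : Integrable (kernel a b c τ x y Y)) :
    ∫ s, kernel a b c τ x y Y s = x * (√(Real.pi / (2 * Real.pi * τ.im)) : ℝ) *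
      (e ((q Y : ℂ) * τ) *
        (((bil Y (vecY0 a b c)).sign + (bil Y (vecY1 a b c)).sign) / 2 : ℝ)) := by
  have hscale : 0 < 2 * √2 * radius a b c := by
    have := radius_pos ha hD
    positivity
  have hβ : 0 < 2 * Real.pi * τ.im := by
    have := τ.im_pos
    positivity
  have hq_eq := q_eq_mul_of_perp ha hD hY hA
  have he : e ((q Y : ℂ) * (starRingEnd ℂ) (τ : ℂ)) ≠ 0 := Complex.exp_ne_zero _
  have hint' := hint.const_mul (e ((q Y : ℂ) * (starRingEnd ℂ) (τ : ℂ)))⁻¹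
  simp only [kernel, inv_mul_cancel_left₀ he] at hint'
  simp only [kernel]
  rw [integral_const_mul]
  unfold arcProd arcProdDeriv at hint' ⊢
  rw [integral_expSum_mul_exp_neg_sq hβ (left_ne_zero_of_mul (right_ne_zero_of_mul (hq_eq ▸ hq)))
    (right_ne_zero_of_mul (right_ne_zero_of_mul (hq_eq ▸ hq))) hint', ← e_mul_conj_mul_exp,
    show ∀ t : ℝ, 4 * t = 2 * (2 * t) by intro t; ring, ← hq_eq, div_eq_inv_mul (bil Y _),
    div_eq_inv_mul (bil Y _), sign_mul_of_pos (inv_pos.2 hscale),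
    sign_mul_of_pos (inv_pos.2 hscale)]
  push_cast
  ring

end Kernel

/-! ### Summation over `I'` -/

lemma toDisc_eq_iff {M : AddSubgroup V} {X Y : dual M} :
    toDisc M X = toDisc M Y ↔ (X : V) - Y ∈ M := by
  rw [toDisc, toDisc, eq_comm, QuotientAddGroup.eq, AddSubgroup.mem_addSubgroupOf, neg_add_eq_sub]
  rfl

section DualLatticeI

variable {A : V} (hA : A ∈ dual latticeL) (hA0 : bil A A ≠ 0)

/-- The action of the stabilizer of `A` on `I'` by conjugation. -/
noncomputable def dualConj : stab A →* Equiv.Perm (dual (latticeI A)) :=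
  MonoidHom.toHomPerm
    { toFun g := fun Y => ⟨conj g Y, conj_mem_dual_latticeI hA hA0 g.2 Y.2⟩
      map_one' := funext fun Y => Subtype.ext (conj_one Y)
      map_mul' g h := funext fun Y => Subtype.ext (conj_mul g h Y) }

lemma coe_dualConj (g : stab A) (Y : dual (latticeI A)) : (dualConj hA hA0 g Y : V) = conj g Y :=
  rfl

lemma toDisc_dualConj (g : stab A) (Y : dual (latticeI A)) :
    toDisc (latticeI A) (dualConj hA hA0 g Y) = toDisc (latticeI A) Y :=
  toDisc_eq_iff.2 (conj_sub_self_mem_latticeI hA hA0 g.2 Y.2)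

lemma dualConj_class_iff (g : stab A) (δ : Disc (latticeI A)) (P : ℝ → Prop)
    (Y : dual (latticeI A)) :
    (toDisc (latticeI A) (dualConj hA hA0 g Y) = δ ∧ P (q (dualConj hA hA0 g Y))) ↔
      (toDisc (latticeI A) Y = δ ∧ P (q Y)) := by
  rw [toDisc_dualConj, coe_dualConj, q_conj]

end DualLatticeI

lemma summable_exp_neg_sqNorm_dual_latticeI {A : V} (hA : A ∈ dual latticeL) (hA0 : bil A A ≠ 0)
    (p : dual (latticeI A) → Prop) {C : ℝ} (hC : 0 < C) :
    Summable fun Y : {Y : dual (latticeI A) // p Y} => Real.exp (-C * sqNorm (Y.1 : V)) :=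
  summable_exp_neg_sqNorm (f := fun Y : {Y : dual (latticeI A) // p Y} => (Y.1 : V))
    (Subtype.val_injective.comp Subtype.val_injective) (mul_ne_zero four_ne_zero hA0)
    (fun Y => smul_mem_latticeL_of_mem_dual_latticeI hA hA0 Y.1.2) hC

section KernelSum

variable {a b c : ℤ} (τ : ℍ) (x y : ℂ)

lemma norm_kernel_le_of_distortion_le (ha : 0 < (a : ℝ)) (hD : 0 < (b : ℝ) ^ 2 - 4 * a * c)
    {Y : V} (hY : Y ∈ dual (latticeI (formMatrix a b c))) {s M : ℝ}
    (hM : distortion (geodesicPath a b c s) ≤ M) :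
    ‖kernel a b c τ x y Y s‖ ≤ (‖x‖ + ‖y‖) * ((1 + 1 / (Real.pi * τ.im)) *
      Real.exp (-(Real.pi * τ.im / M) * sqNorm Y)) := by
  have := τ.im_pos
  have htr := traceless_of_mem_dual (latticeI_le _) hY
  refine (norm_kernel_le τ x y ha hD htr (perp_of_mem_dual_latticeI hY) s).trans ?_
  gcongr ?_ * (?_ * ?_)
  exact exp_neg_mul_majorant_le htr (geodesicPath_im_pos ha hD s) (by positivity) hM

lemma exists_norm_kernel_le (ha : 0 < (a : ℝ)) (hD : 0 < (b : ℝ) ^ 2 - 4 * a * c)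
    (p : dual (latticeI (formMatrix a b c)) → Prop) (T : ℝ) :
    ∃ B : {Y // p Y} → ℝ, Summable B ∧
      ∀ Y, ∀ s ∈ Set.Icc 0 T, ‖kernel a b c τ x y Y.1 s‖ ≤ B Y := by
  obtain ⟨M, hM⟩ := exists_distortion_geodesicPath_le ha hD T
  have hpos : 0 < Real.pi * τ.im / max M 1 := by
    have := τ.im_pos
    positivity
  exact ⟨_, ((summable_exp_neg_sqNorm_dual_latticeI (formMatrix_mem_dual a b c)
    (bil_formMatrix_self_ne_zero hD) p hpos).mul_left _).mul_left _, fun Y s hs =>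
    norm_kernel_le_of_distortion_le τ x y ha hD Y.1.2 ((hM s hs).trans (le_max_left _ _))⟩

lemma summable_kernel (ha : 0 < (a : ℝ)) (hD : 0 < (b : ℝ) ^ 2 - 4 * a * c)
    (p : dual (latticeI (formMatrix a b c)) → Prop) (s : ℝ) :
    Summable fun Y : {Y // p Y} => ‖kernel a b c τ x y Y.1 s‖ := by
  have hpos : 0 < Real.pi * τ.im / distortion (geodesicPath a b c s) := by
    have := τ.im_pos
    have := distortion_pos (z := geodesicPath a b c s)
    positivity
  exact .of_nonneg_of_le (fun Y => norm_nonneg _)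
    (fun Y => norm_kernel_le_of_distortion_le τ x y ha hD Y.1.2 le_rfl)
    (((summable_exp_neg_sqNorm_dual_latticeI (formMatrix_mem_dual a b c)
      (bil_formMatrix_self_ne_zero hD) p hpos).mul_left _).mul_left _)

lemma summable_integral_norm_kernel (ha : 0 < (a : ℝ)) (hD : 0 < (b : ℝ) ^ 2 - 4 * a * c)
    (p : dual (latticeI (formMatrix a b c)) → Prop) (T : ℝ) :
    Summable fun Y : {Y // p Y} => ∫ s in Set.Ioc 0 T, ‖kernel a b c τ x y Y.1 s‖ := by
  obtain ⟨B, hB, hle⟩ := exists_norm_kernel_le τ x y ha hD p T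
  refine .of_norm_bounded (hB.mul_right (volume.real (Set.Ioc 0 T))) fun Y => ?_
  refine norm_setIntegral_le_of_norm_le_const measure_Ioc_lt_top fun s hs => ?_
  rw [norm_norm]
  exact hle Y s (Set.Ioc_subset_Icc_self hs)

lemma continuousOn_tsum_kernel (ha : 0 < (a : ℝ)) (hD : 0 < (b : ℝ) ^ 2 - 4 * a * c)
    (p : dual (latticeI (formMatrix a b c)) → Prop) (T : ℝ) :
    ContinuousOn (fun s => ∑' Y : {Y // p Y}, kernel a b c τ x y Y.1 s) (Set.Icc 0 T) := by
  obtain ⟨B, hB, hle⟩ := exists_norm_kernel_le τ x y ha hD p T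
  exact continuousOn_tsum (fun Y => (continuous_kernel τ x y _).continuousOn) hB hle

lemma hasSum_setIntegral_kernel (ha : 0 < (a : ℝ)) (hD : 0 < (b : ℝ) ^ 2 - 4 * a * c)
    (p : dual (latticeI (formMatrix a b c)) → Prop) (T : ℝ) :
    HasSum (fun Y : {Y // p Y} => ∫ s in Set.Ioc 0 T, kernel a b c τ x y Y.1 s)
      (∫ s in Set.Ioc 0 T, ∑' Y : {Y // p Y}, kernel a b c τ x y Y.1 s) := by
  have : Countable {Y // p Y} := by
    have := (summable_exp_neg_sqNorm_dual_latticeI (formMatrix_mem_dual a b c)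
      (bil_formMatrix_self_ne_zero hD) p one_pos).countable_support
    rwa [Function.support_eq_univ fun Y => (Real.exp_pos _).ne', Set.countable_univ_iff] at this
  exact hasSum_integral_of_summable_integral_norm
    (fun Y => (continuous_kernel τ x y _).integrableOn_Icc.mono_set Set.Ioc_subset_Icc_self)
    (summable_integral_norm_kernel τ x y ha hD p T)

lemma tsum_kernel_add_shift (ha : 0 < (a : ℝ)) (hD : 0 < (b : ℝ) ^ 2 - 4 * a * c)
    {g : SL(2, ℤ)} (hg : g ∈ stab (formMatrix a b c)) (δ : Disc (latticeI (formMatrix a b c)))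
    (s : ℝ) :
    ∑' Y : {Y : dual (latticeI (formMatrix a b c)) // toDisc _ Y = δ},
        kernel a b c τ x y Y.1 (s + shift a b c g) =
      ∑' Y : {Y : dual (latticeI (formMatrix a b c)) // toDisc _ Y = δ},
        kernel a b c τ x y Y.1 s := by
  let σ := (dualConj (formMatrix_mem_dual a b c) (bil_formMatrix_self_ne_zero hD)
    ⟨g, hg⟩).subtypePerm (p := fun Y => toDisc _ Y = δ) fun Y => by rw [toDisc_dualConj]
  rw [← σ.tsum_eq fun Y => kernel a b c τ x y Y.1 (s + shift a b c g)]
  refine tsum_congr fun Y => ?_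
  rw [Equiv.Perm.subtypePerm_apply, coe_dualConj, kernel_conj τ x y ha hD hg, add_sub_cancel_right]

end KernelSum

section HeckeSum

lemma eq_zero_of_mul_eq_sq_of_perp {a b c α β γ : ℤ} (ha : a ≠ 0)
    (hsq : ¬IsSquare (b ^ 2 - 4 * a * c)) (hperp : -(β * b) + a * γ + c * α = 0)
    (hiso : γ * α = β ^ 2) : α = 0 ∧ β = 0 ∧ γ = 0 := by
  have hdisc : (2 * a * β - b * α) ^ 2 = (b ^ 2 - 4 * a * c) * α ^ 2 := by
    linear_combination (4 * a * α) * hperp - 4 * a ^ 2 * hiso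
  have hα : α = 0 := by
    by_contra hα
    obtain ⟨d, hd⟩ := (Int.pow_dvd_pow_iff two_ne_zero).1 (Dvd.intro_left _ hdisc.symm)
    rw [hd, mul_pow, mul_comm] at hdisc
    exact hsq ⟨d, by rw [← mul_right_cancel₀ (pow_ne_zero 2 hα) hdisc, sq]⟩
  have hβ : β = 0 := by simpa [hα] using hiso.symm
  exact ⟨hα, hβ, by simpa [hα, hβ, ha] using hperp⟩

variable {a b c : ℤ}

lemma eq_zero_of_q_eq_zero (ha : 0 < (a : ℝ)) (hD : 0 < (b : ℝ) ^ 2 - 4 * a * c)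
    (hsq : ¬IsSquare (b ^ 2 - 4 * a * c)) {Y : V}
    (hY : Y ∈ dual (latticeI (formMatrix a b c))) (hq : q Y = 0) : Y = 0 := by
  have hA0 := bil_formMatrix_self_ne_zero hD
  obtain ⟨α, β, γ, h⟩ :=
    smul_mem_latticeL_of_mem_dual_latticeI (formMatrix_mem_dual a b c) hA0 hY
  set k : ℝ := 4 * bil (formMatrix a b c) (formMatrix a b c)
  have hiso : q (k • Y) = 0 := by rw [q_smul, hq, mul_zero]
  have hperp : bil (k • Y) (formMatrix a b c) = 0 := by
    rw [bil_smul_left, perp_of_mem_dual_latticeI hY, mul_zero]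
  rw [h, bil_formMatrix] at hperp
  rw [h, q_eq] at hiso
  simp only [Matrix.of_apply, Matrix.cons_val', Matrix.cons_val_zero, Matrix.cons_val_fin_one,
    Matrix.cons_val_one, neg_mul, mul_neg, sub_neg_eq_add] at hperp hiso
  obtain ⟨rfl, rfl, rfl⟩ := eq_zero_of_mul_eq_sq_of_perp (α := α) (β := β) (γ := γ)
    (by rintro rfl; simp at ha) hsq
    (by have : ((-(β * b) + a * γ + c * α : ℤ) : ℝ) = 0 := by push_cast; linarith
        exact_mod_cast this)
    (by have : ((γ * α : ℤ) : ℝ) = (β ^ 2 : ℤ) := by push_cast; linarith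
        exact_mod_cast this)
  refine (smul_eq_zero.1 (h.trans ?_)).resolve_left (mul_ne_zero four_ne_zero hA0)
  ext i j; fin_cases i <;> fin_cases j <;> simp

lemma bil_vecY0_mul_bil_vecY1 {a b c : ℝ} (ha : 0 < a) (hD : 0 < b ^ 2 - 4 * a * c) {Y : V}
    (htr : Y 1 1 = -Y 0 0) (hperp : bil Y (formMatrix a b c) = 0) :
    bil Y (vecY0 a b c) * bil Y (vecY1 a b c) = 4 * radius a b c ^ 2 * q Y := by
  have := radius_pos ha hD
  rw [q_eq_combination ha hD htr, hperp]
  field_simp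
  ring

lemma sign_eq_sign_of_mul_pos {m n : ℝ} (h : 0 < m * n) : m.sign = n.sign := by
  rcases pos_and_pos_or_neg_and_neg_of_mul_pos h with ⟨hm, hn⟩ | ⟨hm, hn⟩
  · rw [Real.sign_of_pos hm, Real.sign_of_pos hn]
  · rw [Real.sign_of_neg hm, Real.sign_of_neg hn]

lemma sign_add_sign_of_mul_neg {m n : ℝ} (h : m * n < 0) : m.sign + n.sign = 0 := by
  rcases mul_neg_iff.1 h with ⟨hm, hn⟩ | ⟨hm, hn⟩
  · rw [Real.sign_of_pos hm, Real.sign_of_neg hn, add_neg_cancel]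
  · rw [Real.sign_of_neg hm, Real.sign_of_pos hn, neg_add_cancel]

lemma bil_vecY0_ne_zero (ha : 0 < (a : ℝ)) (hD : 0 < (b : ℝ) ^ 2 - 4 * a * c) {Y : V}
    (hY : Y ∈ dual (latticeI (formMatrix a b c))) (hq : q Y ≠ 0) : bil Y (vecY0 a b c) ≠ 0 := by
  have := radius_pos ha hD
  refine left_ne_zero_of_mul (b := bil Y (vecY1 a b c)) ?_
  rw [bil_vecY0_mul_bil_vecY1 ha hD (traceless_of_mem_dual (latticeI_le _) hY)
    (perp_of_mem_dual_latticeI hY)]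
  positivity

variable {g₀ : SL(2, ℤ)}

/-- The permutation of `I'` by which a generator of `Γ_A` acts. -/
noncomputable abbrev IsGenerator.perm (hD : 0 < (b : ℝ) ^ 2 - 4 * a * c)
    (hg₀ : IsGenerator a b c g₀) : Equiv.Perm (dual (latticeI (formMatrix (a : ℝ) b c))) :=
  dualConj (formMatrix_mem_dual a b c) (bil_formMatrix_self_ne_zero hD) ⟨g₀, hg₀.mem⟩

lemma IsGenerator.perm_class_iff (hD : 0 < (b : ℝ) ^ 2 - 4 * a * c) (hg₀ : IsGenerator a b c g₀)
    (δ : Disc (latticeI (formMatrix (a : ℝ) b c))) (P : ℝ → Prop)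
    (Y : dual (latticeI (formMatrix (a : ℝ) b c))) :
    (toDisc _ (hg₀.perm hD Y) = δ ∧ P (q (hg₀.perm hD Y))) ↔ (toDisc _ Y = δ ∧ P (q Y)) :=
  dualConj_class_iff _ _ _ δ P Y

variable {p : dual (latticeI (formMatrix (a : ℝ) b c)) → Prop}

lemma IsGenerator.coe_subtypePerm_zpow (hD : 0 < (b : ℝ) ^ 2 - 4 * a * c)
    (hg₀ : IsGenerator a b c g₀) (hp : ∀ Y, p (hg₀.perm hD Y) ↔ p Y) (j : ℤ) (Y : {Y // p Y}) :
    ((((hg₀.perm hD).subtypePerm hp ^ j) Y).1 : V) = conj (g₀ ^ j) Y.1 := by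
  have hpow : hg₀.perm hD ^ j = dualConj (formMatrix_mem_dual a b c)
      (bil_formMatrix_self_ne_zero hD) (⟨g₀, hg₀.mem⟩ ^ j) := by
    rw [map_zpow]
  have happly : ((hg₀.perm hD ^ j) Y.1 : V) = conj (g₀ ^ j) Y.1 := by
    rw [hpow, coe_dualConj, Subgroup.coe_zpow]
  rwa [Equiv.Perm.subtypePerm_zpow, Equiv.Perm.subtypePerm_apply]

lemma eq_zero_of_zpow_perm_apply_eq (ha : 0 < (a : ℝ)) (hD : 0 < (b : ℝ) ^ 2 - 4 * a * c)
    (hg₀ : IsGenerator a b c g₀)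
    (hp : ∀ Y, p (hg₀.perm hD Y) ↔ p Y) {Y : {Y // p Y}} (hq : q Y.1 ≠ 0) {j : ℤ}
    (h : ((hg₀.perm hD).subtypePerm hp ^ j) Y = Y) : j = 0 := by
  have hconj : conj (g₀ ^ j) Y.1 = Y.1 := by
    rw [← hg₀.coe_subtypePerm_zpow hD hp j Y, h]
  have hshift := shift_eq_zero_of_conj_eq ha hD (zpow_mem hg₀.mem j)
    (bil_vecY0_ne_zero ha hD Y.1.2 hq) hconj
  rw [shift_zpow ha hD hg₀.mem] at hshift
  exact_mod_cast (mul_eq_zero.1 hshift).resolve_right hg₀.shift_pos.ne'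

lemma heckeSetoid_iff_sameCycle (ha : 0 < (a : ℝ)) (hD : 0 < (b : ℝ) ^ 2 - 4 * a * c)
    (hg₀ : IsGenerator a b c g₀) {δ : Disc (latticeI (formMatrix (a : ℝ) b c))}
    (Y Y' : HeckeIndex (formMatrix (a : ℝ) b c) δ) :
    heckeSetoid _ δ Y Y' ↔
      ((hg₀.perm hD).subtypePerm (hg₀.perm_class_iff hD δ (0 < ·))).SameCycle Y Y' := by
  constructor
  · rintro ⟨g, hg, h⟩
    obtain ⟨k, hk⟩ := hg₀.exists_conj_eq ha hD hg
    refine ⟨k, Subtype.ext (Subtype.ext ?_)⟩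
    exact (hg₀.coe_subtypePerm_zpow hD (hg₀.perm_class_iff hD δ (0 < ·)) k Y).trans
      ((hk Y.1).symm.trans h)
  · rintro ⟨j, rfl⟩
    exact ⟨g₀ ^ j, zpow_mem hg₀.mem j,
      (hg₀.coe_subtypePerm_zpow hD (hg₀.perm_class_iff hD δ (0 < ·)) j Y).symm⟩

variable (τ : ℍ) (x y : ℂ)

lemma hasSum_integral_kernel (ha : 0 < (a : ℝ)) (hD : 0 < (b : ℝ) ^ 2 - 4 * a * c)
    (hg₀ : IsGenerator a b c g₀)
    (hp : ∀ Y, p (hg₀.perm hD Y) ↔ p Y) (hq : ∀ Y, p Y → q Y ≠ 0) (r : Setoid {Y // p Y})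
    (hr : ∀ Y Y', r Y Y' ↔ ((hg₀.perm hD).subtypePerm hp).SameCycle Y Y') :
    HasSum (fun C : Quotient r => x * (√(Real.pi / (2 * Real.pi * τ.im)) : ℝ) *
      (e ((q (Quotient.out C).1 : ℂ) * τ) * (((bil (Quotient.out C).1 (vecY0 a b c)).sign +
        (bil (Quotient.out C).1 (vecY1 a b c)).sign) / 2 : ℝ)))
      (∑' Y : {Y // p Y}, ∫ s in Set.Ioc 0 (shift a b c g₀), kernel a b c τ x y Y.1 s) := by
  have hfree (Y : {Y // p Y}) (j : ℤ) := eq_zero_of_zpow_perm_apply_eq ha hD hg₀ hp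
    (hq Y.1 Y.2) (j := j)
  have hk (Y : {Y // p Y}) (j : ℤ) (s : ℝ) :
      kernel a b c τ x y (((hg₀.perm hD).subtypePerm hp ^ j) Y).1 s =
      kernel a b c τ x y Y.1 (s - j * shift a b c g₀) := by
    rw [hg₀.coe_subtypePerm_zpow, kernel_conj τ x y ha hD (zpow_mem hg₀.mem j),
      shift_zpow ha hD hg₀.mem]
  have hcont (Y : {Y // p Y}) := continuous_kernel (a := a) (b := b) (c := c) τ x y Y.1
  have hsum := summable_integral_norm_kernel τ x y ha hD p (shift a b c g₀)
  refine (hasSum_integral_unfold hr hfree hg₀.shift_pos hk hcont hsum).congr_fun fun C => ?_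
  exact (integral_kernel τ x y ha hD (traceless_of_mem_dual (latticeI_le _) C.out.1.2)
    (perp_of_mem_dual_latticeI C.out.1.2) (hq _ C.out.2)
    (integrable_of_summable_unfold hfree hg₀.shift_pos hk hcont hsum _)).symm

lemma hasSum_integral_kernel_pos (ha : 0 < (a : ℝ)) (hD : 0 < (b : ℝ) ^ 2 - 4 * a * c)
    (hg₀ : IsGenerator a b c g₀) (δ : Disc (latticeI (formMatrix (a : ℝ) b c))) :
    HasSum (fun C : Quotient (heckeSetoid (formMatrix (a : ℝ) b c) δ) =>
      x * (√(Real.pi / (2 * Real.pi * τ.im)) : ℝ) * heckeTerm a b c τ (Quotient.out C).1)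
      (∑' Y : HeckeIndex (formMatrix (a : ℝ) b c) δ,
          ∫ s in Set.Ioc 0 (shift a b c g₀), kernel a b c τ x y Y.1 s) := by
  refine (hasSum_integral_kernel τ x y ha hD hg₀ (hg₀.perm_class_iff hD δ (0 < ·))
    (fun Y hY => hY.2.ne') _
    (heckeSetoid_iff_sameCycle ha hD hg₀)).congr_fun fun C => ?_
  have hmem := C.out.1.2
  have hq := C.out.2.2
  generalize (C.out.1 : V) = Y at *
  have hmul : 0 < bil Y (vecY0 a b c) * bil Y (vecY1 a b c) := by
    have := radius_pos ha hD
    rw [bil_vecY0_mul_bil_vecY1 ha hD (traceless_of_mem_dual (latticeI_le _) hmem)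
      (perp_of_mem_dual_latticeI hmem)]
    positivity
  rw [heckeTerm, stabOrder_eq_one ha hD (bil_vecY0_ne_zero ha hD hmem hq.ne'),
    ← sign_eq_sign_of_mul_pos hmul]
  push_cast
  ring

lemma tsum_integral_kernel_neg (ha : 0 < (a : ℝ)) (hD : 0 < (b : ℝ) ^ 2 - 4 * a * c)
    (hg₀ : IsGenerator a b c g₀) (δ : Disc (latticeI (formMatrix (a : ℝ) b c))) :
    ∑' Y : {Y : dual (latticeI (formMatrix (a : ℝ) b c)) // toDisc _ Y = δ ∧ q Y < 0},
      ∫ s in Set.Ioc 0 (shift a b c g₀), kernel a b c τ x y Y.1 s = 0 := by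
  refine (hasSum_integral_kernel τ x y ha hD hg₀ (hg₀.perm_class_iff hD δ (· < 0))
    (fun Y hY => hY.2.ne)
    (Equiv.Perm.SameCycle.setoid _) fun _ _ => Iff.rfl).unique
    (hasSum_zero.congr_fun fun C => ?_)
  have hmem := C.out.1.2
  have hq := C.out.2.2
  generalize (C.out.1 : V) = Y at *
  have hmul : bil Y (vecY0 a b c) * bil Y (vecY1 a b c) < 0 := by
    have := radius_pos ha hD
    rw [bil_vecY0_mul_bil_vecY1 ha hD (traceless_of_mem_dual (latticeI_le _) hmem)
      (perp_of_mem_dual_latticeI hmem)]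
    exact mul_neg_of_pos_of_neg (by positivity) hq
  simp [sign_add_sign_of_mul_neg hmul]

lemma tsum_eq_tsum_pos_add_tsum_neg {ι : Type*} {p : ι → Prop} {f : ι → ℂ} {φ : ι → ℝ}
    (hf : Summable fun i : {i // p i} => f i) (h0 : ∀ i, p i → φ i = 0 → f i = 0) :
    ∑' i : {i // p i}, f i =
      ∑' i : {i // p i ∧ 0 < φ i}, f i + ∑' i : {i // p i ∧ φ i < 0}, f i := by
  have hasSum_part (P : ℝ → Prop) :
      HasSum ((fun i : {i // p i} => f i) ∘ ((↑) : {i : {i // p i} | P (φ i)} → _))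
        (∑' i : {i // p i ∧ P (φ i)}, f i) := by
    rw [← (Equiv.subtypeSubtypeEquivSubtypeInter p fun i => P (φ i)).tsum_eq
      fun i : {i // p i ∧ P (φ i)} => f i]
    exact (hf.subtype {i : {i // p i} | P (φ i)}).hasSum
  have hdisj : Disjoint {i : {i // p i} | 0 < φ i} {i : {i // p i} | φ i < 0} :=
    Set.disjoint_left.2 fun i (hi : 0 < φ i) (hi' : φ i < 0) => lt_asymm hi hi'
  refine HasSum.tsum_eq ((hasSum_subtype_iff_of_support_subset fun i hi => ?_).1
    ((hasSum_part (0 < ·)).add_disjoint hdisj (hasSum_part (· < 0))))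
  rcases lt_trichotomy (φ i) 0 with h | h | h
  · exact Or.inr h
  · exact absurd (h0 i i.2 h) hi
  · exact Or.inl h

lemma integral_tsum_kernel (ha : 0 < (a : ℝ)) (hD : 0 < (b : ℝ) ^ 2 - 4 * a * c)
    (hsq : ¬IsSquare (b ^ 2 - 4 * a * c)) (hg₀ : IsGenerator a b c g₀)
    (δ : Disc (latticeI (formMatrix (a : ℝ) b c))) :
    ∫ s in Set.Ioc 0 (shift a b c g₀),
        ∑' Y : {Y : dual (latticeI (formMatrix (a : ℝ) b c)) // toDisc _ Y = δ},
          kernel a b c τ x y Y.1 s =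
      x * (√(Real.pi / (2 * Real.pi * τ.im)) : ℝ) * heckeTheta a b c τ δ := by
  have hsum := hasSum_setIntegral_kernel τ x y ha hD (fun Y => toDisc _ Y = δ) (shift a b c g₀)
  rw [← hsum.tsum_eq, tsum_eq_tsum_pos_add_tsum_neg (φ := fun Y : dual _ => q Y)
      (f := fun Y : dual _ => ∫ s in Set.Ioc 0 (shift a b c g₀), kernel a b c τ x y Y s)
      hsum.summable,
    tsum_integral_kernel_neg τ x y ha hD hg₀ δ, add_zero,
    ← (hasSum_integral_kernel_pos τ x y ha hD hg₀ δ).tsum_eq, tsum_mul_left, heckeTheta]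
  intro Y _ hq
  simp [eq_zero_of_q_eq_zero ha hD hsq Y.2 hq, kernel, arcProd, expSum, bil_zero_left]

lemma summable_heckeTerm (ha : 0 < (a : ℝ)) (hD : 0 < (b : ℝ) ^ 2 - 4 * a * c)
    (hg₀ : IsGenerator a b c g₀) (δ : Disc (latticeI (formMatrix (a : ℝ) b c))) :
    Summable fun C : Quotient (heckeSetoid (formMatrix (a : ℝ) b c) δ) =>
      heckeTerm a b c τ (Quotient.out C).1 := by
  have hne : (1 : ℂ) * (√(Real.pi / (2 * Real.pi * τ.im)) : ℝ) ≠ 0 := by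
    have := τ.im_pos
    rw [one_mul, Complex.ofReal_ne_zero]
    positivity
  exact (summable_mul_left_iff hne).1 (hasSum_integral_kernel_pos τ 1 0 ha hD hg₀ δ).summable

end HeckeSum

/-! ### Decomposition along `I ⊕ N` -/

lemma coeff_of_mem {M : AddSubgroup V} (g : GroupRing M) {X : V} (hX : X ∈ dual M) :
    coeff g X = g (toDisc M ⟨X, hX⟩) := by rw [coeff, dif_pos hX]

section CosetDecomposition

variable {A : V}

lemma projPerp_mem_and_projLine_mem_of_mem_sup (hA0 : bil A A ≠ 0) {Z : V}
    (hZ : Z ∈ latticeI A ⊔ latticeN A) : projPerp A Z ∈ latticeI A ∧ projLine A Z ∈ latticeN A := by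
  obtain ⟨X, hX, _, ⟨hWL, r, rfl⟩, rfl⟩ := AddSubgroup.mem_sup.1 hZ
  rw [projPerp_add, projLine_add, projPerp_of_perp hX.2, projLine_of_perp hX.2,
    projPerp_smul_self hA0, projLine_smul_self hA0, add_zero, zero_add]
  exact ⟨hX, hWL, r, rfl⟩

lemma projPerp_eq_and_projLine_eq_of_add (hA0 : bil A A ≠ 0) {Y W : V}
    (hY : Y ∈ dual (latticeI A)) (hW : W ∈ dual (latticeN A)) :
    projPerp A (Y + W) = Y ∧ projLine A (Y + W) = W := by
  have hperp := perp_of_mem_dual_latticeI hY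
  obtain ⟨r, rfl⟩ := exists_smul_of_mem_dual_latticeN hW
  rw [projPerp_add, projLine_add, projPerp_of_perp hperp, projLine_of_perp hperp,
    projPerp_smul_self hA0, projLine_smul_self hA0, add_zero, zero_add]
  exact ⟨rfl, rfl⟩

/-- A representative of the class of `β + γ` for `β ∈ L/M` and `γ ∈ L'/L`. -/
noncomputable def cosetRep {M : AddSubgroup V} (γ : Disc latticeL)
    (β : latticeL ⧸ M.addSubgroupOf latticeL) : V :=
  (Quotient.out β : latticeL) + (Quotient.out γ : dual latticeL)

lemma cosetRep_mem {M : AddSubgroup V} (γ : Disc latticeL)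
    (β : latticeL ⧸ M.addSubgroupOf latticeL) : cosetRep γ β ∈ dual latticeL :=
  add_mem (latticeL_le_dual (Quotient.out β).2) (Quotient.out γ).2

/-- The quotient `L/(I ⊕ N)`. -/
abbrev SupQuotient (A : V) : Type :=
  latticeL ⧸ (latticeI A ⊔ latticeN A).addSubgroupOf latticeL

variable (hA : A ∈ dual latticeL) (hA0 : bil A A ≠ 0)

/-- The class in `I'/I` of the projection to `I'` of a representative of `β + γ`. -/
noncomputable def classI (γ : Disc latticeL) (β : SupQuotient A) : Disc (latticeI A) :=
  toDisc _ ⟨projPerp A (cosetRep γ β), projPerp_mem_dual hA hA0 (cosetRep_mem γ β)⟩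

/-- The class in `N'/N` of the projection to `N'` of a representative of `β + γ`. -/
noncomputable def classN (γ : Disc latticeL) (β : SupQuotient A) : Disc (latticeN A) :=
  toDisc _ ⟨projLine A (cosetRep γ β), projLine_mem_dual hA hA0 (cosetRep_mem γ β)⟩

variable {hA hA0}

lemma add_sub_cosetRep_mem {γ : Disc latticeL} {β : SupQuotient A} {Y : dual (latticeI A)}
    {W : dual (latticeN A)} (hY : toDisc _ Y = classI hA hA0 γ β)
    (hW : toDisc _ W = classN hA hA0 γ β) :
    (Y : V) + W - cosetRep γ β ∈ latticeI A ⊔ latticeN A := by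
  have h : (Y : V) - projPerp A (cosetRep γ β) + (W - projLine A (cosetRep γ β)) ∈
      latticeI A ⊔ latticeN A :=
    AddSubgroup.add_mem_sup (toDisc_eq_iff.1 hY) (toDisc_eq_iff.1 hW)
  rwa [sub_add_sub_comm, projPerp_add_projLine] at h

lemma add_sub_out_mem_latticeL {γ : Disc latticeL} {β : SupQuotient A} {Y : dual (latticeI A)}
    {W : dual (latticeN A)} (hY : toDisc _ Y = classI hA hA0 γ β)
    (hW : toDisc _ W = classN hA hA0 γ β) :
    (Y : V) + W - (Quotient.out γ : dual latticeL) ∈ latticeL := by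
  have hadd := add_mem (sup_le (latticeI_le _) (latticeN_le _) (add_sub_cosetRep_mem hY hW))
    (Quotient.out β : latticeL).2
  rwa [cosetRep, add_comm (Quotient.out β : latticeL).1, ← sub_sub, sub_add_cancel] at hadd

variable (hA hA0)

/-- The map `(Y, W) ↦ Y + W` from the pairs of vectors of `I'` and `N'` whose classes belong to a
common `β ∈ L/(I ⊕ N)` to the class `γ ∈ L'/L`. -/
noncomputable def cosetMap (γ : Disc latticeL) :
    (Σ β : SupQuotient A, {Y : dual (latticeI A) // toDisc _ Y = classI hA hA0 γ β} ×
      {W : dual (latticeN A) // toDisc _ W = classN hA hA0 γ β}) →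
    {X : dual latticeL // toDisc latticeL X = γ} := fun x =>
  have h := add_sub_out_mem_latticeL x.2.1.2 x.2.2.2
  ⟨⟨x.2.1.1 + x.2.2.1, by
      simpa only [sub_add_cancel] using add_mem (latticeL_le_dual h) (Quotient.out γ).2⟩,
    (toDisc_eq_iff.2 h).trans (Quotient.out_eq γ)⟩

lemma injective_cosetMap (γ : Disc latticeL) : Function.Injective (cosetMap hA hA0 γ) := by
  rintro ⟨β, ⟨Y, hY⟩, ⟨W, hW⟩⟩ ⟨β', ⟨Y', hY'⟩, ⟨W', hW'⟩⟩ h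
  have hadd : (Y : V) + W = Y' + W' := congrArg (fun x => (x.1 : V)) h
  obtain ⟨hperp, hline⟩ := projPerp_eq_and_projLine_eq_of_add hA0 Y.2 W.2
  obtain ⟨hperp', hline'⟩ := projPerp_eq_and_projLine_eq_of_add hA0 Y'.2 W'.2
  rw [hadd] at hperp hline
  obtain rfl : Y = Y' := Subtype.ext (hperp.symm.trans hperp')
  obtain rfl : W = W' := Subtype.ext (hline.symm.trans hline')
  obtain rfl : β = β' := by
    rw [← Quotient.out_eq β, ← Quotient.out_eq β']
    refine QuotientAddGroup.eq.2 ?_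
    rw [AddSubgroup.mem_addSubgroupOf]
    convert sub_mem (add_sub_cosetRep_mem hY hW) (add_sub_cosetRep_mem hY' hW') using 1
    rw [cosetRep, cosetRep]
    push_cast
    abel
  rfl

lemma surjective_cosetMap (γ : Disc latticeL) : Function.Surjective (cosetMap hA hA0 γ) := by
  rintro ⟨X, hX⟩
  have hXL : (X : V) - (Quotient.out γ : dual latticeL) ∈ latticeL :=
    toDisc_eq_iff.1 (hX.trans (Quotient.out_eq γ).symm)
  let β : SupQuotient A := QuotientAddGroup.mk ⟨_, hXL⟩
  have hβ : (X : V) - cosetRep γ β ∈ latticeI A ⊔ latticeN A := by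
    have hout := QuotientAddGroup.eq.1 (show QuotientAddGroup.mk (Quotient.out β) = β from
      Quotient.out_eq β)
    rw [AddSubgroup.mem_addSubgroupOf] at hout
    convert hout using 1
    rw [cosetRep]
    push_cast
    abel
  obtain ⟨hperp, hline⟩ := projPerp_mem_and_projLine_mem_of_mem_sup hA0 hβ
  rw [projPerp_sub] at hperp
  rw [projLine_sub] at hline
  exact ⟨⟨β, ⟨⟨_, projPerp_mem_dual hA hA0 X.2⟩, toDisc_eq_iff.2 hperp⟩,
    ⟨⟨_, projLine_mem_dual hA hA0 X.2⟩, toDisc_eq_iff.2 hline⟩⟩,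
    Subtype.ext (Subtype.ext (projPerp_add_projLine _ _))⟩

lemma coeff_tensor_cosetRep (f : GroupRing (latticeI A)) (h : GroupRing (latticeN A))
    (γ : Disc latticeL) (β : SupQuotient A) :
    coeff (tensor A f h) (cosetRep γ β) = f (classI hA hA0 γ β) * h (classN hA hA0 γ β) := by
  have hmem := cosetRep_mem γ β
  have hmem' := dual_latticeL_le_dual_sup hA hA0 hmem
  rw [coeff_of_mem _ hmem', tensor]
  set Z := Quotient.out (toDisc (latticeI A ⊔ latticeN A) ⟨cosetRep γ β, hmem'⟩)
  have hsub : (Z : V) - cosetRep γ β ∈ latticeI A ⊔ latticeN A :=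
    toDisc_eq_iff.1 (Quotient.out_eq _)
  have hZL : (Z : V) ∈ dual latticeL := by
    simpa only [sub_add_cancel] using
      add_mem (latticeL_le_dual (sup_le (latticeI_le _) (latticeN_le _) hsub)) hmem
  obtain ⟨hperp, hline⟩ := projPerp_mem_and_projLine_mem_of_mem_sup hA0 hsub
  rw [projPerp_sub] at hperp
  rw [projLine_sub] at hline
  rw [coeff_of_mem f (projPerp_mem_dual hA hA0 hZL), coeff_of_mem h (projLine_mem_dual hA hA0 hZL)]
  exact congrArg₂ (f · * h ·) (toDisc_eq_iff.2 hperp) (toDisc_eq_iff.2 hline)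

end CosetDecomposition

/-! ### The integrand along the geodesic -/

section GeodesicDerivative

variable {a b c : ℝ} {X : V}

lemma bil_formMatrix_vecY0 (ha : 0 < a) (hD : 0 < b ^ 2 - 4 * a * c) :
    bil (formMatrix a b c) (vecY0 a b c) = 0 := by
  rw [formMatrix_eq ha hD, bil_smul_left, bil_eq, vecY0, endpoint_eq, mul_eq_zero]
  right
  simp
  ring

lemma bil_formMatrix_vecY1 (ha : 0 < a) (hD : 0 < b ^ 2 - 4 * a * c) :
    bil (formMatrix a b c) (vecY1 a b c) = 0 := by
  rw [formMatrix_eq ha hD, bil_smul_left, bil_eq, vecY1, isotropic, endpoint'_eq, mul_eq_zero]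
  right
  simp
  ring

lemma arcProd_add_smul (ha : 0 < a) (hD : 0 < b ^ 2 - 4 * a * c) (Y : V) (r s : ℝ) :
    arcProd a b c (Y + r • formMatrix a b c) s = arcProd a b c Y s := by
  rw [arcProd, arcProd, bil_add_left, bil_add_left, bil_smul_left, bil_smul_left,
    bil_formMatrix_vecY0 ha hD, bil_formMatrix_vecY1 ha hD, mul_zero, add_zero, add_zero]

lemma arcProdDeriv_add_smul (ha : 0 < a) (hD : 0 < b ^ 2 - 4 * a * c) (Y : V) (r s : ℝ) :
    arcProdDeriv a b c (Y + r • formMatrix a b c) s = arcProdDeriv a b c Y s := by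
  rw [arcProdDeriv, arcProdDeriv, bil_add_left, bil_add_left, bil_smul_left, bil_smul_left,
    bil_formMatrix_vecY0 ha hD, bil_formMatrix_vecY1 ha hD, mul_zero, add_zero, add_zero]

lemma bil_smul_formMatrix_posVec_geodesicPath (ha : 0 < a) (hD : 0 < b ^ 2 - 4 * a * c)
    (r s : ℝ) : bil (r • formMatrix a b c) (posVec (geodesicPath a b c s)) = 0 := by
  rw [bil_posVec_geodesicPath ha hD, bil_smul_left, bil_smul_left, bil_formMatrix_vecY0 ha hD,
    bil_formMatrix_vecY1 ha hD]
  ring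

lemma fderiv_bil_posVec_tangent (ha : 0 < a) (hD : 0 < b ^ 2 - 4 * a * c) (hX : X 1 1 = -X 0 0)
    (s : ℝ) :
    posDerivX X (geodesicPath a b c s) * (-radius a b c / Real.cosh s ^ 2) +
        posDerivY X (geodesicPath a b c s) * (-radius a b c * Real.sinh s / Real.cosh s ^ 2) =
      arcProdDeriv a b c X s := by
  have hcomp := (hasFDerivAt_bil_posVec hX (geodesicPath_im_pos ha hD s)).comp_hasDerivAt s
    (hasDerivAt_geodesicPath s)
  have hexp : HasDerivAt (fun s => bil X (posVec (geodesicPath a b c s)))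
      (arcProdDeriv a b c X s) s := by
    simp only [← arcProd_eq ha hD]
    exact hasDerivAt_expSum _ _ s
  simpa only [add_apply, smul_apply, Complex.reCLM_apply,
    Complex.imCLM_apply, Complex.add_re, Complex.add_im, Complex.ofReal_re, Complex.ofReal_im,
    Complex.re_ofReal_mul, Complex.im_ofReal_mul, Complex.I_re, Complex.I_im, smul_eq_mul,
    mul_zero, mul_one, add_zero, zero_add] using hcomp.unique hexp

lemma fderiv_bil_posVec_normal (ha : 0 < a) (hD : 0 < b ^ 2 - 4 * a * c) (hX : X 1 1 = -X 0 0)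
    (s : ℝ) :
    posDerivX X (geodesicPath a b c s) * (-radius a b c * Real.sinh s / Real.cosh s ^ 2) -
        posDerivY X (geodesicPath a b c s) * (-radius a b c / Real.cosh s ^ 2) =
      -(√2 * bil X (formMatrix a b c) / √(b ^ 2 - 4 * a * c)) := by
  have hr := radius_pos ha hD
  have hsqrt : √2 ^ 2 = 2 := Real.sq_sqrt two_pos.le
  have hdisc : √(b ^ 2 - 4 * a * c) = 2 * a * radius a b c := by unfold radius; field_simp
  rw [hdisc, posDerivX, posDerivY, bil_posVec hX, geodesicPath_re, geodesicPath_im,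
    Real.tanh_eq_sinh_div_cosh, formMatrix_eq ha hD, bil_eq, hX]
  simp
  field_simp
  rw [hsqrt]
  linear_combination (2 * X 1 0 * radius a b c ^ 2) * Real.cosh_sq s

lemma wirtinger_posDeriv_mul_deriv_geodesicPath (ha : 0 < a) (hD : 0 < b ^ 2 - 4 * a * c)
    (hX : X 1 1 = -X 0 0) (s : ℝ) :
    ((posDerivX X (geodesicPath a b c s) : ℂ) -
      Complex.I * posDerivY X (geodesicPath a b c s)) * deriv (geodesicPath a b c) s =
      arcProdDeriv a b c X s -
        Complex.I * (√2 * bil X (formMatrix a b c) / √(b ^ 2 - 4 * a * c) : ℝ) := by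
  rw [(hasDerivAt_geodesicPath s).deriv, ← fderiv_bil_posVec_tangent ha hD hX s,
    ← neg_eq_iff_eq_neg.2 (fderiv_bil_posVec_normal ha hD hX s)]
  push_cast
  linear_combination (-((posDerivY X (geodesicPath a b c s) : ℂ)) *
    (-radius a b c * Complex.sinh s / Complex.cosh s ^ 2)) * Complex.I_sq

end GeodesicDerivative

/-! ### The unary theta series -/

section Unary

variable {a b c : ℤ} (τ : ℍ)

lemma norm_e_mul_conj (r : ℝ) : ‖e ((r : ℂ) * (starRingEnd ℂ) (τ : ℂ))‖ =
    Real.exp (2 * Real.pi * τ.im * r) := by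
  rw [norm_e, Complex.im_ofReal_mul, Complex.conj_im]
  congr 1
  change -(2 * Real.pi * (r * -τ.im)) = _
  ring

lemma conj_e_neg (r : ℝ) : (starRingEnd ℂ) (e (-(r : ℂ) * τ)) =
    e ((r : ℂ) * (starRingEnd ℂ) (τ : ℂ)) := by
  rw [e, e, ← Complex.exp_conj]
  congr 1
  simp only [map_mul, map_neg, Complex.conj_ofReal, Complex.conj_I, map_ofNat]
  ring

lemma sq_bil_of_mem_dual_latticeN {A W : V} (hW : W ∈ dual (latticeN A)) :
    bil W A ^ 2 = 2 * bil A A * q W := by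
  obtain ⟨r, rfl⟩ := exists_smul_of_mem_dual_latticeN hW
  rw [bil_smul_left, q_smul, bil_self]
  ring

lemma q_nonpos_of_mem_dual_latticeN (hD : 0 < (b : ℝ) ^ 2 - 4 * a * c) {W : V}
    (hW : W ∈ dual (latticeN (formMatrix a b c))) : q W ≤ 0 := by
  have hsq := sq_bil_of_mem_dual_latticeN hW
  rw [bil_formMatrix_self] at hsq
  nlinarith [sq_nonneg (bil W (formMatrix a b c))]

-- On the geodesic `X(z)` is orthogonal to `A`, so there `-q` is the majorant on `N'`.
lemma summable_exp_mul_q_dual_latticeN (ha : 0 < (a : ℝ)) (hD : 0 < (b : ℝ) ^ 2 - 4 * a * c)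
    (p : dual (latticeN (formMatrix a b c)) → Prop) {C : ℝ} (hC : 0 < C) :
    Summable fun W : {W // p W} => Real.exp (C * q W.1) := by
  refine .of_nonneg_of_le (fun W => (Real.exp_pos _).le) (fun W => ?_)
    (summable_exp_neg_sqNorm (Subtype.val_injective.comp Subtype.val_injective)
      (mul_ne_zero four_ne_zero (bil_formMatrix_self_ne_zero hD))
      (fun W : {W // p W} => smul_mem_latticeL_of_mem_dual_latticeN
        (formMatrix_mem_dual a b c) W.1.2)
      (div_pos hC (distortion_pos (z := geodesicPath a b c 0))))
  obtain ⟨r, hr⟩ := exists_smul_of_mem_dual_latticeN W.1.2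
  have hmaj : majorant (geodesicPath a b c 0) W.1 = -q W.1 := by
    rw [majorant, hr, bil_smul_formMatrix_posVec_geodesicPath ha hD]
    ring
  have hle := exp_neg_mul_majorant_le (traceless_of_mem_dual (latticeN_le _) W.1.2)
    (geodesicPath_im_pos ha hD 0) hC.le le_rfl
  rwa [hmaj, mul_neg, neg_neg] at hle

lemma summable_norm_e_dual_latticeN (ha : 0 < (a : ℝ)) (hD : 0 < (b : ℝ) ^ 2 - 4 * a * c)
    (p : dual (latticeN (formMatrix a b c)) → Prop) :
    Summable fun W : {W // p W} => ‖e ((q W.1 : ℂ) * (starRingEnd ℂ) (τ : ℂ))‖ := by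
  have := τ.im_pos
  simp only [norm_e_mul_conj]
  exact summable_exp_mul_q_dual_latticeN ha hD p (by positivity)

lemma summable_norm_bil_mul_e_dual_latticeN (ha : 0 < (a : ℝ))
    (hD : 0 < (b : ℝ) ^ 2 - 4 * a * c) (p : dual (latticeN (formMatrix a b c)) → Prop) :
    Summable fun W : {W // p W} =>
      ‖(bil W.1 (formMatrix a b c) : ℂ) * e ((q W.1 : ℂ) * (starRingEnd ℂ) (τ : ℂ))‖ := by
  have hτ : 0 < Real.pi * τ.im := mul_pos Real.pi_pos τ.im_pos
  set D : ℝ := (b : ℝ) ^ 2 - 4 * a * c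
  refine .of_nonneg_of_le (fun W => norm_nonneg _) (fun W => ?_)
    ((summable_exp_mul_q_dual_latticeN ha hD p hτ).mul_left (1 + D / (Real.pi * τ.im)))
  have hq := q_nonpos_of_mem_dual_latticeN hD W.1.2
  have hbil : |bil W.1 (formMatrix a b c)| ≤ 1 + D * -q W.1 := by
    have hsq := sq_bil_of_mem_dual_latticeN W.1.2
    rw [bil_formMatrix_self, ← sq_abs] at hsq
    nlinarith [sq_nonneg (|bil W.1 (formMatrix a b c)| - 1)]
  have hexp : Real.exp (2 * Real.pi * τ.im * q W.1) ≤ Real.exp (Real.pi * τ.im * q W.1) :=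
    Real.exp_le_exp.2 (by nlinarith)
  have hmul := mul_exp_neg_two_mul_le (Real.pi * τ.im * -q W.1)
  rw [norm_mul, Complex.norm_real, Real.norm_eq_abs, norm_e_mul_conj]
  calc |bil W.1 (formMatrix a b c)| * Real.exp (2 * Real.pi * τ.im * q W.1)
      ≤ (1 + D * -q W.1) * Real.exp (2 * Real.pi * τ.im * q W.1) := by gcongr
    _ = Real.exp (2 * Real.pi * τ.im * q W.1) + D / (Real.pi * τ.im) *
          (Real.pi * τ.im * -q W.1 * Real.exp (-(2 * (Real.pi * τ.im * -q W.1)))) := by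
        field_simp
    _ ≤ Real.exp (Real.pi * τ.im * q W.1) + D / (Real.pi * τ.im) *
          Real.exp (-(Real.pi * τ.im * -q W.1)) := by gcongr
    _ = _ := by ring_nf

lemma summable_unaryTerm (ha : 0 < (a : ℝ)) (hD : 0 < (b : ℝ) ^ 2 - 4 * a * c)
    (δ : Disc (latticeN (formMatrix a b c))) :
    Summable fun W : {W : dual (latticeN (formMatrix a b c)) //
      toDisc (latticeN (formMatrix a b c)) W = δ} => unaryTerm (formMatrix a b c) τ W.1 := by
  refine ((summable_norm_bil_mul_e_dual_latticeN τ ha hD fun W => toDisc _ W = δ).congr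
    fun W => ?_).of_norm
  rw [unaryTerm, norm_mul, norm_mul, ← conj_e_neg, RCLike.norm_conj]

lemma tsum_bil_mul_e (A : V) (δ : Disc (latticeN A)) :
    ∑' W : {W : dual (latticeN A) // toDisc (latticeN A) W = δ},
        (bil W.1 A : ℂ) * e ((q W.1 : ℂ) * (starRingEnd ℂ) (τ : ℂ)) =
      (starRingEnd ℂ) (unaryTheta A τ δ) := by
  rw [unaryTheta, Complex.conj_tsum]
  refine tsum_congr fun W => ?_
  rw [unaryTerm, map_mul, Complex.conj_ofReal, conj_e_neg]

end Unary

/-! ### Unfolding the cycle integral -/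

section Splitting

variable {a b c : ℝ} (τ : ℍ)

/-- The factor of `(W, A) e(q(W) \bar τ)` in the integrand of the cycle integral. -/
noncomputable def unaryFactor (a b c : ℝ) (τ : ℍ) : ℂ :=
  (-(4 * Real.pi * τ.im ^ 2 * √2 / √(b ^ 2 - 4 * a * c)) : ℝ)

lemma kernel_eq_linear (x y : ℂ) (Y : V) (s : ℝ) : kernel a b c τ x y Y s =
    kernel a b c τ 1 0 Y s * x + kernel a b c τ 0 1 Y s * y := by
  simp only [kernel]; ring

lemma e_q_add_mul {Y W : V} (hYW : bil Y W = 0) (z : ℂ) :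
    e ((q (Y + W) : ℂ) * z) = e ((q Y : ℂ) * z) * e ((q W : ℂ) * z) := by
  rw [q_add, hYW, add_zero, ← e_add, Complex.ofReal_add, add_mul]

lemma raisingTerm_add_mul_deriv_geodesicPath (ha : 0 < a) (hD : 0 < b ^ 2 - 4 * a * c) {Y W : V}
    (hYtr : Y 1 1 = -Y 0 0) (hYA : bil Y (formMatrix a b c) = 0) {r : ℝ}
    (hW : W = r • formMatrix a b c) (s : ℝ) :
    raisingTerm τ (geodesicPath a b c s) (Y + W) * deriv (geodesicPath a b c) s =
      kernel a b c τ 1 0 Y s * (unaryFactor a b c τ *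
        ((bil W (formMatrix a b c) : ℂ) * e ((q W : ℂ) * (starRingEnd ℂ) (τ : ℂ)))) +
      kernel a b c τ 0 1 Y s * (-(4 * Real.pi * τ.im ^ 2 * Complex.I) *
        e ((q W : ℂ) * (starRingEnd ℂ) (τ : ℂ))) := by
  have htr : (Y + W) 1 1 = -(Y + W) 0 0 := by
    simp [hW, formMatrix, hYtr]
    ring
  have hYW : bil Y W = 0 := by rw [hW, bil_smul_right, hYA, mul_zero]
  have hderiv := wirtinger_posDeriv_mul_deriv_geodesicPath ha hD htr s
  rw [bil_add_left, hYA, zero_add, hW, arcProdDeriv_add_smul ha hD, ← hW] at hderiv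
  have hprod : bil (Y + W) (posVec (geodesicPath a b c s)) = arcProd a b c Y s := by
    rw [← arcProd_eq ha hD, hW, arcProd_add_smul ha hD]
  have hexponent (v p : ℝ) : -(2 * Real.pi * (v * p ^ 2)) = -(2 * Real.pi * v) * p ^ 2 := by ring
  rw [raisingTerm, mul_assoc, mul_assoc (siegelTerm _ _ _ * _), hderiv,
    siegelTerm_eq τ (geodesicPath_im_pos ha hD s), hprod, hexponent,
    e_q_add_mul hYW, kernel, kernel, unaryFactor]
  push_cast
  simp only [neg_mul]
  linear_combination (4 * Real.pi * τ.im ^ 2 * √2 / √(b ^ 2 - 4 * a * c) *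
    (bil W (formMatrix a b c) : ℂ) * e ((q W : ℂ) * (starRingEnd ℂ) (τ : ℂ)) *
    e ((q Y : ℂ) * (starRingEnd ℂ) (τ : ℂ)) * (arcProd a b c Y s : ℂ) *
    Complex.exp (-(2 * Real.pi * τ.im * (arcProd a b c Y s : ℂ) ^ 2))) * Complex.I_sq

lemma unaryFactor_mul_sqrt (a b c : ℝ) :
    unaryFactor a b c τ * (√(Real.pi / (2 * Real.pi * τ.im)) : ℝ) =
      -(4 * Real.pi / √(b ^ 2 - 4 * a * c) : ℝ) * ((τ.im ^ (3 / 2 : ℝ) : ℝ) : ℂ) := by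
  have hv := τ.im_pos
  have hgauss : Real.pi / (2 * Real.pi * τ.im) = 1 / (2 * τ.im) := by
    have := Real.pi_pos
    field_simp
  have hpow : τ.im ^ (3 / 2 : ℝ) = τ.im * √τ.im := by
    rw [show (3 / 2 : ℝ) = 1 + 1 / 2 by norm_num, Real.rpow_add hv, Real.rpow_one,
      Real.sqrt_eq_rpow]
  have hsqrt : √τ.im ^ 2 = τ.im := Real.sq_sqrt hv.le
  rw [unaryFactor, ← Complex.ofReal_mul, ← Complex.ofReal_neg, ← Complex.ofReal_mul, hgauss, hpow,
    Real.sqrt_div zero_le_one, Real.sqrt_one, Real.sqrt_mul two_pos.le]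
  congr 1
  field_simp
  rw [hsqrt]

end Splitting

lemma hasSum_mul_add_mul {α β : Type*} {f f' : α → ℂ} {g g' : β → ℂ}
    (hf : Summable fun i => ‖f i‖) (hf' : Summable fun i => ‖f' i‖)
    (hg : Summable fun i => ‖g i‖) (hg' : Summable fun i => ‖g' i‖) :
    HasSum (fun x : α × β => f x.1 * g x.2 + f' x.1 * g' x.2)
      (∑' i, (f i * ∑' j, g j + f' i * ∑' j, g' j)) := by
  rw [(hf.of_norm.mul_right _).tsum_add (hf'.of_norm.mul_right _), tsum_mul_right, tsum_mul_right]
  exact (hf.of_norm.hasSum.mul hg.of_norm.hasSum (summable_mul_of_summable_norm hf hg)).add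
    (hf'.of_norm.hasSum.mul hg'.of_norm.hasSum (summable_mul_of_summable_norm hf' hg'))

section CycleIntegral

variable {a b c : ℤ} (τ : ℍ)

/-- The coefficient of the even part of the kernel attached to a class of `N'/N`. -/
noncomputable def evenCoeff (a b c : ℤ) (τ : ℍ) (δ : Disc (latticeN (formMatrix a b c))) : ℂ :=
  unaryFactor a b c τ * (starRingEnd ℂ) (unaryTheta (formMatrix a b c) τ δ)

/-- The coefficient of the odd part of the kernel attached to a class of `N'/N`. -/
noncomputable def oddCoeff (a b c : ℤ) (τ : ℍ) (δ : Disc (latticeN (formMatrix a b c))) : ℂ :=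
  -(4 * Real.pi * τ.im ^ 2 * Complex.I) *
    ∑' W : {W : dual (latticeN (formMatrix (a : ℝ) b c)) // toDisc _ W = δ},
      e ((q W.1 : ℂ) * (starRingEnd ℂ) (τ : ℂ))

/-- The contribution to the integrand of the cycle integral of the vectors `Y + W` with `Y ∈ I'`
and `W ∈ N'` in given classes. -/
noncomputable def classKernel (a b c : ℤ) (τ : ℍ) (δI : Disc (latticeI (formMatrix a b c)))
    (δN : Disc (latticeN (formMatrix a b c))) (s : ℝ) : ℂ :=
  ∑' Y : {Y : dual (latticeI (formMatrix (a : ℝ) b c)) // toDisc _ Y = δI},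
    kernel a b c τ (evenCoeff a b c τ δN) (oddCoeff a b c τ δN) Y.1 s

lemma hasSum_classKernel (ha : 0 < (a : ℝ)) (hD : 0 < (b : ℝ) ^ 2 - 4 * a * c)
    (δI : Disc (latticeI (formMatrix a b c))) (δN : Disc (latticeN (formMatrix a b c))) (s : ℝ) :
    HasSum (fun x : {Y : dual (latticeI (formMatrix (a : ℝ) b c)) // toDisc _ Y = δI} ×
        {W : dual (latticeN (formMatrix (a : ℝ) b c)) // toDisc _ W = δN} =>
      raisingTerm τ (geodesicPath a b c s) ((x.1.1 : V) + x.2.1) * deriv (geodesicPath a b c) s)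
      (classKernel a b c τ δI δN s) := by
  have heven := summable_norm_bil_mul_e_dual_latticeN τ ha hD fun W => toDisc _ W = δN
  have hodd := summable_norm_e_dual_latticeN τ ha hD fun W => toDisc _ W = δN
  have hsum := hasSum_mul_add_mul (summable_kernel τ 1 0 ha hD (fun Y => toDisc _ Y = δI) s)
    (summable_kernel τ 0 1 ha hD (fun Y => toDisc _ Y = δI) s)
    ((heven.mul_left ‖unaryFactor a b c τ‖).congr fun W => (norm_mul _ _).symm)
    ((hodd.mul_left ‖(-(4 * Real.pi * τ.im ^ 2 * Complex.I) : ℂ)‖).congr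
      fun W => (norm_mul _ _).symm)
  rw [tsum_mul_left, tsum_mul_left, tsum_bil_mul_e] at hsum
  rw [classKernel, tsum_congr fun Y : {Y // toDisc _ Y = δI} => kernel_eq_linear τ _ _ Y.1 s]
  refine hsum.congr_fun fun x => ?_
  obtain ⟨r, hr⟩ := exists_smul_of_mem_dual_latticeN x.2.1.2
  exact raisingTerm_add_mul_deriv_geodesicPath τ ha hD
    (traceless_of_mem_dual (latticeI_le _) x.1.1.2) (perp_of_mem_dual_latticeI x.1.1.2) hr s

lemma cycleIntegrand_raising_siegelTheta (ha : 0 < (a : ℝ)) (hD : 0 < (b : ℝ) ^ 2 - 4 * a * c)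
    (hA : formMatrix (a : ℝ) b c ∈ dual latticeL)
    (hA0 : bil (formMatrix (a : ℝ) b c) (formMatrix a b c) ≠ 0) (γ : Disc latticeL) (s : ℝ) :
    cycleIntegrand a b c 1 (raising 0 (fun z : ℂ => siegelTheta τ z γ)) s =
      ∑' β : SupQuotient (formMatrix a b c),
        classKernel a b c τ (classI hA hA0 γ β) (classN hA hA0 γ β) s := by
  have hraising := (hasSum_raising_siegelTheta τ γ (geodesicPath_im_pos ha hD s)).mul_right
    (deriv (geodesicPath a b c) s)
  have hsum := (Equiv.ofBijective (cosetMap hA hA0 γ)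
    ⟨injective_cosetMap hA hA0 γ, surjective_cosetMap hA hA0 γ⟩).hasSum_iff.2 hraising
  rw [cycleIntegrand, sub_self, zpow_zero, mul_one]
  exact (hsum.sigma fun β => hasSum_classKernel τ ha hD (classI hA hA0 γ β)
    (classN hA hA0 γ β) s).tsum_eq.symm

variable {g₀ : SL(2, ℤ)} (δI : Disc (latticeI (formMatrix (a : ℝ) b c)))
  (δN : Disc (latticeN (formMatrix (a : ℝ) b c)))

lemma integrableOn_classKernel (ha : 0 < (a : ℝ)) (hD : 0 < (b : ℝ) ^ 2 - 4 * a * c) (T : ℝ) :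
    IntegrableOn (classKernel a b c τ δI δN) (Set.Ioc 0 T) :=
  (continuousOn_tsum_kernel τ _ _ ha hD _ T).integrableOn_Icc.mono_set Set.Ioc_subset_Icc_self

lemma classKernel_vadd (ha : 0 < (a : ℝ)) (hD : 0 < (b : ℝ) ^ 2 - 4 * a * c)
    (hg₀ : IsGenerator a b c g₀) (t : AddSubgroup.zmultiples (shift (a : ℝ) b c g₀)) (s : ℝ) :
    classKernel a b c τ δI δN (t +ᵥ s) = classKernel a b c τ δI δN s := by
  obtain ⟨_, j, rfl⟩ := t
  have hvadd : (⟨_, j, rfl⟩ : AddSubgroup.zmultiples (shift (a : ℝ) b c g₀)) +ᵥ s =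
      s + shift a b c (g₀ ^ j) := by
    rw [shift_zpow ha hD hg₀.mem, add_comm, ← zsmul_eq_mul]
    rfl
  rw [hvadd]
  exact tsum_kernel_add_shift τ _ _ ha hD (zpow_mem hg₀.mem j) δI s

lemma integral_classKernel (ha : 0 < (a : ℝ)) (hD : 0 < (b : ℝ) ^ 2 - 4 * a * c)
    (hsq : ¬IsSquare (b ^ 2 - 4 * a * c)) (hg₀ : IsGenerator a b c g₀) :
    ∫ s in Set.Ioc 0 (shift a b c g₀), classKernel a b c τ δI δN s =
      -(4 * Real.pi / √((b : ℝ) ^ 2 - 4 * a * c) : ℝ) * (heckeTheta a b c τ δI *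
        ((starRingEnd ℂ) (unaryTheta (formMatrix a b c) τ δN) *
          ((τ.im ^ (3 / 2 : ℝ) : ℝ) : ℂ))) := by
  have hfactor := unaryFactor_mul_sqrt τ a b c
  simp only [classKernel]
  rw [integral_tsum_kernel τ _ _ ha hD hsq hg₀, evenCoeff]
  linear_combination (starRingEnd ℂ (unaryTheta (formMatrix a b c) τ δN)) *
    heckeTheta a b c τ δI * hfactor

lemma hasCycleIntegral_raising_siegelTheta (ha : 0 < (a : ℝ)) (hD : 0 < (b : ℝ) ^ 2 - 4 * a * c)
    (hsq : ¬IsSquare (b ^ 2 - 4 * a * c)) (hg₀ : IsGenerator a b c g₀) (γ : Disc latticeL) :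
    HasCycleIntegral a b c 1 (raising 0 (fun z : ℂ => siegelTheta τ z γ))
      (-(4 * Real.pi / √((b : ℝ) ^ 2 - 4 * a * c) : ℝ) *
        up latticeL (tensor (formMatrix a b c) (heckeTheta a b c τ)
          (fun δ => (starRingEnd ℂ) (unaryTheta (formMatrix a b c) τ δ) *
            ((τ.im ^ (3 / 2 : ℝ) : ℝ) : ℂ))) γ) := by
  have hA := formMatrix_mem_dual a b c
  have hA0 := bil_formMatrix_self_ne_zero hD
  have := finite_quotient_sup hA hA0
  have := Fintype.ofFinite (SupQuotient (formMatrix (a : ℝ) b c))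
  have hcycle : cycleIntegrand a b c 1 (raising 0 (fun z : ℂ => siegelTheta τ z γ)) = fun s =>
      ∑ β, classKernel a b c τ (classI hA hA0 γ β) (classN hA hA0 γ β) s := by
    funext s
    rw [cycleIntegrand_raising_siegelTheta τ ha hD hA hA0, tsum_fintype]
  refine ⟨exists_isFundDomain ha hD hg₀, fun F hF => ?_⟩
  have hfund := isAddFundamentalDomain_params ha hD hg₀ hF
  have hIoc := isAddFundamentalDomain_Ioc hg₀.shift_pos 0
  rw [zero_add] at hIoc
  have hperiod (t : AddSubgroup.zmultiples (shift (a : ℝ) b c g₀)) (s : ℝ) :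
      ∑ β, classKernel a b c τ (classI hA hA0 γ β) (classN hA hA0 γ β) (t +ᵥ s) =
        ∑ β, classKernel a b c τ (classI hA hA0 γ β) (classN hA hA0 γ β) s :=
    Finset.sum_congr rfl fun β _ => classKernel_vadd τ _ _ ha hD hg₀ t s
  have hint (β) := integrableOn_classKernel τ (classI hA hA0 γ β) (classN hA hA0 γ β) ha hD
    (shift a b c g₀)
  rw [hcycle, hfund.integrableOn_iff hIoc hperiod, hfund.setIntegral_eq hIoc hperiod,
    integral_finsetSum _ fun β _ => hint β, up, finsum_eq_sum_of_fintype, Finset.mul_sum]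
  refine ⟨integrable_finsetSum _ fun β _ => hint β, Finset.sum_congr rfl fun β _ => ?_⟩
  rw [integral_classKernel τ _ _ ha hD hsq hg₀, ← coeff_tensor_cosetRep hA hA0
    (heckeTheta a b c τ) (fun δ => (starRingEnd ℂ) (unaryTheta (formMatrix a b c) τ δ) *
      ((τ.im ^ (3 / 2 : ℝ) : ℝ) : ℂ)) γ β, cosetRep]

end CycleIntegral

end SiegelTheta

theorem theorem3p1 (a b c : ℤ) (ha : 0 < a) (hD : 0 < b ^ 2 - 4 * a * c)
    (hsq : ¬ IsSquare (b ^ 2 - 4 * a * c)) (τ : ℍ) :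
    (∀ (γ : Disc latticeL) (z : ℂ), 0 < z.im →
      Summable (fun X : {X : dual latticeL // toDisc latticeL X = γ} => siegelTerm τ z X.1) ∧
        DifferentiableAt ℝ (fun z : ℂ => siegelTheta τ z γ) z) ∧
    (∀ γ : Disc (latticeI (formMatrix a b c)),
      Summable (fun Y : Quotient (heckeSetoid (formMatrix a b c) γ) =>
        heckeTerm a b c τ (Quotient.out Y).1)) ∧
    (∀ γ : Disc (latticeN (formMatrix a b c)),
      Summable (fun W : {W : dual (latticeN (formMatrix a b c)) //
        toDisc (latticeN (formMatrix a b c)) W = γ} => unaryTerm (formMatrix a b c) τ W.1)) ∧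
    Finite (latticeL ⧸ (latticeI (formMatrix a b c) ⊔ latticeN (formMatrix a b c)).addSubgroupOf
      latticeL) ∧
    ∀ γ : Disc latticeL,
      HasCycleIntegral a b c 1 (raising 0 (fun z : ℂ => siegelTheta τ z γ))
        (-(4 * Real.pi / √((b : ℝ) ^ 2 - 4 * a * c) : ℝ) *
          up latticeL (tensor (formMatrix a b c) (heckeTheta a b c τ)
            (fun δ => (starRingEnd ℂ) (unaryTheta (formMatrix a b c) τ δ) *
              ((τ.im ^ (3 / 2 : ℝ) : ℝ) : ℂ))) γ) := by
  have ha' : (0 : ℝ) < a := by exact_mod_cast ha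
  have hD' : 0 < (b : ℝ) ^ 2 - 4 * a * c := by exact_mod_cast hD
  obtain ⟨g₀, hg₀⟩ := exists_isGenerator ha' hD hsq
  exact ⟨fun γ z hz => ⟨summable_siegelTerm τ γ hz, differentiableAt_siegelTheta τ γ hz⟩,
    summable_heckeTerm τ ha' hD' hg₀, summable_unaryTerm τ ha' hD',
    finite_quotient_sup (formMatrix_mem_dual a b c) (bil_formMatrix_self_ne_zero hD'),
    hasCycleIntegral_raising_siegelTheta τ ha' hD' hsq hg₀⟩
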